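/- Let $n\ge 3$, and let $\omega_{n-1}$ be the area of the unit sphere $S^{n-1}\subset\mathbb R^n$. Let $\mathrm{RotSym}^\partial_n$ be the class of smooth, metrically complete Riemannian metrics $g$ on $M=\{x\in\mathbb R^n:|x|\ge 1\}\cong[0,\infty)\times S^{n-1}$ that are invariant under $SO(n)$, have nonnegative scalar curvature, and whose boundary $\partial M$ is a minimal hypersurface that is outermost (no other closed minimal hypersurface encloses it) and outer-minimizing (every closed hypersurface enclosing it has area at least $|\partial M|$). Write $g=ds^2+r(s)^2g_{S^{n-1}}$, where $s$ is the distance from $\partial M$. Assume in addition that $r$ is unbounded, so that $r$ takes every value in $[r_0,\infty)$, where $r_0=r(0)=(|\partial M|/\omega_{n-1})^{1/(n-1)}$. Put $$m_{\mathrm{ADM}}=\lim_{s\to\infty}\frac{r^{n-2}}{2}\Bigl(1-\Bigl(\frac{dr}{ds}\Bigr)^2\Bigr),\qquad m_0=\frac12\Bigl(\frac{|\partial M|}{\omega_{n-1}}\Bigr)^{\frac{n-2}{n-1}} .$$ For $m>0$ and $L\ge 0$, let $M_{\mathrm{Sch}}(m,L)$ be the Schwarzschild space $\{r\ge(2m)^{1/(n-2)}\}$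 with metric $(1-2m/r^{n-2})^{-1}dr^2+r^2g_{S^{n-1}}$, with the Riemannian cylinder $[-L,0]\times S^{n-1}$ of radius $(2m)^{1/(n-2)}$ glued to its boundary. The Schwarzschild space embeds isometrically in $\mathbb R^{n+1}$ as the graph of the radial function $z_{\mathrm{Sch}}(r)=\int_{(2m)^{1/(n-2)}}^{r}\sqrt{2m/(x^{n-2}-2m)}\,dx$. Depth: if $m_{\mathrm{ADM}}<\infty$, define $\delta_M\ge0$ by $m_{\mathrm{ADM}}=(1+\delta_M)m_0$, put $r_{\delta_M}=(1+\sqrt{\delta_M})^{1/(n-2)}r_0$, and embed $M$ isometrically in $\mathbb R^{n+1}$ as the graph of an increasing radial function $z(r)$ (so $dz^2=ds^2-dr^2$), normalized so that it meets the graph of $M_{\mathrm{Sch}}(m_0)$ at $r=r_{\delta_M}$. The depth of $M$ is $L=-z(r_0)$. The Lipschitz distance of metric spaces is $d_{\mathcal L}(X,Y)=\inf_\varphi\bigl(|\log\operatorname{dil}\varphi|+|\log\operatorname{dil}\varphi^{-1}|\bigr)$ over bi-Lipschitz bijections $\varphi:X\to Y$, where $\operatorname{dil}\varphi=\sup_{x_1\ne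 x_2}d_Y(\varphi(x_1),\varphi(x_2))/d_X(x_1,x_2)$ (it is $\infty$ if there are none). Theorem. For every $n\ge3$ and every $\varepsilon>0$ there is $\delta>0$ such that every $M\in\mathrm{RotSym}^\partial_n$ with $r$ unbounded and $$m_{\mathrm{ADM}}\le\frac{1+\delta}{2}\Bigl(\frac{|\partial M|}{\omega_{n-1}}\Bigr)^{\frac{n-2}{n-1}}$$ has depth $L\ge0$ and satisfies $d_{\mathcal L}\bigl(M,M_{\mathrm{Sch}}(m_0,L)\bigr)<\varepsilon$. -/

import Mathlib

namespace Penrose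

open MeasureTheory Filter Topology Set
open scoped ENNReal ContDiff Matrix

noncomputable section

/-! ### Length distances and the Lipschitz distance -/

/-- The length of a curve `γ : [0,1] → E` for the length element `√(G x v)`. -/
def curveLength {E : Type*} [NormedAddCommGroup E] [NormedSpace ℝ E]
    (G : E → E → ℝ) (γ : ℝ → E) : ℝ≥0∞ :=
  ∫⁻ t in Icc (0 : ℝ) 1, ENNReal.ofReal (√(G (γ t) (deriv γ t)))

/-- The Riemannian distance on `S ⊆ E`: infimum of the lengths of the Lipschitz curves inside `S`
joining two points.  (For a continuous metric this is the same infimum as over piecewise `C¹`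
curves.) -/
def lengthDist {E : Type*} [NormedAddCommGroup E] [NormedSpace ℝ E]
    (G : E → E → ℝ) (S : Set E) (x y : S) : ℝ≥0∞ :=
  ⨅ (γ : ℝ → E) (_ : (∃ K, LipschitzOnWith K γ (Icc 0 1)) ∧ (∀ t ∈ Icc (0 : ℝ) 1, γ t ∈ S) ∧
      γ 0 = x ∧ γ 1 = y), curveLength G γ

/-- Metric completeness with respect to a distance function: Cauchy sequences converge. -/
def IsCompleteDist {X : Type*} (d : X → X → ℝ≥0∞) : Prop :=
  ∀ x : ℕ → X, (∀ ε : ℝ≥0∞, 0 < ε → ∃ N, ∀ i ≥ N, ∀ j ≥ N, d (x i) (x j) < ε) →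
    ∃ y, Tendsto (fun i => d (x i) y) atTop (𝓝 0)

/-- The dilation `sup_{x₁ ≠ x₂} d_Y(φ x₁, φ x₂) / d_X(x₁, x₂)`. -/
def dil {X Y : Type*} (dX : X → X → ℝ≥0∞) (dY : Y → Y → ℝ≥0∞) (φ : X → Y) : ℝ≥0∞ :=
  ⨆ (x₁ : X) (x₂ : X) (_ : x₁ ≠ x₂), dY (φ x₁) (φ x₂) / dX x₁ x₂

/-- The Lipschitz distance: infimum of `|log dil φ| + |log dil φ⁻¹|` over all bi-Lipschitz
bijections `φ : X → Y`; it is `∞` when there are none. -/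
def lipschitzDist {X Y : Type*} (dX : X → X → ℝ≥0∞) (dY : Y → Y → ℝ≥0∞) : ℝ≥0∞ :=
  ⨅ (φ : X ≃ Y) (_ : dil dX dY φ < ⊤ ∧ dil dY dX φ.symm < ⊤),
    ENNReal.ofReal (|Real.log (dil dX dY φ).toReal| + |Real.log (dil dY dX φ.symm).toReal|)

/-! ### Riemannian metrics on the exterior region `{‖x‖ ≥ 1} ≅ [0,∞) × S^{n-1}` -/

/-- Euclidean `n`-space. -/
abbrev V (n : ℕ) := EuclideanSpace ℝ (Fin n)

/-- The manifold with boundary `{x ∈ ℝⁿ : ‖x‖ ≥ 1}`, diffeomorphic to `[0,∞) × S^{n-1}`. -/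
def ext (n : ℕ) : Set (V n) := {x | 1 ≤ ‖x‖}

/-- Partial derivative of a function on `ext n` (one-sided at the boundary). -/
def pd {n : ℕ} (i : Fin n) (f : V n → ℝ) (x : V n) : ℝ :=
  fderivWithin ℝ f (ext n) x (EuclideanSpace.single i 1)

/-- `f` is smooth on `ext n`, up to and including the boundary. -/
def SmoothOnExt {n : ℕ} (f : V n → ℝ) : Prop := ContDiffOn ℝ ∞ f (ext n)

/-- A metric tensor given by its coefficients `g x i j = g_{ij}(x)`. -/
abbrev MetricTensor (n : ℕ) := V n → Matrix (Fin n) (Fin n) ℝ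

/-- `g` is a smooth Riemannian metric on `ext n`. -/
def IsRiemannian {n : ℕ} (g : MetricTensor n) : Prop :=
  (∀ i j, SmoothOnExt (fun x => g x i j)) ∧ ∀ x ∈ ext n, (g x).PosDef

/-- The square norm `g_x(v, v)`. -/
def normSq {n : ℕ} (g : MetricTensor n) (x v : V n) : ℝ := ∑ i, ∑ j, g x i j * v i * v j

/-- The Riemannian distance of `g`. -/
def gDist {n : ℕ} (g : MetricTensor n) : ext n → ext n → ℝ≥0∞ := lengthDist (normSq g) (ext n)

/-- Christoffel symbols `Γ^k_{ij}`. -/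
def christoffel {n : ℕ} (g : MetricTensor n) (k i j : Fin n) (x : V n) : ℝ :=
  (1 / 2) * ∑ l, (g x)⁻¹ k l *
    (pd i (fun y => g y j l) x + pd j (fun y => g y i l) x - pd l (fun y => g y i j) x)

/-- Ricci curvature `R_{ij} = ∂_k Γ^k_{ij} - ∂_j Γ^k_{ik} + Γ^k_{kl} Γ^l_{ij} - Γ^k_{jl} Γ^l_{ik}`. -/
def ricci {n : ℕ} (g : MetricTensor n) (i j : Fin n) (x : V n) : ℝ :=
  ∑ k, (pd k (christoffel g k i j) x - pd j (christoffel g k i k) x +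
    ∑ l, (christoffel g k k l x * christoffel g l i j x -
      christoffel g k j l x * christoffel g l i k x))

/-- Scalar curvature `g^{ij} R_{ij}`. -/
def scalarCurv {n : ℕ} (g : MetricTensor n) (x : V n) : ℝ :=
  ∑ i, ∑ j, (g x)⁻¹ i j * ricci g i j x

/-- `g` is invariant under `SO(n)`: the action `x ↦ A x` is by isometries. -/
def IsRotInvariant {n : ℕ} (g : MetricTensor n) : Prop :=
  ∀ A ∈ Matrix.specialOrthogonalGroup (Fin n) ℝ, ∀ x ∈ ext n,
    Aᵀ * g (Matrix.toEuclideanLin A x) * A = g x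

/-! ### Hypersurfaces, given as regular level sets -/

/-- The hypersurface `{u = 0}` in `ext n`. -/
def levelSet {n : ℕ} (u : V n → ℝ) : Set (V n) := {x | x ∈ ext n ∧ u x = 0}

/-- `|∇u|_g = (g^{ij} ∂_i u ∂_j u)^{1/2}`. -/
def gradNorm {n : ℕ} (g : MetricTensor n) (u : V n → ℝ) (x : V n) : ℝ :=
  √(∑ i, ∑ j, (g x)⁻¹ i j * pd i u x * pd j u x)

/-- The mean curvature at `x` of the level set of `u` through `x`, with respect to the normal
`∇u/|∇u|`: the divergence `div_g (∇u/|∇u|)`. -/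
def meanCurv {n : ℕ} (g : MetricTensor n) (u : V n → ℝ) (x : V n) : ℝ :=
  (1 / √(g x).det) *
    ∑ i, pd i (fun y => √(g y).det * (∑ j, (g y)⁻¹ i j * pd j u y) / gradNorm g u y) x

/-- `{u = 0}` is a minimal hypersurface. -/
def IsMinimal {n : ℕ} (g : MetricTensor n) (u : V n → ℝ) : Prop :=
  ∀ x ∈ levelSet u, meanCurv g u x = 0

/-- The `g`-area of `{u = 0}`: the area element of `g` is `√(det g) |ν|_g` times the Euclidean
one, where `ν = du/|du|` is the Euclidean unit conormal. -/
def area {n : ℕ} (g : MetricTensor n) (u : V n → ℝ) : ℝ≥0∞ :=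
  ∫⁻ x in levelSet u,
    ENNReal.ofReal (√(g x).det * gradNorm g u x / √(∑ i, (pd i u x) ^ 2))
    ∂(Measure.euclideanHausdorffMeasure (n - 1))

/-- `{u = 0}` is a closed smooth embedded hypersurface in the interior, bounding together with
the boundary `{‖x‖ = 1}` the compact region `{u ≤ 0}`. -/
def IsEnclosing {n : ℕ} (u : V n → ℝ) : Prop :=
  SmoothOnExt u ∧ (∀ x, ‖x‖ = 1 → u x < 0) ∧ IsCompact {x | x ∈ ext n ∧ u x ≤ 0} ∧
    ∀ x ∈ levelSet u, fderivWithin ℝ u (ext n) x ≠ 0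

/-- Defining function of the symmetric sphere `{‖x‖ = ρ}`; `ρ = 1` is the boundary. -/
def sph {n : ℕ} (ρ : ℝ) (x : V n) : ℝ := ‖x‖ - ρ

/-- The class of complete rotationally symmetric metrics of nonnegative scalar curvature whose
boundary is an outermost and outer-minimizing minimal hypersurface. -/
structure IsRotSym {n : ℕ} (g : MetricTensor n) : Prop where
  riemannian : IsRiemannian g
  rotInvariant : IsRotInvariant g
  complete : IsCompleteDist (gDist g)
  scalar_nonneg : ∀ x ∈ ext n, 0 ≤ scalarCurv g x
  boundary_minimal : IsMinimal g (sph 1)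
  outermost : ∀ u, IsEnclosing u → ¬ IsMinimal g u
  outer_minimizing : ∀ u, IsEnclosing u → area g (sph 1) ≤ area g u

/-! ### Area radius, Hawking mass, ADM mass -/

/-- `ω_{n-1}`, the area of the Euclidean unit sphere in `ℝⁿ`. -/
def omega (n : ℕ) : ℝ :=
  (Measure.euclideanHausdorffMeasure (n - 1) (Metric.sphere (0 : V n) 1)).toReal

/-- The area of the boundary. -/
def boundaryArea {n : ℕ} (g : MetricTensor n) : ℝ := (area g (sph 1)).toReal

/-- The function `r`: the area of the symmetric sphere `{‖x‖ = ρ}` is `ω_{n-1} r^{n-1}`. -/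
def areaRadius {n : ℕ} (g : MetricTensor n) (ρ : ℝ) : ℝ :=
  ((area g (sph ρ)).toReal / omega n) ^ (1 / ((n : ℝ) - 1))

/-- The radii of the symmetric spheres are unbounded, i.e. `r` takes all values in `[r₀, ∞)`. -/
def UnboundedRadii {n : ℕ} (g : MetricTensor n) : Prop :=
  ∀ R : ℝ, ∃ ρ, 1 ≤ ρ ∧ R < areaRadius g ρ

/-- A unit vector of `ℝⁿ` (any other gives the same for rotationally symmetric `g`). -/
def unitVec (n : ℕ) : V n := WithLp.toLp 2 (fun _ => 1 / √(n : ℝ))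

/-- `ds/dρ`, where `s` is the arc length along radial geodesics, the distance to the boundary. -/
def radialSpeed {n : ℕ} (g : MetricTensor n) (ρ : ℝ) : ℝ :=
  √(normSq g (ρ • unitVec n) (unitVec n))

/-- The Hawking mass `(r^{n-2}/2) (1 - (dr/ds)²)` of the symmetric sphere `{‖x‖ = ρ}`. -/
def hawkingMass {n : ℕ} (g : MetricTensor n) (ρ : ℝ) : ℝ :=
  areaRadius g ρ ^ (n - 2) / 2 * (1 - (deriv (areaRadius g) ρ / radialSpeed g ρ) ^ 2)

/-- The ADM mass, the limit of the Hawking masses in `[-∞, ∞]`. -/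
def admMass {n : ℕ} (g : MetricTensor n) : EReal :=
  limUnder atTop (fun ρ => (hawkingMass g ρ : EReal))

/-- `m₀ = (1/2) (|∂M|/ω_{n-1})^{(n-2)/(n-1)}`. -/
def mZero {n : ℕ} (g : MetricTensor n) : ℝ :=
  1 / 2 * (boundaryArea g / omega n) ^ (((n : ℝ) - 2) / ((n : ℝ) - 1))

/-! ### Appended Schwarzschild spaces -/

/-- The radius `(2m)^{1/(n-2)}` of the horizon. -/
def horizonRadius (n : ℕ) (m : ℝ) : ℝ := (2 * m) ^ (1 / ((n : ℝ) - 2))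

/-- The height `z(r)` of the Schwarzschild graph, with `dz/dr = √(2m/(r^{n-2} - 2m))` and
`z = 0` at the horizon, so that `dr² + dz² = (1 - 2m/r^{n-2})⁻¹ dr²`. -/
def schwHeight (n : ℕ) (m r : ℝ) : ℝ :=
  ∫ x in horizonRadius n m..r, √(2 * m / (x ^ (n - 2) - 2 * m))

/-- `M_Sch(m, L)` as a rotational hypersurface in `ℝⁿ × ℝ`: the graph of `z(|x|)` over the outside
of the horizon, with the cylinder `[-L, 0] × S^{n-1}` glued to its boundary at height `0`. -/
def schwSpace (n : ℕ) (m L : ℝ) : Set (V n × ℝ) :=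
  {p | (horizonRadius n m ≤ ‖p.1‖ ∧ p.2 = schwHeight n m ‖p.1‖) ∨
    (‖p.1‖ = horizonRadius n m ∧ -L ≤ p.2 ∧ p.2 ≤ 0)}

/-- The intrinsic Riemannian distance of `M_Sch(m, L)`, for the metric induced from the Euclidean
metric of `ℝⁿ × ℝ`. -/
def schwDist (n : ℕ) (m L : ℝ) : schwSpace n m L → schwSpace n m L → ℝ≥0∞ :=
  lengthDist (fun _ v => ‖v.1‖ ^ 2 + v.2 ^ 2) (schwSpace n m L)

/-! ### Depth -/

/-- The height above `∂M` of the sphere `{‖x‖ = ρ}` when `M` is embedded in `ℝⁿ × ℝ` as a radial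
graph: `dz² = ds² - dr²`. -/
def graphHeight {n : ℕ} (g : MetricTensor n) (ρ : ℝ) : ℝ :=
  ∫ t in (1 : ℝ)..ρ, √(radialSpeed g t ^ 2 - deriv (areaRadius g) t ^ 2)

/-- The number `δ` with `m_ADM = ((1 + δ)/2) (|∂M|/ω_{n-1})^{(n-2)/(n-1)} = (1 + δ) m₀`. -/
def massExcess {n : ℕ} (g : MetricTensor n) : ℝ := (admMass g).toReal / mZero g - 1

/-- `r_δ = (1 + √δ)^{1/(n-2)} r₀`. -/
def rDelta {n : ℕ} (g : MetricTensor n) : ℝ :=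
  (1 + √(massExcess g)) ^ (1 / ((n : ℝ) - 2)) * areaRadius g 1

/-- The coordinate `ρ` of the symmetric sphere of area radius `r_δ`. -/
def rhoDelta {n : ℕ} (g : MetricTensor n) : ℝ := sInf {ρ | 1 ≤ ρ ∧ areaRadius g ρ = rDelta g}

/-- The depth `L`: when the graph of `M` is placed so that it meets the graph of `M_Sch(m₀)` at
`r = r_δ`, its boundary lies at height `-L`, i.e. `-L + graphHeight = schwHeight` there. -/
def depth {n : ℕ} (g : MetricTensor n) : ℝ :=
  graphHeight g (rhoDelta g) - schwHeight n (mZero g) (rDelta g)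

end

end Penrose

namespace Penrose
open MeasureTheory Filter Topology Set
open scoped ENNReal ContDiff Matrix
noncomputable section

/-! ### Partial derivatives on the exterior region -/

/-! Everything is carried by the profile curve of radius r and height z as functions of arc length
s. Write T = r^(n-2), p = r₀^(n-2) and u = (dr/ds)². Nonnegative scalar curvature makes the Hawking
mass T(1 - u)/2 nondecreasing, and minimality of the boundary gives u = 0 there. An outermost
boundary and unbounded radii make r increasing. Hence p ≤ T(1 - u) ≤ (1 + σ²)p everywhere, with σ =
√δ_M.

The two inequalities are effective in complementary regions. Where T ≤ (1 + σ)p, the lower one gives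
(1 + σ)(1 - u) ≥ 1: the profile is almost vertical, radii hardly vary, and height measures length up
to a factor near 1. There M is matched with the Schwarzschild space by height, negative heights
going to the cylinder. Where T ≥ (1 + σ)p, the upper one gives Tu ≥ (1 - σ)(T - p), so ds² and the
Schwarzschild element at the same radius differ by a factor at most 1/(1 - σ). There M is matched by
radius. The definition of the depth makes both rules agree at the seam r = r_δ. The depth is
nonnegative because the lower inequality makes the profile at least as steep as Schwarzschild at
every radius.

The reduction to profiles is `IsRotSym.exists_warpData`: `HasForm.scalarCurv_eq` and
`mass_hasDerivWithinAt` display the same expression, which is the monotonicity of the mass. The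
matching is `WarpData.exists_comparison`, with constant K = 1/(1 - s₀) for an upper bound s₀ < 1 of
σ. Rotating it, `IsComparison.exists_equiv` gives a bijection changing distances by factors at most
K, and `lipschitzDist_le` bounds the Lipschitz distance by 2 log K. -/

theorem uniqueDiffWithinAt_ext {n : ℕ} {x : V n} (hx : x ∈ ext n) :
    UniqueDiffWithinAt ℝ (ext n) x := by
  have hx1 : (1 : ℝ) ≤ ‖x‖ := hx
  -- `ext n` is not convex, but by Cauchy–Schwarz it contains this half-space, which has x on its
  -- boundary. Unique differentiability passes from the half-space to the larger set.
  have hconv : Convex ℝ {y : V n | ‖x‖ ^ 2 ≤ inner ℝ x y} :=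
    convex_halfSpace_ge (innerₗ (V n) x).isLinear _
  have hcont : Continuous fun y : V n => inner ℝ x y := by fun_prop
  have hopen : IsOpen {y : V n | ‖x‖ ^ 2 < inner ℝ x y} := isOpen_lt continuous_const hcont
  have hsub : {y : V n | ‖x‖ ^ 2 ≤ inner ℝ x y} ⊆ ext n := by
    intro y hy
    have h1 : ‖x‖ ^ 2 ≤ ‖x‖ * ‖y‖ := le_trans hy (real_inner_le_norm x y)
    have : ‖x‖ ≤ ‖y‖ := by nlinarith
    exact hx1.trans this
  have hint : (interior {y : V n | ‖x‖ ^ 2 ≤ inner ℝ x y}).Nonempty := by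
    have hsub' : {y : V n | ‖x‖ ^ 2 < inner ℝ x y} ⊆ {y : V n | ‖x‖ ^ 2 ≤ inner ℝ x y} :=
      fun y hy => le_of_lt (show ‖x‖ ^ 2 < inner ℝ x y from hy)
    refine ⟨(2 : ℝ) • x, interior_maximal hsub' hopen ?_⟩
    show ‖x‖ ^ 2 < inner ℝ x ((2 : ℝ) • x)
    rw [real_inner_smul_right, real_inner_self_eq_norm_sq]
    nlinarith
  refine (uniqueDiffWithinAt_convex hconv hint (subset_closure ?_)).mono hsub
  show ‖x‖ ^ 2 ≤ inner ℝ x x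
  rw [real_inner_self_eq_norm_sq]

/-- The Kronecker symbol. -/
def kd {n : ℕ} (i j : Fin n) : ℝ := if i = j then 1 else 0

theorem kd_comm {n : ℕ} (i j : Fin n) : kd i j = kd j i := by simp [kd, eq_comm]

theorem kd_self {n : ℕ} (i : Fin n) : kd i i = 1 := by simp [kd]

theorem sum_kd_mul {n : ℕ} (j : Fin n) (f : Fin n → ℝ) : ∑ k, kd k j * f k = f j := by
  simp [kd]

theorem sum_kd_mul' {n : ℕ} (j : Fin n) (f : Fin n → ℝ) : ∑ k, kd j k * f k = f j := by
  simp [kd]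

/-- `f` is differentiable on `ext n` at `x`, with `i`-th partial derivative `d`. -/
def HasPd {n : ℕ} (i : Fin n) (f : V n → ℝ) (x : V n) (d : ℝ) : Prop :=
  ∃ L : V n →L[ℝ] ℝ, HasFDerivWithinAt f L (ext n) x ∧ L (EuclideanSpace.single i 1) = d

namespace HasPd

variable {n : ℕ} {i : Fin n} {f f' : V n → ℝ} {x : V n} {d d' : ℝ}

theorem pd_eq (h : HasPd i f x d) (hx : x ∈ ext n) : pd i f x = d := by
  obtain ⟨L, hL, rfl⟩ := h
  rw [pd, hL.fderivWithin (uniqueDiffWithinAt_ext hx)]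

theorem congr (h : HasPd i f x d) (hx : x ∈ ext n) (hf : ∀ y ∈ ext n, f' y = f y) :
    HasPd i f' x d := by
  obtain ⟨L, hL, h⟩ := h
  exact ⟨L, hL.congr hf (hf x hx), h⟩

theorem congr_deriv (h : HasPd i f x d) (hd : d = d') : HasPd i f x d' := hd ▸ h

theorem const (c : ℝ) : HasPd i (fun _ => c) x 0 :=
  ⟨0, hasFDerivWithinAt_const c x _, rfl⟩

theorem coord (j : Fin n) : HasPd i (fun y => y j) x (kd i j) := by
  refine ⟨EuclideanSpace.proj (𝕜 := ℝ) j,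
    (EuclideanSpace.proj (𝕜 := ℝ) j : V n →L[ℝ] ℝ).hasFDerivWithinAt, ?_⟩
  simp [kd, eq_comm]

theorem add (h : HasPd i f x d) (h' : HasPd i f' x d') :
    HasPd i (fun y => f y + f' y) x (d + d') := by
  obtain ⟨L, hL, rfl⟩ := h
  obtain ⟨L', hL', rfl⟩ := h'
  exact ⟨L + L', hL.add hL', rfl⟩

theorem mul (h : HasPd i f x d) (h' : HasPd i f' x d') :
    HasPd i (fun y => f y * f' y) x (d * f' x + f x * d') := by
  obtain ⟨L, hL, rfl⟩ := h
  obtain ⟨L', hL', rfl⟩ := h'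
  refine ⟨_, hL.mul hL', ?_⟩
  simp
  ring

/-- The chain rule for functions of `‖x‖²`. -/
theorem radial {F : ℝ → ℝ} {D : ℝ}
    (h : HasDerivWithinAt F D (Ici 1) (‖x‖ ^ 2)) :
    HasPd i (fun y => F (‖y‖ ^ 2)) x (2 * D * x i) := by
  have h1 : HasFDerivWithinAt (fun y : V n => ‖y‖ ^ 2) (2 • innerSL ℝ x) (ext n) x :=
    (hasStrictFDerivAt_norm_sq x).hasFDerivAt.hasFDerivWithinAt
  have hm : MapsTo (fun y : V n => ‖y‖ ^ 2) (ext n) (Ici 1) := by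
    intro y hy
    have : (1 : ℝ) ≤ ‖y‖ := hy
    show (1 : ℝ) ≤ ‖y‖ ^ 2
    nlinarith
  refine ⟨_, h.comp_hasFDerivWithinAt x h1 hm, ?_⟩
  simp [EuclideanSpace.inner_single_right]
  ring

end HasPd

theorem norm_sq_eq_sum {n : ℕ} (x : V n) : ∑ k, x k * x k = ‖x‖ ^ 2 := by
  rw [EuclideanSpace.real_norm_sq_eq]
  exact Finset.sum_congr rfl fun k _ => (sq _).symm

theorem one_le_norm_sq {n : ℕ} {x : V n} (hx : x ∈ ext n) : 1 ≤ ‖x‖ ^ 2 := by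
  have : (1 : ℝ) ≤ ‖x‖ := hx
  nlinarith

/-! ### Curvature of metrics `B(|x|²) δ + C(|x|²) x ⊗ x` -/

/-- The coefficients of `g` are `B(|x|²) δ_{ij} + C(|x|²) x_i x_j`. -/
def HasForm {n : ℕ} (g : MetricTensor n) (B C : ℝ → ℝ) : Prop :=
  ∀ x ∈ ext n, ∀ i j, g x i j = B (‖x‖ ^ 2) * kd i j + C (‖x‖ ^ 2) * (x i * x j)

/-- Sherman–Morrison for a rank-one perturbation of a multiple of the identity; `B + t C` is the
eigenvalue in the radial direction. -/
theorem HasForm.inv_apply {n : ℕ} {g : MetricTensor n} {B C : ℝ → ℝ} (h : HasForm g B C)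
    {x : V n} (hx : x ∈ ext n) (hB : B (‖x‖ ^ 2) ≠ 0)
    (hC : B (‖x‖ ^ 2) + ‖x‖ ^ 2 * C (‖x‖ ^ 2) ≠ 0) (i j : Fin n) :
    (g x)⁻¹ i j = 1 / B (‖x‖ ^ 2) * (kd i j -
      C (‖x‖ ^ 2) / (B (‖x‖ ^ 2) + ‖x‖ ^ 2 * C (‖x‖ ^ 2)) * (x i * x j)) := by
  have hg := h x hx
  have ht := norm_sq_eq_sum x
  generalize ‖x‖ ^ 2 = t at *
  generalize B t = b at *
  generalize C t = c at *
  have key : (g x)⁻¹ = Matrix.of fun i j => 1 / b * (kd i j - c / (b + t * c) * (x i * x j)) := by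
    apply Matrix.inv_eq_right_inv
    ext i k
    rw [Matrix.mul_apply, Matrix.one_apply]
    have : ∀ j, g x i j * (Matrix.of fun i j => 1 / b * (kd i j -
      c / (b + t * c) * (x i * x j))) j k =
        kd i j * (kd j k - c / (b + t * c) * (x j * x k))
        + kd j k * (c / b * (x i * x j))
        - (x j * x j) * (c / b * (c / (b + t * c)) * (x i * x k)) := by
      intro j
      rw [hg, Matrix.of_apply]
      field_simp
      ring
    rw [Finset.sum_congr rfl fun j _ => this j, Finset.sum_sub_distrib, Finset.sum_add_distrib,
      ← Finset.sum_mul, ht, sum_kd_mul', sum_kd_mul, ← kd]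
    generalize hw : b + t * c = w at *
    field_simp
    rw [← hw]
    ring
  rw [key, Matrix.of_apply]

/-- Differentiating a function of |x|² only produces factors 2xᵢ, so all terms are built from
Kronecker symbols and coordinates. The grouping is the one that `ricci_eq` takes as input. -/
theorem HasForm.christoffel_eq {n : ℕ} {g : MetricTensor n} {B C B' C' : ℝ → ℝ}
    (h : HasForm g B C) (hB' : ∀ t ∈ Ici (1 : ℝ), HasDerivWithinAt B (B' t) (Ici 1) t)
    (hC' : ∀ t ∈ Ici (1 : ℝ), HasDerivWithinAt C (C' t) (Ici 1) t)
    (hB : ∀ t ∈ Ici (1 : ℝ), B t ≠ 0) (hC : ∀ t ∈ Ici (1 : ℝ), B t + t * C t ≠ 0)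
    {x : V n} (hx : x ∈ ext n) (k i j : Fin n) :
    christoffel g k i j x =
      B' (‖x‖ ^ 2) / B (‖x‖ ^ 2) * (kd k j * x i + kd k i * x j) +
      ((C (‖x‖ ^ 2) - B' (‖x‖ ^ 2)) / (B (‖x‖ ^ 2) + ‖x‖ ^ 2 * C (‖x‖ ^ 2)) * kd i j +
        (C' (‖x‖ ^ 2) - 2 * B' (‖x‖ ^ 2) * C (‖x‖ ^ 2) / B (‖x‖ ^ 2)) /
          (B (‖x‖ ^ 2) + ‖x‖ ^ 2 * C (‖x‖ ^ 2)) * (x i * x j)) * x k := by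
  have hpd : ∀ i j l, pd i (fun y => g y j l) x = 2 * B' (‖x‖ ^ 2) * x i * kd j l
      + (2 * C' (‖x‖ ^ 2) * x i * (x j * x l) + C (‖x‖ ^ 2) *
        (kd i j * x l + x j * kd i l)) := by
    intro i j l
    have hb := (HasPd.radial (i := i) (hB' _ (one_le_norm_sq hx))).mul
      (HasPd.const (i := i) (x := x) (kd j l))
    have hc := (HasPd.radial (i := i) (hC' _ (one_le_norm_sq hx))).mul
      ((HasPd.coord (i := i) (x := x) j).mul (HasPd.coord (i := i) (x := x) l))
    rw [((hb.add hc).congr hx fun y hy => h y hy j l).pd_eq hx]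
    ring
  have hb := hB _ (one_le_norm_sq hx)
  have hc := hC _ (one_le_norm_sq hx)
  have hinv := h.inv_apply hx hb hc
  have ht := norm_sq_eq_sum x
  unfold christoffel
  generalize ‖x‖ ^ 2 = t at *
  generalize B t = b at *
  generalize C t = c at *
  generalize B' t = b' at *
  generalize C' t = c' at *
  -- Each summand is sorted into Kronecker terms and a multiple of x_l x_l, so that the sum over l
  -- collapses. The same device computes all later contractions.
  have hs : ∀ l, (g x)⁻¹ k l *
      (pd i (fun y => g y j l) x + pd j (fun y => g y i l) x - pd l (fun y => g y i j) x) =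
      kd k l * (2 / b * (b' * x i * kd j l + b' * x j * kd i l +
        ((c - b') * kd i j + c' * (x i * x j)) * x l)) -
      kd j l * (2 / b * (c / (b + t * c)) * x k * b' * x i * x l) -
      kd i l * (2 / b * (c / (b + t * c)) * x k * b' * x j * x l) -
      (x l * x l) * (2 / b * (c / (b + t * c)) * x k *
        ((c - b') * kd i j + c' * (x i * x j))) := by
    intro l
    rw [hinv, hpd, hpd, hpd, kd_comm j i, kd_comm l i, kd_comm l j]
    field_simp
    ring
  rw [Finset.sum_congr rfl fun l _ => hs l, Finset.sum_sub_distrib, Finset.sum_sub_distrib,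
    Finset.sum_sub_distrib, ← Finset.sum_mul, ht, sum_kd_mul', sum_kd_mul', sum_kd_mul',
    kd_comm j k, kd_comm i k]
  generalize hw : b + t * c = w at *
  field_simp
  rw [← hw]
  ring

/-- The scalar curvature, computed from Christoffel symbols of the form
`Γ^k_{ij} = β (δ_{kj} x_i + δ_{ki} x_j) + (μ δ_{ij} + ν x_i x_j) x_k`. -/
theorem ricci_eq {n : ℕ} {g : MetricTensor n} {β μ ν : ℝ → ℝ} {β' μ' ν' : ℝ}
    (hΓ : ∀ y ∈ ext n, ∀ k i j, christoffel g k i j y =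
      β (‖y‖ ^ 2) * (kd k j * y i + kd k i * y j) +
        (μ (‖y‖ ^ 2) * kd i j + ν (‖y‖ ^ 2) * (y i * y j)) * y k)
    {x : V n} (hx : x ∈ ext n) (hβ : HasDerivWithinAt β β' (Ici 1) (‖x‖ ^ 2))
    (hμ : HasDerivWithinAt μ μ' (Ici 1) (‖x‖ ^ 2))
    (hν : HasDerivWithinAt ν ν' (Ici 1) (‖x‖ ^ 2)) {t b m v : ℝ} (ht : ‖x‖ ^ 2 = t)
    (hb : β t = b) (hm : μ t = m) (hv : ν t = v) (i j : Fin n) :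
    ricci g i j x =
      (2 * b + n * m + 2 * t * μ' - (((n : ℝ) + 1) * b + m + t * v)
        + (((n : ℝ) + 1) * b + m + t * v) * t * m - 2 * t * b * m) * kd i j +
      (4 * β' + n * v + 2 * t * ν' + 2 * v - 2 * (((n : ℝ) + 1) * β' + μ' + v + t * ν')
        + (((n : ℝ) + 1) * b + m + t * v) * (2 * b + t * v)
        - ((n + 3) * b ^ 2 + 2 * b * m + 4 * t * b * v + m ^ 2 + 2 * t * m * v + v ^ 2 * t ^ 2)) *
        (x i * x j) := by
  have hpd : ∀ p k i j, pd p (christoffel g k i j) x =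
      2 * β' * x p * (kd k j * x i + kd k i * x j) + b * (kd k j * kd p i + kd k i * kd p j) +
      ((2 * μ' * x p * kd i j + (2 * ν' * x p * (x i * x j) +
        v * (kd p i * x j + x i * kd p j))) * x k + (m * kd i j + v * (x i * x j)) * kd p k) := by
    intro p k i j
    have h1 := (HasPd.radial (i := p) hβ).mul
      (((HasPd.const (i := p) (x := x) (kd k j)).mul (HasPd.coord i)).add
        ((HasPd.const (i := p) (x := x) (kd k i)).mul (HasPd.coord j)))
    have h2 := (((HasPd.radial (i := p) hμ).mul (HasPd.const (kd i j))).add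
      ((HasPd.radial (i := p) hν).mul ((HasPd.coord i).mul (HasPd.coord j)))).mul
        (HasPd.coord (i := p) (x := x) k)
    rw [((h1.add h2).congr hx fun y hy => hΓ y hy k i j).pd_eq hx, ht, hb, hm, hv]
    ring
  have hG : ∀ k i j, christoffel g k i j x = b * (kd k j * x i + kd k i * x j) +
        (m * kd i j + v * (x i * x j)) * x k := by
    intro k i j
    rw [hΓ x hx, ht, hb, hm, hv]
  have hs := norm_sq_eq_sum x
  rw [ht] at hs
  have hx1 : ∀ c : ℝ, ∑ k, x k * x k * c = t * c := fun c => by rw [← Finset.sum_mul, hs]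
  -- The four contractions in the Ricci tensor are found separately; each is a combination of δ_ij
  -- and x_i x_j.
  have S1 : ∑ k, pd k (christoffel g k i j) x =
      (2 * b + n * m + 2 * t * μ') * kd i j + (4 * β' + n * v + 2 * t * ν' + 2 * v) * (x i * x j) := by
    have : ∀ k, pd k (christoffel g k i j) x =
        kd k j * (2 * β' * x k * x i + b * kd k i + v * x i * x k) +
        kd k i * (2 * β' * x k * x j + b * kd k j + v * x j * x k) +
        x k * x k * (2 * μ' * kd i j + 2 * ν' * (x i * x j)) + (m * kd i j + v * (x i * x j)) := by
      intro k
      rw [hpd, kd_self]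
      ring
    rw [Finset.sum_congr rfl fun k _ => this k]
    simp only [Finset.sum_add_distrib, sum_kd_mul, hx1, Finset.sum_const, Finset.card_univ,
      Fintype.card_fin, nsmul_eq_mul]
    rw [kd_comm j i]
    ring
  have S2 : ∑ k, pd j (christoffel g k i k) x =
      (((n : ℝ) + 1) * b + m + t * v) * kd i j +
        2 * (((n : ℝ) + 1) * β' + μ' + v + t * ν') * (x i * x j) := by
    have : ∀ k, pd j (christoffel g k i k) x =
        kd k i * (2 * β' * x j * x k + b * kd j k + 2 * μ' * x j * x k + m * kd j k) +
        kd k j * (2 * v * x i * x k) +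
        x k * x k * (2 * ν' * (x i * x j) + v * kd j i) + (2 * β' * x j * x i + b * kd j i) := by
      intro k
      rw [hpd, kd_self, kd_comm i k, kd_comm k j]
      ring
    rw [Finset.sum_congr rfl fun k _ => this k]
    simp only [Finset.sum_add_distrib, sum_kd_mul, hx1, Finset.sum_const, Finset.card_univ,
      Fintype.card_fin, nsmul_eq_mul]
    rw [kd_comm j i]
    ring
  have tr : ∀ l, ∑ k, christoffel g k k l x = (((n : ℝ) + 1) * b + m + t * v) * x l := by
    intro l
    have : ∀ k, christoffel g k k l x = kd k l * (b * x k + m * x k) + x k * x k * (v * x l) +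
        b * x l := by
      intro k
      rw [hG, kd_self]
      ring
    rw [Finset.sum_congr rfl fun k _ => this k]
    simp only [Finset.sum_add_distrib, sum_kd_mul, hx1, Finset.sum_const, Finset.card_univ,
      Fintype.card_fin, nsmul_eq_mul]
    ring
  have tr' : ∀ l, ∑ k, christoffel g k l k x = (((n : ℝ) + 1) * b + m + t * v) * x l := by
    intro l
    rw [← tr l]
    refine Finset.sum_congr rfl fun k _ => ?_
    rw [hG, hG, kd_comm k l]
    ring
  have xup : ∀ i j, ∑ l, x l * christoffel g l i j x = 2 * b * (x i * x j) +
      t * (m * kd i j + v * (x i * x j)) := by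
    intro i j
    have : ∀ l, x l * christoffel g l i j x = kd l j * (b * x l * x i) + kd l i * (b * x l * x j) +
        x l * x l * (m * kd i j + v * (x i * x j)) := by
      intro k
      rw [hG]
      ring
    rw [Finset.sum_congr rfl fun k _ => this k]
    simp only [Finset.sum_add_distrib, sum_kd_mul, hx1]
    ring
  have xlow : ∑ k, x k * christoffel g j i k x = b * (x i * x j + t * kd i j) +
      (m + v * t) * (x i * x j) := by
    have : ∀ k, x k * christoffel g j i k x = kd k j * (b * x k * x i) + kd k i * (m * x k * x j) +
        x k * x k * (b * kd i j + v * (x i * x j)) := by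
      intro k
      rw [hG, kd_comm j k, kd_comm i k, kd_comm j i]
      ring
    rw [Finset.sum_congr rfl fun k _ => this k]
    simp only [Finset.sum_add_distrib, sum_kd_mul, hx1]
    ring
  have S3 : ∑ k, ∑ l, christoffel g k k l x * christoffel g l i j x =
      (((n : ℝ) + 1) * b + m + t * v) * (2 * b * (x i * x j) +
      t * (m * kd i j + v * (x i * x j))) := by
    rw [Finset.sum_comm, ← xup, Finset.mul_sum]
    refine Finset.sum_congr rfl fun l _ => ?_
    rw [← Finset.sum_mul, tr]
    ring
  have S4 : ∑ k, ∑ l, christoffel g k j l x * christoffel g l i k x =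
      2 * t * b * m * kd i j +
      ((n + 3) * b ^ 2 + 2 * b * m + 4 * t * b * v + m ^ 2 + 2 * t * m * v + v ^ 2 * t ^ 2) *
        (x i * x j) := by
    have h1 : ∀ k, ∑ l, christoffel g k j l x * christoffel g l i k x =
        b * x j * christoffel g k i k x + m * (x k * christoffel g j i k x) +
        (kd k j * (b * (2 * b * (x i * x k) + t * (m * kd i k + v * (x i * x k)))) +
          kd k i * (v * x j * (t * m) * x k) + x k * x k * (v * x j * x i * (2 * b + t * v))) := by
      intro k
      have : ∀ l, christoffel g k j l x * christoffel g l i k x =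
          kd k l * (b * x j * christoffel g l i k x) + kd j l * (m * x k * christoffel g l i k x) +
          x l * christoffel g l i k x * (b * kd k j + v * x j * x k) := by
        intro l
        rw [hG k j l]
        ring
      rw [Finset.sum_congr rfl fun k _ => this k]
      simp only [Finset.sum_add_distrib, sum_kd_mul']
      rw [← Finset.sum_mul, xup, kd_comm i k]
      ring
    rw [Finset.sum_congr rfl fun k _ => h1 k]
    simp only [Finset.sum_add_distrib, sum_kd_mul, hx1]
    rw [← Finset.mul_sum, ← Finset.mul_sum, xlow, tr']
    ring
  unfold ricci
  simp only [Finset.sum_add_distrib, Finset.sum_sub_distrib]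
  rw [S1, S2, S3, S4]
  ring

/-- The scalar curvature of `B δ + C x ⊗ x`, multiplied by `|x|² B / (n-1)`, in terms of the
square area radius `y = t B` and the radial coefficient `a = B + t C`. -/
theorem HasForm.scalarCurv_eq {n : ℕ} {g : MetricTensor n} {B C B' C' B'' C'' : ℝ → ℝ}
    (h : HasForm g B C) (hB' : ∀ t ∈ Ici (1 : ℝ), HasDerivWithinAt B (B' t) (Ici 1) t)
    (hC' : ∀ t ∈ Ici (1 : ℝ), HasDerivWithinAt C (C' t) (Ici 1) t)
    (hB'' : ∀ t ∈ Ici (1 : ℝ), HasDerivWithinAt B' (B'' t) (Ici 1) t)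
    (hC'' : ∀ t ∈ Ici (1 : ℝ), HasDerivWithinAt C' (C'' t) (Ici 1) t)
    (hB : ∀ t ∈ Ici (1 : ℝ), B t ≠ 0) (hC : ∀ t ∈ Ici (1 : ℝ), B t + t * C t ≠ 0)
    {x : V n} (hx : x ∈ ext n) {t y a y' a' y'' : ℝ} (ht : ‖x‖ ^ 2 = t) (hy : t * B t = y)
    (ha : B t + t * C t = a) (hy' : B t + t * B' t = y') (ha' : B' t + C t + t * C' t = a')
    (hy'' : 2 * B' t + t * B'' t = y'') :
    y * scalarCurv g x = (n - 1) * ((n - 2) * (1 - t * y' ^ 2 / (y * a)) -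
      2 * ((y' + 2 * t * y'') / a - t * y' ^ 2 / (y * a) - t * y' * a' / a ^ 2)) := by
  have htI : (‖x‖ ^ 2) ∈ Ici (1 : ℝ) := one_le_norm_sq hx
  have ht1 : t ∈ Ici (1 : ℝ) := ht ▸ htI
  have ht0 : t ≠ 0 := by have : (1 : ℝ) ≤ t := ht1; positivity
  have hden : HasDerivWithinAt (fun t => B t + t * C t) (B' t + (1 * C t + t * C' t)) (Ici 1) t :=
    (hB' t ht1).add ((hasDerivWithinAt_id t _).mul (hC' t ht1))
  have hβ := (hB'' t ht1).div (hB' t ht1) (hB t ht1)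
  have hμ := ((hC' t ht1).sub (hB'' t ht1)).div hden (hC t ht1)
  have hν := ((hC'' t ht1).sub ((((hB'' t ht1).const_mul 2).mul (hC' t ht1)).div
    (hB' t ht1) (hB t ht1))).div hden (hC t ht1)
  rw [← ht] at hβ hμ hν
  have hR := fun i j => ricci_eq (fun y hy k i j => h.christoffel_eq hB' hC' hB hC hy k i j) hx
    hβ hμ hν ht rfl rfl rfl i j
  have hI := h.inv_apply hx (hB _ htI) (hC _ htI)
  have hs := norm_sq_eq_sum x
  have hb0 := hB t ht1
  have hc0 := hC t ht1
  simp only [Pi.mul_apply, Pi.sub_apply, Pi.div_apply] at hR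
  rw [ht] at hR hI hs
  generalize B'' t = b'' at *
  generalize C'' t = c'' at *
  generalize B' t = b' at *
  generalize C' t = c' at *
  generalize B t = b at *
  generalize C t = c at *
  -- The trace of E δ + F x ⊗ x against an inverse of Sherman–Morrison form.
  have key : ∀ (E F D : ℝ), ∑ i, ∑ j, (1 / b * (kd i j - D * (x i * x j))) *
      (E * kd i j + F * (x i * x j)) = 1 / b * (n * E + t * F - D * t * (E + t * F)) := by
    intro E F D
    have h1 : ∀ i, ∑ j, (1 / b * (kd i j - D * (x i * x j))) *
        (E * kd i j + F * (x i * x j)) =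
        1 / b * E + x i * x i * (1 / b * (F - D * E - D * F * t)) := by
      intro i
      have : ∀ j, (1 / b * (kd i j - D * (x i * x j))) * (E * kd i j + F * (x i * x j)) =
          kd i j * (1 / b * (E * kd i j + F * (x i * x j) - D * E * (x i * x j))) +
          x j * x j * (- (1 / b * D * F) * (x i * x i)) := by
        intro j
        ring
      rw [Finset.sum_congr rfl fun k _ => this k]
      rw [Finset.sum_add_distrib, ← Finset.sum_mul, hs, sum_kd_mul', kd_self]
      ring
    rw [Finset.sum_congr rfl fun k _ => h1 k, Finset.sum_add_distrib, Finset.sum_const,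
      ← Finset.sum_mul, hs, Finset.card_univ, Fintype.card_fin, nsmul_eq_mul]
    ring
  unfold scalarCurv
  simp only [hR, hI, key]
  subst hy hy' ha' hy''
  -- Eliminating C in favour of the radial coefficient a leaves a rational identity.
  obtain rfl : c = (a - b) / t := by field_simp; linarith
  have hca : b + t * ((a - b) / t) = a := by field_simp; ring
  rw [hca] at hc0 ⊢
  field_simp
  ring

/-! ### The form of rotationally symmetric metrics -/

theorem toEuclideanLin_apply_coord {n : ℕ} (A : Matrix (Fin n) (Fin n) ℝ) (x : V n) (k : Fin n) :
    (Matrix.toEuclideanLin A x) k = ∑ l, A k l * x l := by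
  simp [Matrix.toEuclideanLin, Matrix.mulVec, dotProduct]

/-- Signed permutation matrices of determinant one act on metrics by permuting the entries. -/
theorem IsRotInvariant.signedPerm {n : ℕ} {g : MetricTensor n} (hr : IsRotInvariant g)
    {x : V n} (hx : x ∈ ext n) (σ : Equiv.Perm (Fin n)) (s : Fin n → ℝ) (hs : ∀ i, s i * s i = 1)
    (hdet : (Equiv.Perm.sign σ : ℝ) * ∏ i, s i = 1) (hfix : ∀ k, s k * x k = x (σ k))
    (i j : Fin n) : g x i j = s i * s j * g x (σ i) (σ j) := by
  -- A sends e_l to s_l e_{σ l}. By `hfix` it fixes x, so invariance relates entries of g at the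
  -- single point x.
  let A : Matrix (Fin n) (Fin n) ℝ := (Equiv.Perm.permMatrix ℝ σ)ᵀ * Matrix.diagonal s
  have hA : ∀ k l, A k l = kd k (σ l) * s l := by
    intro k l
    simp [A, Matrix.mul_diagonal, Equiv.Perm.permMatrix, PEquiv.toMatrix_apply, kd,
      Equiv.eq_symm_apply, eq_comm]
  have hAmem : A ∈ Matrix.specialOrthogonalGroup (Fin n) ℝ := by
    rw [Matrix.mem_specialOrthogonalGroup_iff, Matrix.mem_orthogonalGroup_iff']
    constructor
    · ext k l
      rw [Matrix.mul_apply, Matrix.one_apply, ← kd]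
      simp only [Matrix.transpose_apply, hA]
      have : ∀ m, kd m (σ k) * s k * (kd m (σ l) * s l) = kd m (σ k) * (s k * s l * kd m (σ l)) :=
        fun m => by ring
      rw [Finset.sum_congr rfl fun m _ => this m, sum_kd_mul]
      by_cases h : k = l
      · subst h; rw [kd_self, kd_self, hs, one_mul]
      · simp [kd, h]
    · simp only [A, Matrix.det_mul, Matrix.det_transpose, Matrix.det_permutation,
        Matrix.det_diagonal]
      exact hdet
  have hAx : Matrix.toEuclideanLin A x = x := by
    ext k
    rw [toEuclideanLin_apply_coord]
    obtain ⟨m, rfl⟩ := σ.surjective k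
    have : ∀ l, A (σ m) l * x l = kd m l * (s l * x l) := by
      intro l
      rw [hA]
      simp only [kd, EmbeddingLike.apply_eq_iff_eq]
      ring
    rw [Finset.sum_congr rfl fun l _ => this l, sum_kd_mul', hfix]
  have h := hr A hAmem x hx
  rw [hAx] at h
  rw [← congrFun (congrFun h i) j]
  simp only [Matrix.mul_apply, Matrix.transpose_apply, hA]
  have h1 : ∀ l, (∑ k, kd k (σ i) * s i * g x k l) * (kd l (σ j) * s j) =
      kd l (σ j) * (s i * s j * g x (σ i) l) := by
    intro l
    have : ∀ k, kd k (σ i) * s i * g x k l = kd k (σ i) * (s i * g x k l) := fun k => by ring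
    rw [Finset.sum_congr rfl fun k _ => this k, sum_kd_mul]
    ring
  rw [Finset.sum_congr rfl fun l _ => h1 l, sum_kd_mul]

/-- `SO(n)` is transitive on unit vectors. -/
theorem exists_rotation {n : ℕ} {o p : Fin n} (hop : o ≠ p) (u : V n) (hu : ‖u‖ = 1) :
    ∃ A ∈ Matrix.specialOrthogonalGroup (Fin n) ℝ, ∀ i, A i o = u i := by
  -- H is the Householder reflection exchanging e_o and u, which degenerates only if u = e_o.
  have key : ∃ H ∈ Matrix.orthogonalGroup (Fin n) ℝ, ∀ i, H i o = u i := by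
    by_cases h1 : u o = 1
    · refine ⟨1, one_mem _, fun i => ?_⟩
      have hs := norm_sq_eq_sum u
      rw [hu, ← Finset.add_sum_erase _ _ (Finset.mem_univ o), h1] at hs
      have h0 : ∑ k ∈ Finset.univ.erase o, u k * u k = 0 := by linarith
      rw [Finset.sum_eq_zero_iff_of_nonneg fun k _ => mul_self_nonneg _] at h0
      by_cases hi : i = o
      · subst hi; simp [h1]
      · rw [Matrix.one_apply_ne hi]
        exact (mul_self_eq_zero.1 (h0 i (by simp [hi]))).symm
    · have hc : (1 - u o) ≠ 0 := sub_ne_zero.2 (Ne.symm h1)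
      let w : Fin n → ℝ := fun i => kd i o - u i
      have hw : ∑ k, w k * w k = 2 * (1 - u o) := by
        have : ∀ k, w k * w k = kd k o * (kd k o - 2 * u k) + u k * u k := fun k => by
          simp only [w]; ring
        rw [Finset.sum_congr rfl fun k _ => this k, Finset.sum_add_distrib, sum_kd_mul,
          norm_sq_eq_sum, hu, kd_self]
        ring
      refine ⟨Matrix.of fun i j => kd i j - 1 / (1 - u o) * (w i * w j), ?_, fun i => ?_⟩
      · rw [Matrix.mem_orthogonalGroup_iff']
        ext k l
        rw [Matrix.mul_apply, Matrix.one_apply, ← kd]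
        simp only [Matrix.transpose_apply, Matrix.of_apply]
        have : ∀ m, (kd m k - 1 / (1 - u o) * (w m * w k)) *
            (kd m l - 1 / (1 - u o) * (w m * w l)) =
            kd m k * (kd m l - 1 / (1 - u o) * (w m * w l)) -
            kd m l * (1 / (1 - u o) * (w m * w k)) +
            w m * w m * (1 / (1 - u o) * (1 / (1 - u o)) * (w k * w l)) := fun m => by ring
        rw [Finset.sum_congr rfl fun m _ => this m, Finset.sum_add_distrib,
          Finset.sum_sub_distrib, sum_kd_mul, sum_kd_mul, ← Finset.sum_mul, hw]
        field_simp
        ring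
      · simp only [Matrix.of_apply, w, kd_self]
        field_simp
        ring
  obtain ⟨H, hH, hHo⟩ := key
  have hdet : H.det = 1 ∨ H.det = -1 := by
    have h1 := (Matrix.mem_orthogonalGroup_iff' _ _).1 hH
    have h2 := congrArg Matrix.det h1
    rw [Matrix.det_mul, Matrix.det_transpose, Matrix.det_one] at h2
    exact mul_self_eq_one_iff.1 h2
  rcases hdet with hdet | hdet
  · exact ⟨H, Matrix.mem_specialOrthogonalGroup_iff.2 ⟨hH, hdet⟩, hHo⟩
  -- If the determinant is -1, flipping the sign of column p repairs it and leaves column o alone.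
  · let s : Fin n → ℝ := fun i => if i = p then -1 else 1
    have hD : Matrix.diagonal s ∈ Matrix.orthogonalGroup (Fin n) ℝ := by
      rw [Matrix.mem_orthogonalGroup_iff']
      ext k l
      rw [Matrix.diagonal_transpose, Matrix.diagonal_mul_diagonal]
      by_cases h : k = l
      · subst h
        by_cases hp : k = p <;> simp [s, hp]
      · simp [h]
    refine ⟨H * Matrix.diagonal s, Matrix.mem_specialOrthogonalGroup_iff.2
      ⟨mul_mem hH hD, ?_⟩, fun i => ?_⟩
    · rw [Matrix.det_mul, hdet, Matrix.det_diagonal]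
      simp [s, Finset.prod_ite_eq']
    · rw [Matrix.mul_diagonal, hHo]
      simp [s, hop]

/-- On the axis through `o`, a rotationally symmetric metric is diagonal. -/
theorem IsRotInvariant.axis {n : ℕ} {g : MetricTensor n} (hr : IsRotInvariant g)
    {o p q : Fin n} (hop : o ≠ p) (hoq : o ≠ q) (hpq : p ≠ q) {ρ : ℝ}
    (hx : EuclideanSpace.single o ρ ∈ ext n)
    (hsymm : (g (EuclideanSpace.single o ρ)).IsSymm) (i j : Fin n) :
    g (EuclideanSpace.single o ρ) i j =
      g (EuclideanSpace.single o ρ) p p * kd i j +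
        (g (EuclideanSpace.single o ρ) o o - g (EuclideanSpace.single o ρ) p p) *
          (kd i o * kd j o) := by
  set G := g (EuclideanSpace.single o ρ) with hG
  -- Invariance under the quarter turn of the (k, l)-plane, which fixes the axis o. The swap and the
  -- single sign change together have determinant 1.
  have quarter : ∀ k l : Fin n, o ≠ k → o ≠ l → k ≠ l →
      G k k = G l l ∧ G k l = -G l k ∧ G o k = G o l ∧ G o l = -G o k ∧
        G k o = G l o ∧ G l o = - G k o := by
    intro k l hk hl hkl
    have h := fun i j => hr.signedPerm hx (Equiv.swap k l) (fun i => if i = l then -1 else 1)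
      (by intro i; split_ifs <;> norm_num) (by simp [Equiv.Perm.sign_swap hkl])
      (by
        intro m
        by_cases hm : m = l
        · subst hm
          simp [hl.symm, hk.symm]
        · by_cases hm' : m = k
          · subst hm'
            simp [hl.symm, hk.symm]
          · simp [hm, Equiv.swap_apply_of_ne_of_ne hm' hm]) i j
    rw [← hG] at h
    have ho : Equiv.swap k l o = o := Equiv.swap_apply_of_ne_of_ne hk hl
    refine ⟨?_, ?_, ?_, ?_, ?_, ?_⟩
    · simpa [hkl] using h k k
    · simpa [hkl] using h k l
    · simpa [hkl, ho, hl] using h o k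
    · simpa [hkl, ho, hl] using h o l
    · simpa [hkl, ho, hl] using h k o
    · simpa [hkl, ho, hl] using h l o
  -- A mixed entry equals both plus and minus another one, so it vanishes. A second index l off the
  -- axis exists because p and q are distinct.
  have hzero : ∀ k, o ≠ k → G o k = 0 ∧ G k o = 0 := by
    intro k hk
    obtain ⟨l, hol, hkl⟩ : ∃ l, o ≠ l ∧ k ≠ l := by
      by_cases h : k = p
      · exact ⟨q, hoq, h ▸ hpq⟩
      · exact ⟨p, hop, h⟩
    obtain ⟨-, -, h1, h2, h3, h4⟩ := quarter k l hk hol hkl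
    constructor <;> linarith
  by_cases hi : i = o
  · subst hi
    by_cases hj : j = i
    · subst hj; rw [kd_self]; ring
    · rw [(hzero j (Ne.symm hj)).1, kd_self]
      simp [kd, hj, Ne.symm hj]
  · by_cases hj : j = o
    · subst hj
      rw [(hzero i (Ne.symm hi)).2, kd_self]
      simp [kd, hi]
    · by_cases hij : i = j
      · subst hij
        have : G i i = G p p := by
          by_cases hip : i = p
          · rw [hip]
          · exact (quarter i p (Ne.symm hi) hop hip).1
        rw [this, kd_self]
        simp [kd, hi]
      · have h1 := (quarter i j (Ne.symm hi) (Ne.symm hj) hij).2.1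
        have h2 : G i j = G j i := hsymm.apply j i
        have : G i j = 0 := by linarith
        rw [this]
        simp [kd, hij, hi]

/-- A smooth rotationally symmetric metric is `B(|x|²) δ + C(|x|²) x ⊗ x` with smooth `B`, `C`. -/
theorem exists_hasForm {n : ℕ} (hn : 3 ≤ n) {g : MetricTensor n} (hg : IsRiemannian g)
    (hr : IsRotInvariant g) : ∃ B C : ℝ → ℝ, ContDiffOn ℝ ∞ B (Ici 1) ∧ ContDiffOn ℝ ∞ C (Ici 1) ∧
      (∀ t ∈ Ici (1 : ℝ), 0 < B t ∧ 0 < B t + t * C t) ∧ HasForm g B C := by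
  let o : Fin n := ⟨0, by omega⟩
  let p : Fin n := ⟨1, by omega⟩
  let q : Fin n := ⟨2, by omega⟩
  have hop : o ≠ p := by simp [o, p]
  have hoq : o ≠ q := by simp [o, q]
  have hpq : p ≠ q := by simp [p, q]
  -- Radial and tangential coefficients along one axis, as functions of t = |x|². They are smooth
  -- because √t is smooth on t ≥ 1.
  let a : ℝ → ℝ := fun t => g (EuclideanSpace.single o (√t)) o o
  let b : ℝ → ℝ := fun t => g (EuclideanSpace.single o (√t)) p p
  have hmaps : ∀ t ∈ Ici (1 : ℝ), (EuclideanSpace.single o (√t) : V n) ∈ ext n := by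
    intro t ht
    show (1 : ℝ) ≤ ‖(EuclideanSpace.single o (√t) : V n)‖
    simp only [PiLp.norm_single, Real.norm_eq_abs, abs_of_nonneg (Real.sqrt_nonneg t)]
    exact Real.one_le_sqrt.2 ht
  have hsqrt : ContDiffOn ℝ ∞ (fun t : ℝ => (EuclideanSpace.single o (√t) : V n)) (Ici 1) := by
    have h1 : ContDiffOn ℝ ∞ (fun t : ℝ => √t) (Ici 1) := by
      intro t ht
      have : (0 : ℝ) < t := lt_of_lt_of_le one_pos ht
      exact (Real.contDiffAt_sqrt this.ne').contDiffWithinAt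
    rw [contDiffOn_euclidean]
    intro i
    by_cases hi : i = o
    · subst hi
      simpa using h1
    · simpa [hi] using contDiffOn_const
  have ha : ContDiffOn ℝ ∞ a (Ici 1) := (hg.1 o o).comp hsqrt hmaps
  have hb : ContDiffOn ℝ ∞ b (Ici 1) := (hg.1 p p).comp hsqrt hmaps
  have ht0 : ∀ t ∈ Ici (1 : ℝ), t ≠ 0 := fun t ht => (lt_of_lt_of_le one_pos ht).ne'
  have hpos : ∀ t ∈ Ici (1 : ℝ), 0 < a t ∧ 0 < b t := fun t ht =>
    ⟨(hg.2 _ (hmaps t ht)).diag_pos, (hg.2 _ (hmaps t ht)).diag_pos⟩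
  refine ⟨b, fun t => (a t - b t) / t, hb, (ha.sub hb).div contDiffOn_id ht0, fun t ht => ?_, ?_⟩
  · refine ⟨(hpos t ht).2, ?_⟩
    have := ht0 t ht
    have h2 : b t + t * ((a t - b t) / t) = a t := by field_simp; ring
    rw [h2]
    exact (hpos t ht).1
  · intro x hx i j
    have hx0 : 0 < ‖x‖ := lt_of_lt_of_le one_pos hx
    obtain ⟨A, hA, hAo⟩ := exists_rotation hop (‖x‖⁻¹ • x)
      (by rw [norm_smul, norm_inv, norm_norm, inv_mul_cancel₀ hx0.ne'])
    have hsq : √(‖x‖ ^ 2) = ‖x‖ := Real.sqrt_sq hx0.le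
    have he : (EuclideanSpace.single o ‖x‖ : V n) ∈ ext n := by
      have := hmaps (‖x‖ ^ 2) (one_le_norm_sq hx)
      rwa [hsq] at this
    have hAx : Matrix.toEuclideanLin A (EuclideanSpace.single o ‖x‖) = x := by
      ext k
      rw [toEuclideanLin_apply_coord]
      simp [hAo]
      field_simp
    have hinv := hr A hA _ he
    rw [hAx] at hinv
    have hAA : A * Aᵀ = 1 :=
      (Matrix.mem_orthogonalGroup_iff _ _).1 (Matrix.mem_specialOrthogonalGroup_iff.1 hA).1
    have hgx : g x = A * g (EuclideanSpace.single o ‖x‖) * Aᵀ := by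
      rw [← hinv]
      calc g x = (A * Aᵀ) * g x * (A * Aᵀ) := by rw [hAA]; simp
        _ = _ := by simp only [Matrix.mul_assoc]
    have hG := hr.axis hop hoq hpq he (by
      have := (hg.2 _ he).isHermitian
      rwa [Matrix.IsHermitian, Matrix.conjTranspose_eq_transpose_of_trivial] at this)
    have hAA' : ∑ k, A i k * A j k = kd i j := by
      have := congrFun (congrFun hAA i) j
      rw [Matrix.mul_apply, Matrix.one_apply] at this
      simpa [kd] using this
    have e1 : a (‖x‖ ^ 2) = g (EuclideanSpace.single o ‖x‖) o o := by simp only [a, hsq]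
    have e2 : b (‖x‖ ^ 2) = g (EuclideanSpace.single o ‖x‖) p p := by simp only [b, hsq]
    show _ = b (‖x‖ ^ 2) * kd i j + (a (‖x‖ ^ 2) - b (‖x‖ ^ 2)) / ‖x‖ ^ 2 * (x i * x j)
    rw [hgx, e1, e2]
    generalize g (EuclideanSpace.single o ‖x‖) = G at *
    simp only [Matrix.mul_apply, Matrix.transpose_apply]
    have h1 : ∀ l, (∑ k, A i k * G k l) * A j l =
        G p p * (A i l * A j l) + kd l o * ((G o o - G p p) * A i o * A j l) := by
      intro l
      have : ∀ k, A i k * G k l = kd k l * (G p p * A i k) +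
          kd k o * ((G o o - G p p) * A i k * kd l o) := fun k => by rw [hG k l]; ring
      rw [Finset.sum_congr rfl fun k _ => this k, Finset.sum_add_distrib, sum_kd_mul, sum_kd_mul]
      ring
    rw [Finset.sum_congr rfl fun l _ => h1 l, Finset.sum_add_distrib, ← Finset.mul_sum, hAA',
      sum_kd_mul, hAo, hAo]
    simp only [PiLp.smul_apply, smul_eq_mul]
    field_simp

/-! ### Symmetric spheres -/

/-- The matrix determinant lemma: n - 1 tangential eigenvalues B and one radial eigenvalue B + t C.
-/
theorem HasForm.det_eq {n : ℕ} (hn : 1 ≤ n) {g : MetricTensor n} {B C : ℝ → ℝ} (h : HasForm g B C)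
    {x : V n} (hx : x ∈ ext n) (hB : B (‖x‖ ^ 2) ≠ 0) :
    (g x).det = B (‖x‖ ^ 2) ^ (n - 1) * (B (‖x‖ ^ 2) + ‖x‖ ^ 2 * C (‖x‖ ^ 2)) := by
  have hg := h x hx
  have ht := norm_sq_eq_sum x
  generalize ‖x‖ ^ 2 = t at *
  generalize B t = b at *
  generalize C t = c at *
  have hgx : g x = b • (1 + Matrix.replicateCol Unit (fun i => c / b * x i) *
      Matrix.replicateRow Unit (fun i => x i)) := by
    ext i j
    rw [hg]
    simp only [Matrix.smul_apply, Matrix.add_apply, Matrix.mul_apply, Matrix.one_apply, kd,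
      Matrix.replicateCol_apply, Matrix.replicateRow_apply, Finset.univ_unique,
      Finset.sum_singleton, smul_eq_mul]
    field_simp
  rw [hgx, Matrix.det_smul, Matrix.det_one_add_replicateCol_mul_replicateRow, Fintype.card_fin,
    dotProduct]
  have : ∀ i, x i * (c / b * x i) = x i * x i * (c / b) := fun i => by ring
  rw [Finset.sum_congr rfl fun i _ => this i, ← Finset.sum_mul, ht]
  obtain ⟨m, rfl⟩ : ∃ m, n = m + 1 := ⟨n - 1, by omega⟩
  simp only [Nat.add_sub_cancel, pow_succ]
  field_simp

theorem hasPd_sph {n : ℕ} {ρ : ℝ} {x : V n} (hx : x ∈ ext n) (i : Fin n) :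
    HasPd i (sph ρ) x (x i / ‖x‖) := by
  have hx0 : 0 < ‖x‖ := lt_of_lt_of_le one_pos hx
  have h1 : HasDerivWithinAt (fun t : ℝ => √t - ρ) (1 / (2 * √(‖x‖ ^ 2))) (Ici 1) (‖x‖ ^ 2) :=
    ((Real.hasDerivAt_sqrt (by positivity)).sub_const ρ).hasDerivWithinAt
  refine ((HasPd.radial h1).congr hx fun y _ => ?_).congr_deriv ?_
  · simp [sph, Real.sqrt_sq (norm_nonneg y)]
  · rw [Real.sqrt_sq hx0.le]
    field_simp

theorem sum_normalized_sq {n : ℕ} {x : V n} (hx : x ∈ ext n) :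
    ∑ i, (x i / ‖x‖) * (x i / ‖x‖) = 1 := by
  have hx0 : ‖x‖ ≠ 0 := (lt_of_lt_of_le one_pos hx).ne'
  have : ∀ i, (x i / ‖x‖) * (x i / ‖x‖) = x i * x i * (1 / ‖x‖ ^ 2) := fun i => by
    field_simp
  rw [Finset.sum_congr rfl fun i _ => this i, ← Finset.sum_mul, norm_sq_eq_sum]
  field_simp

theorem HasForm.inv_mul_radial {n : ℕ} {g : MetricTensor n} {B C : ℝ → ℝ} (h : HasForm g B C)
    {x : V n} (hx : x ∈ ext n) (hB : B (‖x‖ ^ 2) ≠ 0)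
    (hC : B (‖x‖ ^ 2) + ‖x‖ ^ 2 * C (‖x‖ ^ 2) ≠ 0) (i : Fin n) :
    ∑ j, (g x)⁻¹ i j * (x j / ‖x‖) =
      x i / ‖x‖ / (B (‖x‖ ^ 2) + ‖x‖ ^ 2 * C (‖x‖ ^ 2)) := by
  have hx0 : ‖x‖ ≠ 0 := (lt_of_lt_of_le one_pos hx).ne'
  have hI := h.inv_apply hx hB hC
  have ht := norm_sq_eq_sum x
  generalize B (‖x‖ ^ 2) = b at *
  generalize C (‖x‖ ^ 2) = c at *
  have : ∀ j, (g x)⁻¹ i j * (x j / ‖x‖) = kd i j * (1 / b * (x j / ‖x‖)) -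
      x j * x j * (1 / b * (c / (b + ‖x‖ ^ 2 * c)) * (x i / ‖x‖)) := by
    intro j
    rw [hI]
    ring
  rw [Finset.sum_congr rfl fun j _ => this j, Finset.sum_sub_distrib, sum_kd_mul',
    ← Finset.sum_mul, ht]
  generalize hw : b + ‖x‖ ^ 2 * c = w at *
  field_simp
  rw [← hw]
  ring

theorem HasForm.gradNorm_sph {n : ℕ} {g : MetricTensor n} {B C : ℝ → ℝ} (h : HasForm g B C)
    {x : V n} (hx : x ∈ ext n) (hB : B (‖x‖ ^ 2) ≠ 0)
    (hC : B (‖x‖ ^ 2) + ‖x‖ ^ 2 * C (‖x‖ ^ 2) ≠ 0) (ρ : ℝ) :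
    gradNorm g (sph ρ) x = √(1 / (B (‖x‖ ^ 2) + ‖x‖ ^ 2 * C (‖x‖ ^ 2))) := by
  unfold gradNorm
  congr 1
  simp only [fun i => (hasPd_sph (ρ := ρ) hx i).pd_eq hx]
  have h1 : ∀ i, ∑ j, (g x)⁻¹ i j * (x i / ‖x‖) * (x j / ‖x‖) =
      x i / ‖x‖ * (x i / ‖x‖) * (1 / (B (‖x‖ ^ 2) + ‖x‖ ^ 2 * C (‖x‖ ^ 2))) := by
    intro i
    rw [mul_assoc, ← div_eq_mul_one_div (x i / ‖x‖), ← h.inv_mul_radial hx hB hC i, Finset.mul_sum]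
    exact Finset.sum_congr rfl fun j _ => by ring
  rw [Finset.sum_congr rfl fun i _ => h1 i, ← Finset.sum_mul, sum_normalized_sq hx, one_mul]

/-- The right side is the derivative of t B(t), the squared area radius: a symmetric sphere is
minimal exactly when its area is stationary. -/
theorem HasForm.meanCurv_sph_eq_zero_iff {n : ℕ} (hn : 2 ≤ n) {g : MetricTensor n}
    {B C B' : ℝ → ℝ} (h : HasForm g B C)
    (hB' : ∀ t ∈ Ici (1 : ℝ), HasDerivWithinAt B (B' t) (Ici 1) t)
    (hpos : ∀ t ∈ Ici (1 : ℝ), 0 < B t ∧ 0 < B t + t * C t) {x : V n} (hx : x ∈ ext n) (ρ : ℝ) :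
    meanCurv g (sph ρ) x = 0 ↔ B (‖x‖ ^ 2) + ‖x‖ ^ 2 * B' (‖x‖ ^ 2) = 0 := by
  -- The density √(det g) times the unit normal is F(|x|²) x; the radial coefficient cancels. Its
  -- flat divergence is n F + 2 t F'.
  let F : ℝ → ℝ := fun t => √(B t) ^ (n - 1) / √t
  have hF : ∀ y ∈ ext n, ∀ i, √(g y).det * (∑ j, (g y)⁻¹ i j * pd j (sph ρ) y) /
      gradNorm g (sph ρ) y = F (‖y‖ ^ 2) * y i := by
    intro y hy i
    obtain ⟨hb, ha⟩ := hpos _ (one_le_norm_sq hy)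
    rw [h.gradNorm_sph hy hb.ne' ha.ne', h.det_eq (by omega) hy hb.ne']
    simp only [fun i => (hasPd_sph (ρ := ρ) hy i).pd_eq hy, h.inv_mul_radial hy hb.ne' ha.ne', F]
    rw [Real.sqrt_mul (by positivity), Real.sqrt_sq (norm_nonneg y), Real.sqrt_div zero_le_one,
      Real.sqrt_one]
    have hy0 : ‖y‖ ≠ 0 := (lt_of_lt_of_le one_pos hy).ne'
    have hs : √(B (‖y‖ ^ 2) ^ (n - 1)) = √(B (‖y‖ ^ 2)) ^ (n - 1) := by
      rw [Real.sqrt_eq_iff_mul_self_eq (by positivity) (by positivity), ← mul_pow,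
        Real.mul_self_sqrt hb.le]
    rw [hs]
    have hsa := Real.sqrt_pos.2 ha
    have hsa' := Real.sq_sqrt ha.le
    generalize B (‖y‖ ^ 2) + ‖y‖ ^ 2 * C (‖y‖ ^ 2) = w at *
    field_simp
    linear_combination y i * hsa'
  have ht1 : ‖x‖ ^ 2 ∈ Ici (1 : ℝ) := one_le_norm_sq hx
  have hx0 : 0 < ‖x‖ := lt_of_lt_of_le one_pos hx
  obtain ⟨hb, ha⟩ := hpos _ ht1
  have hsb := Real.sqrt_pos.2 hb
  have hF' : HasDerivWithinAt F (F (‖x‖ ^ 2) * ((n - 1) * B' (‖x‖ ^ 2) / (2 * B (‖x‖ ^ 2)) -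
      1 / (2 * ‖x‖ ^ 2))) (Ici 1) (‖x‖ ^ 2) := by
    have h1 := (((hB' _ ht1).sqrt hb.ne').pow (n - 1)).div
      (Real.hasDerivAt_sqrt (x := ‖x‖ ^ 2) (by positivity)).hasDerivWithinAt
      (by positivity)
    refine h1.congr_deriv ?_
    simp only [F, Pi.pow_apply]
    rw [Real.sqrt_sq hx0.le]
    obtain ⟨m, rfl⟩ : ∃ m, n = m + 2 := ⟨n - 2, by omega⟩
    have e1 : m + 2 - 1 = m + 1 := by omega
    have e2 : m + 1 - 1 = m := by omega
    rw [e1, e2, pow_succ √(B (‖x‖ ^ 2))]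
    push_cast
    have hsb' := Real.sq_sqrt hb.le
    generalize √(B (‖x‖ ^ 2)) = s at *
    rw [← hsb']
    field_simp
    ring
  have hpd : ∀ i, pd i (fun y => √(g y).det * (∑ j, (g y)⁻¹ i j * pd j (sph ρ) y) /
      gradNorm g (sph ρ) y) x = F (‖x‖ ^ 2) + x i * x i * (2 * (F (‖x‖ ^ 2) *
      ((n - 1) * B' (‖x‖ ^ 2) / (2 * B (‖x‖ ^ 2)) - 1 / (2 * ‖x‖ ^ 2)))) := by
    intro i
    rw [(((HasPd.radial hF').mul (HasPd.coord i)).congr hx fun y hy => hF y hy i).pd_eq hx, kd_self]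
    ring
  unfold meanCurv
  rw [Finset.sum_congr rfl fun i _ => hpd i, Finset.sum_add_distrib, ← Finset.sum_mul,
    norm_sq_eq_sum, Finset.sum_const, Finset.card_univ, Fintype.card_fin, nsmul_eq_mul]
  have hdet : 0 < (g x).det := by
    rw [h.det_eq (by omega) hx hb.ne']
    positivity
  have hF0 : 0 < F (‖x‖ ^ 2) := by
    simp only [F]
    positivity
  have hn1 : (0 : ℝ) < n - 1 := by
    have : (2 : ℝ) ≤ n := by exact_mod_cast hn
    linarith
  have : 1 / √(g x).det * (n * F (‖x‖ ^ 2) + ‖x‖ ^ 2 * (2 * (F (‖x‖ ^ 2) *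
      ((n - 1) * B' (‖x‖ ^ 2) / (2 * B (‖x‖ ^ 2)) - 1 / (2 * ‖x‖ ^ 2))))) =
      (1 / √(g x).det * F (‖x‖ ^ 2) * (n - 1) / B (‖x‖ ^ 2)) *
        (B (‖x‖ ^ 2) + ‖x‖ ^ 2 * B' (‖x‖ ^ 2)) := by
    field_simp
    ring
  rw [this, mul_eq_zero]
  constructor
  · rintro (h0 | h0)
    · exact absurd h0 (by positivity)
    · exact h0
  · exact Or.inr

theorem levelSet_sph {n : ℕ} {ρ : ℝ} (hρ : 1 ≤ ρ) :
    levelSet (sph ρ : V n → ℝ) = Metric.sphere 0 ρ := by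
  ext x
  simp only [levelSet, sph, ext, mem_sphere_iff_norm, sub_zero]
  constructor
  · rintro ⟨-, h⟩
    exact sub_eq_zero.1 h
  · intro h
    exact ⟨show 1 ≤ ‖x‖ from h ▸ hρ, sub_eq_zero.2 h⟩

/-- Spheres are the competitors to which the outermost condition is applied. -/
theorem isEnclosing_sph {n : ℕ} {ρ : ℝ} (hρ : 1 < ρ) : IsEnclosing (sph ρ : V n → ℝ) := by
  refine ⟨?_, fun x hx => ?_, ?_, fun x hx h0 => ?_⟩
  · intro x hx
    have hx0 : x ≠ 0 := norm_pos_iff.1 (lt_of_lt_of_le one_pos hx)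
    exact ((contDiffAt_norm ℝ hx0).sub contDiffAt_const).contDiffWithinAt
  · simp [sph, hx, hρ]
  · have : {x : V n | x ∈ ext n ∧ sph ρ x ≤ 0} = Metric.closedBall 0 ρ ∩ {x | 1 ≤ ‖x‖} := by
      ext x
      simp [ext, sph, and_comm]
    rw [this]
    exact (isCompact_closedBall 0 ρ).inter_right (isClosed_le continuous_const continuous_norm)
  · have h1 : ∀ i, x i / ‖x‖ = 0 := by
      intro i
      rw [← (hasPd_sph (ρ := ρ) hx.1 i).pd_eq hx.1, pd, h0]
      rfl
    have := sum_normalized_sq hx.1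
    simp [h1] at this

/-! ### The area of the unit sphere -/

/-- Radial projection to the unit sphere is Lipschitz with constant 2/‖x‖. It serves both for the
area of the sphere and for the directions of curves. -/
theorem norm_mul_norm_normalize_sub_le {E : Type*} [NormedAddCommGroup E] [NormedSpace ℝ E]
    {x y : E} (hx : x ≠ 0) (hy : y ≠ 0) :
    ‖x‖ * ‖‖x‖⁻¹ • x - ‖y‖⁻¹ • y‖ ≤ 2 * ‖x - y‖ := by
  have hx0 : 0 < ‖x‖ := norm_pos_iff.2 hx
  have hy0 : 0 < ‖y‖ := norm_pos_iff.2 hy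
  have h1 : ‖x‖⁻¹ • x - ‖y‖⁻¹ • y = ‖x‖⁻¹ • (x - y) + (‖x‖⁻¹ - ‖y‖⁻¹) • y := by
    rw [smul_sub, sub_smul]
    abel
  have h2 : |‖x‖⁻¹ - ‖y‖⁻¹| * ‖y‖ = ‖x‖⁻¹ * |‖x‖ - ‖y‖| := by
    rw [inv_sub_inv hx0.ne' hy0.ne', abs_div, abs_of_pos (mul_pos hx0 hy0), abs_sub_comm]
    field_simp
  have h3 : ‖‖x‖⁻¹ • x - ‖y‖⁻¹ • y‖ ≤ ‖x‖⁻¹ * ‖x - y‖ + ‖x‖⁻¹ * |‖x‖ - ‖y‖| := by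
    rw [h1]
    refine (norm_add_le _ _).trans (le_of_eq ?_)
    rw [norm_smul, norm_smul, Real.norm_eq_abs, Real.norm_eq_abs, h2, abs_of_pos (inv_pos.2 hx0)]
  refine (mul_le_mul_of_nonneg_left h3 hx0.le).trans ?_
  rw [mul_add, mul_inv_cancel_left₀ hx0.ne', mul_inv_cancel_left₀ hx0.ne']
  linarith [abs_norm_sub_norm_le x y]

theorem lipschitzOnWith_euclideanHausdorffMeasure_image_le {X Y : Type*}
    [EMetricSpace X] [MeasurableSpace X] [BorelSpace X]
    [EMetricSpace Y] [MeasurableSpace Y] [BorelSpace Y] {K : NNReal} {f : X → Y} {s : Set X}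
    (h : LipschitzOnWith K f s) (d : ℕ) :
    Measure.euclideanHausdorffMeasure d (f '' s) ≤
      (K : ℝ≥0∞) ^ d * Measure.euclideanHausdorffMeasure d s := by
  simp only [Measure.euclideanHausdorffMeasure_def, Measure.smul_apply]
  have := h.hausdorffMeasure_image_le (d := d) (by positivity)
  rw [ENNReal.rpow_natCast] at this
  rw [ENNReal.smul_def, ENNReal.smul_def, smul_eq_mul, smul_eq_mul, mul_left_comm]
  gcongr

/-- Insertion of a coordinate in `ℝᵈ`. -/
def insertCoord {d : ℕ} (i : Fin (d + 1)) (s : ℝ) (y : V d) : V (d + 1) :=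
  WithLp.toLp 2 (Fin.insertNth i s (fun k => y k) : Fin (d + 1) → ℝ)

theorem norm_insertCoord_sub {d : ℕ} (i : Fin (d + 1)) (s : ℝ) (y z : V d) :
    ‖insertCoord i s y - insertCoord i s z‖ = ‖y - z‖ := by
  have h0 : ∀ y : V d, insertCoord i s y i = s := fun y => by simp [insertCoord]
  have hs : ∀ (y : V d) k, insertCoord i s y (i.succAbove k) = y k := fun y k => by
    simp [insertCoord]
  rw [EuclideanSpace.norm_eq, EuclideanSpace.norm_eq, Fin.sum_univ_succAbove _ i]
  simp [h0, hs]

/-- Dropping a coordinate is 1-Lipschitz and maps the sphere onto a set containing the open unit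
ball. Positivity and finiteness together make division by `omega` meaningful. -/
theorem sphere_measure_pos (d : ℕ) :
    0 < Measure.euclideanHausdorffMeasure d (Metric.sphere (0 : V (d + 1)) 1) := by
  let f : V (d + 1) → V d := fun x => WithLp.toLp 2 fun k => x k.succ
  have hf : LipschitzOnWith 1 f (Metric.sphere 0 1) := by
    refine LipschitzOnWith.of_dist_le_mul fun x _ y _ => ?_
    rw [NNReal.coe_one, one_mul, EuclideanSpace.dist_eq, EuclideanSpace.dist_eq]
    apply Real.sqrt_le_sqrt
    rw [Fin.sum_univ_succ (fun i => dist (x i) (y i) ^ 2)]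
    exact le_add_of_nonneg_left (sq_nonneg _)
  have h := lipschitzOnWith_euclideanHausdorffMeasure_image_le hf d
  rw [ENNReal.coe_one, one_pow, one_mul] at h
  refine lt_of_lt_of_le ?_ h
  refine lt_of_lt_of_le ?_ (measure_mono (s := Metric.ball (0 : V d) 1) ?_)
  · rw [EuclideanSpace.euclideanHausdorffMeasure_eq_volume]
    exact Metric.measure_ball_pos _ _ one_pos
  · intro y hy
    have hy1 : ‖y‖ < 1 := by simpa using hy
    have hy2 : 0 ≤ 1 - ‖y‖ ^ 2 := by nlinarith [norm_nonneg y]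
    refine ⟨insertCoord 0 (√(1 - ‖y‖ ^ 2)) y, ?_, ?_⟩
    · rw [mem_sphere_iff_norm, sub_zero, ← sq_eq_sq₀ (norm_nonneg _) zero_le_one,
        EuclideanSpace.real_norm_sq_eq, Fin.sum_univ_succ]
      simp only [insertCoord, Fin.insertNth_zero', Fin.cons_zero, Fin.cons_succ]
      rw [Real.sq_sqrt hy2, EuclideanSpace.real_norm_sq_eq]
      ring
    · ext k
      simp [f, insertCoord]

/-- The sphere is covered by the radial projections of the 2(d + 1) faces of a cube. Points on the
faces have norm at least 1, so each projection is 2-Lipschitz. -/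
theorem sphere_measure_lt_top (d : ℕ) :
    Measure.euclideanHausdorffMeasure d (Metric.sphere (0 : V (d + 1)) 1) < ⊤ := by
  let sgn : Bool → ℝ := fun b => if b then 1 else -1
  let f : Fin (d + 1) × Bool → V d → V (d + 1) := fun p y =>
    ‖insertCoord p.1 (sgn p.2) y‖⁻¹ • insertCoord p.1 (sgn p.2) y
  have hone : ∀ (p : Fin (d + 1) × Bool) (y : V d), 1 ≤ ‖insertCoord p.1 (sgn p.2) y‖ := by
    intro p y
    have h := PiLp.norm_apply_le (insertCoord p.1 (sgn p.2) y : V (d + 1)) p.1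
    refine le_trans ?_ h
    rcases p with ⟨i, b⟩
    cases b <;> simp [insertCoord, sgn]
  have hlip : ∀ p, LipschitzOnWith 2 (f p) (Metric.closedBall 0 (√d)) := by
    intro p
    refine LipschitzOnWith.of_dist_le_mul fun y _ z _ => ?_
    rw [dist_eq_norm, dist_eq_norm, ← norm_insertCoord_sub p.1 (sgn p.2)]
    have h0 : ∀ y, insertCoord p.1 (sgn p.2) y ≠ 0 := fun y =>
      norm_pos_iff.1 (one_pos.trans_le (hone p y))
    refine le_trans ?_ (norm_mul_norm_normalize_sub_le (h0 y) (h0 z))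
    exact le_mul_of_one_le_left (norm_nonneg _) (hone p y)
  have hcover : Metric.sphere (0 : V (d + 1)) 1 ⊆ ⋃ p, f p '' Metric.closedBall 0 (√d) := by
    intro x hx
    have hx1 : ‖x‖ = 1 := by simpa using hx
    -- The coordinate of largest modulus, with its sign, selects the face.
    obtain ⟨i, -, hi⟩ := Finset.exists_max_image Finset.univ (fun k => |x k|) ⟨0, Finset.mem_univ 0⟩
    have hxi : 0 < |x i| := by
      by_contra hcon
      have : x = 0 := by
        ext k
        exact abs_nonpos_iff.1 ((hi k (Finset.mem_univ k)).trans (not_lt.1 hcon))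
      rw [this, norm_zero] at hx1
      exact zero_ne_one hx1
    obtain ⟨b, hb⟩ : ∃ b, sgn b = |x i|⁻¹ * x i := by
      rcases lt_or_gt_of_ne (abs_pos.1 hxi) with h | h
      · refine ⟨false, ?_⟩
        rw [abs_of_neg h]
        rw [inv_neg, neg_mul, inv_mul_cancel₀ h.ne]
        rfl
      · refine ⟨true, ?_⟩
        rw [abs_of_pos h, inv_mul_cancel₀ h.ne']
        rfl
    let y : V d := WithLp.toLp 2 fun k => |x i|⁻¹ * x (i.succAbove k)
    have hins : insertCoord i (sgn b) y = |x i|⁻¹ • x := by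
      ext k
      rcases Fin.eq_self_or_eq_succAbove i k with rfl | ⟨j, rfl⟩
      · simp [insertCoord, hb]
      · simp [insertCoord, y]
    refine mem_iUnion.2 ⟨(i, b), y, ?_, ?_⟩
    · rw [mem_closedBall_zero_iff, EuclideanSpace.norm_eq]
      apply Real.sqrt_le_sqrt
      calc ∑ k, ‖y k‖ ^ 2 ≤ ∑ _k : Fin d, (1 : ℝ) := by
            refine Finset.sum_le_sum fun k _ => ?_
            have : ‖y k‖ ≤ 1 := by
              simp only [y, Real.norm_eq_abs, abs_mul, abs_inv, abs_abs]
              rw [inv_mul_le_iff₀ hxi, mul_one]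
              exact hi _ (Finset.mem_univ _)
            exact pow_le_one₀ (norm_nonneg _) this
        _ = d := by simp
    · show ‖insertCoord i (sgn b) y‖⁻¹ • insertCoord i (sgn b) y = x
      rw [hins, norm_smul, hx1, mul_one, norm_inv, Real.norm_eq_abs, abs_abs, inv_inv, smul_smul,
        mul_inv_cancel₀ hxi.ne', one_smul]
  refine (measure_mono hcover).trans_lt ((measure_iUnion_le _).trans_lt ?_)
  rw [tsum_fintype]
  refine ENNReal.sum_lt_top.2 fun p _ => ?_
  refine (lipschitzOnWith_euclideanHausdorffMeasure_image_le (hlip p) d).trans_lt ?_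
  rw [EuclideanSpace.euclideanHausdorffMeasure_eq_volume]
  exact ENNReal.mul_lt_top (by simp) measure_closedBall_lt_top

/-! ### The area radius -/

open scoped Pointwise in
-- The radial eigenvalue in √(det g) cancels against |∇u|, leaving the tangential factor
-- B^((n-1)/2); the rest is scaling of Hausdorff measure.
theorem HasForm.area_sph {n : ℕ} (hn : 1 ≤ n) {g : MetricTensor n} {B C : ℝ → ℝ}
    (h : HasForm g B C) (hpos : ∀ t ∈ Ici (1 : ℝ), 0 < B t ∧ 0 < B t + t * C t) {ρ : ℝ}
    (hρ : 1 ≤ ρ) : area g (sph ρ) = ENNReal.ofReal ((ρ * √(B (ρ ^ 2))) ^ (n - 1)) *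
      Measure.euclideanHausdorffMeasure (n - 1) (Metric.sphere (0 : V n) 1) := by
  have hρ0 : 0 < ρ := lt_of_lt_of_le one_pos hρ
  have hint : ∀ x ∈ Metric.sphere (0 : V n) ρ,
      ENNReal.ofReal (√(g x).det * gradNorm g (sph ρ) x / √(∑ i, (pd i (sph ρ) x) ^ 2)) =
      ENNReal.ofReal (√(B (ρ ^ 2)) ^ (n - 1)) := by
    intro x hx
    have hxρ : ‖x‖ = ρ := by simpa using hx
    have hxe : x ∈ ext n := show 1 ≤ ‖x‖ from hxρ ▸ hρ
    obtain ⟨hb, ha⟩ := hpos _ (one_le_norm_sq hxe)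
    rw [h.gradNorm_sph hxe hb.ne' ha.ne', h.det_eq hn hxe hb.ne']
    simp only [fun i => (hasPd_sph (ρ := ρ) hxe i).pd_eq hxe, sq (_ / _)]
    rw [sum_normalized_sq hxe, Real.sqrt_one, div_one, ← hxρ, ← Real.sqrt_mul (by positivity),
      mul_assoc, mul_one_div_cancel ha.ne', mul_one]
    congr 1
    rw [Real.sqrt_eq_iff_mul_self_eq (by positivity) (by positivity), ← mul_pow,
      Real.mul_self_sqrt hb.le]
  unfold area
  rw [levelSet_sph hρ, setLIntegral_congr_fun Metric.isClosed_sphere.measurableSet hint,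
    setLIntegral_const]
  have hsph : Metric.sphere (0 : V n) ρ = ρ • Metric.sphere (0 : V n) 1 := by
    rw [smul_sphere' hρ0.ne']
    simp [abs_of_pos hρ0]
  rw [hsph, Measure.euclideanHausdorffMeasure_smul₀ _ hρ0.ne', ENNReal.smul_def, smul_eq_mul,
    ← mul_assoc, mul_pow, mul_comm (ρ ^ (n - 1)), ENNReal.ofReal_mul (by positivity)]
  congr 2
  rw [ENNReal.coe_pow, ENNReal.ofReal_pow hρ0.le]
  congr 1
  rw [ENNReal.ofReal, Real.toNNReal_eq_nnnorm_of_nonneg hρ0.le]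

theorem omega_pos {n : ℕ} (hn : 1 ≤ n) : 0 < omega n := by
  obtain ⟨d, rfl⟩ : ∃ d, n = d + 1 := ⟨n - 1, by omega⟩
  exact ENNReal.toReal_pos (sphere_measure_pos d).ne' (sphere_measure_lt_top d).ne

theorem HasForm.area_sph_div_omega {n : ℕ} (hn : 1 ≤ n) {g : MetricTensor n} {B C : ℝ → ℝ}
    (h : HasForm g B C) (hpos : ∀ t ∈ Ici (1 : ℝ), 0 < B t ∧ 0 < B t + t * C t) {ρ : ℝ}
    (hρ : 1 ≤ ρ) : (area g (sph ρ)).toReal / omega n = (ρ * √(B (ρ ^ 2))) ^ (n - 1) := by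
  have hρ0 : 0 < ρ := lt_of_lt_of_le one_pos hρ
  rw [h.area_sph hn hpos hρ, ENNReal.toReal_mul, ENNReal.toReal_ofReal (by positivity)]
  exact mul_div_cancel_right₀ _ (omega_pos hn).ne'

theorem HasForm.areaRadius_eq {n : ℕ} (hn : 2 ≤ n) {g : MetricTensor n} {B C : ℝ → ℝ}
    (h : HasForm g B C) (hpos : ∀ t ∈ Ici (1 : ℝ), 0 < B t ∧ 0 < B t + t * C t) {ρ : ℝ}
    (hρ : 1 ≤ ρ) : areaRadius g ρ = ρ * √(B (ρ ^ 2)) := by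
  have hρ0 : 0 < ρ := lt_of_lt_of_le one_pos hρ
  rw [areaRadius, h.area_sph_div_omega (by omega) hpos hρ, one_div]
  have : ((n : ℝ) - 1) = ((n - 1 : ℕ) : ℝ) := by
    rw [Nat.cast_sub (by omega), Nat.cast_one]
  rw [this, Real.pow_rpow_inv_natCast (by positivity) (by omega)]

theorem HasForm.normSq_eq {n : ℕ} {g : MetricTensor n} {B C : ℝ → ℝ} (h : HasForm g B C)
    {x : V n} (hx : x ∈ ext n) (v : V n) :
    normSq g x v = B (‖x‖ ^ 2) * ‖v‖ ^ 2 + C (‖x‖ ^ 2) * inner ℝ x v ^ 2 := by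
  have hin : inner ℝ x v = ∑ i, x i * v i := by
    simp [PiLp.inner_apply, mul_comm]
  unfold normSq
  have h1 : ∀ i, ∑ j, g x i j * v i * v j = v i * v i * B (‖x‖ ^ 2) +
      x i * v i * (C (‖x‖ ^ 2) * inner ℝ x v) := by
    intro i
    have : ∀ j, g x i j * v i * v j = kd i j * (B (‖x‖ ^ 2) * v i * v j) +
        x j * v j * (C (‖x‖ ^ 2) * x i * v i) := fun j => by rw [h x hx]; ring
    rw [Finset.sum_congr rfl fun j _ => this j, Finset.sum_add_distrib, sum_kd_mul',
      ← Finset.sum_mul, ← hin]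
    ring
  rw [Finset.sum_congr rfl fun i _ => h1 i, Finset.sum_add_distrib, ← Finset.sum_mul,
    ← Finset.sum_mul, norm_sq_eq_sum, ← hin]
  ring

theorem HasForm.radialSpeed_eq {n : ℕ} (hn : 1 ≤ n) {g : MetricTensor n} {B C : ℝ → ℝ}
    (h : HasForm g B C) {ρ : ℝ} (hρ : 1 ≤ ρ) :
    radialSpeed g ρ = √(B (ρ ^ 2) + ρ ^ 2 * C (ρ ^ 2)) := by
  have hu : ‖unitVec n‖ = 1 := by
    rw [EuclideanSpace.norm_eq, Real.sqrt_eq_one]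
    simp only [unitVec, Real.norm_eq_abs, sq_abs, div_pow, one_pow,
      Real.sq_sqrt (Nat.cast_nonneg n), Finset.sum_const, Finset.card_univ, Fintype.card_fin,
      nsmul_eq_mul]
    have : (n : ℝ) ≠ 0 := by positivity
    field_simp
  have hnorm : ‖ρ • unitVec n‖ = ρ := by
    rw [norm_smul, hu, mul_one, Real.norm_of_nonneg (zero_le_one.trans hρ)]
  have hx : ρ • unitVec n ∈ ext n := show 1 ≤ ‖ρ • unitVec n‖ from hnorm.symm ▸ hρ
  rw [radialSpeed, h.normSq_eq hx, hnorm, hu, real_inner_smul_left, real_inner_self_eq_norm_sq, hu]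
  congr 1
  ring

/-! ### Rotationally symmetric metrics as warped products -/

/-- The data of a warped product `A(ρ)² dρ² + R(ρ)² g_{S^{n-1}}` on `ρ ≥ 1` with minimal boundary,
increasing unbounded radii and nondecreasing Hawking mass. -/
structure WarpData (n : ℕ) (A R R' : ℝ → ℝ) : Prop where
  continuous_speed : Continuous A
  speed_pos : ∀ ρ, 0 < A ρ
  continuousOn_radius : ContinuousOn R (Ici 1)
  radius_pos : ∀ ρ ∈ Ici (1 : ℝ), 0 < R ρ
  hasDerivAt_radius : ∀ ρ, 1 < ρ → HasDerivAt R (R' ρ) ρ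
  continuousOn_deriv : ContinuousOn R' (Ici 1)
  deriv_pos : ∀ ρ, 1 < ρ → 0 < R' ρ
  deriv_one : R' 1 = 0
  mass_mono : MonotoneOn (fun ρ => R ρ ^ (n - 2) * (1 - (R' ρ / A ρ) ^ 2)) (Ici 1)
  unbounded : ∀ K, ∃ ρ, 1 ≤ ρ ∧ K < R ρ

/-- With m = n - 2, y the squared area radius and a the radial coefficient, the function is twice
the Hawking mass in the variable t = ρ². The last factor of the derivative is the bracket in
`HasForm.scalarCurv_eq`, so its sign is that of the scalar curvature. -/
theorem mass_hasDerivWithinAt {m : ℕ} {y y' a : ℝ → ℝ} {y'' a' t : ℝ} {s : Set ℝ}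
    (hy : HasDerivWithinAt y (y' t) s t) (hy' : HasDerivWithinAt y' y'' s t)
    (ha : HasDerivWithinAt a a' s t) (hy0 : 0 < y t) (ha0 : 0 < a t) :
    HasDerivWithinAt (fun t => √(y t) ^ m * (1 - t * y' t ^ 2 / (y t * a t)))
      (√(y t) ^ m * y' t / (2 * y t) * (m * (1 - t * y' t ^ 2 / (y t * a t)) -
        2 * ((y' t + 2 * t * y'') / a t - t * y' t ^ 2 / (y t * a t) -
          t * y' t * a' / a t ^ 2))) s t := by
  have h1 := ((hy.sqrt hy0.ne').pow m).mul ((((hasDerivWithinAt_id t s).mul (hy'.pow 2)).div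
    (hy.mul ha) (mul_pos hy0 ha0).ne').const_sub 1)
  have hs := Real.sqrt_pos.2 hy0
  have hs' := Real.sq_sqrt hy0.le
  refine h1.congr_deriv ?_
  simp only [Pi.pow_apply, Pi.mul_apply, id_eq, Pi.div_apply]
  generalize √(y t) = r at *
  rw [← hs']
  rcases m with _ | m
  · simp
    field_simp
    ring
  · rw [Nat.add_sub_cancel, pow_succ]
    push_cast
    field_simp
    ring

theorem ContDiffOn.exists_hasDerivWithinAt {f : ℝ → ℝ} {s : Set ℝ} (hs : UniqueDiffOn ℝ s)
    (hf : ContDiffOn ℝ ∞ f s) :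
    ∃ f' : ℝ → ℝ, ContDiffOn ℝ ∞ f' s ∧ ∀ t ∈ s, HasDerivWithinAt f (f' t) s t := by
  rw [contDiffOn_infty_iff_derivWithin hs] at hf
  exact ⟨derivWithin f s, hf.2, fun t ht => (hf.1 t ht).hasDerivWithinAt⟩

/-- This is where the geometric hypotheses become facts about functions of one variable; the
Lipschitz estimate afterwards uses only the data produced here. -/
theorem IsRotSym.exists_warpData {n : ℕ} (hn : 3 ≤ n) {g : MetricTensor n} (hg : IsRotSym g)
    (hu : UnboundedRadii g) : ∃ A R R' : ℝ → ℝ, WarpData n A R R' ∧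
      (∀ ρ, 1 ≤ ρ → areaRadius g ρ = R ρ) ∧ (∀ ρ, 1 ≤ ρ → radialSpeed g ρ = A ρ) ∧
      (∀ x ∈ ext n, ∀ v, normSq g x v = A ‖x‖ ^ 2 * (inner ℝ x v / ‖x‖) ^ 2 +
        (R ‖x‖ / ‖x‖) ^ 2 * (‖v‖ ^ 2 - (inner ℝ x v / ‖x‖) ^ 2)) ∧
      boundaryArea g / omega n = R 1 ^ (n - 1) := by
  obtain ⟨B, C, hBs, hCs, hpos, hform⟩ := exists_hasForm hn hg.riemannian hg.rotInvariant
  have hU : UniqueDiffOn ℝ (Ici (1 : ℝ)) := uniqueDiffOn_Ici 1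
  obtain ⟨B', hBs', hB'⟩ := ContDiffOn.exists_hasDerivWithinAt hU hBs
  obtain ⟨B'', -, hB''⟩ := ContDiffOn.exists_hasDerivWithinAt hU hBs'
  obtain ⟨C', hCs', hC'⟩ := ContDiffOn.exists_hasDerivWithinAt hU hCs
  obtain ⟨C'', -, hC''⟩ := ContDiffOn.exists_hasDerivWithinAt hU hCs'
  let o : Fin n := ⟨0, by omega⟩
  have hpt : ∀ ρ : ℝ, 1 ≤ ρ → ∃ x : V n, ‖x‖ = ρ ∧ x ∈ ext n := by
    intro ρ hρ
    have : ‖(EuclideanSpace.single o ρ : V n)‖ = ρ := by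
      rw [PiLp.norm_single, Real.norm_of_nonneg (zero_le_one.trans hρ)]
    exact ⟨_, this, show 1 ≤ ‖(EuclideanSpace.single o ρ : V n)‖ from this.symm ▸ hρ⟩
  have hpt2 : ∀ t ∈ Ici (1 : ℝ), ∃ x : V n, ‖x‖ ^ 2 = t ∧ x ∈ ext n ∧ ‖x‖ = √t := by
    intro t ht
    obtain ⟨x, hx, hxe⟩ := hpt (√t) (Real.one_le_sqrt.2 ht)
    exact ⟨x, by rw [hx, Real.sq_sqrt (zero_le_one.trans ht)], hxe, hx⟩
  let y : ℝ → ℝ := fun t => t * B t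
  let y' : ℝ → ℝ := fun t => B t + t * B' t
  let a : ℝ → ℝ := fun t => B t + t * C t
  have ht0 : ∀ t ∈ Ici (1 : ℝ), 0 < t := fun t ht => lt_of_lt_of_le one_pos ht
  have hy0 : ∀ t ∈ Ici (1 : ℝ), 0 < y t := fun t ht => mul_pos (ht0 t ht) (hpos t ht).1
  have ha0 : ∀ t ∈ Ici (1 : ℝ), 0 < a t := fun t ht => (hpos t ht).2
  have hy : ∀ t ∈ Ici (1 : ℝ), HasDerivWithinAt y (y' t) (Ici 1) t := fun t ht =>
    ((hasDerivWithinAt_id t _).mul (hB' t ht)).congr_deriv (by simp [y'])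
  have hy'd : ∀ t ∈ Ici (1 : ℝ), HasDerivWithinAt y' (2 * B' t + t * B'' t) (Ici 1) t :=
    fun t ht => ((hB' t ht).add ((hasDerivWithinAt_id t _).mul (hB'' t ht))).congr_deriv
      (by simp; ring)
  have had : ∀ t ∈ Ici (1 : ℝ), HasDerivWithinAt a (B' t + C t + t * C' t) (Ici 1) t :=
    fun t ht => ((hB' t ht).add ((hasDerivWithinAt_id t _).mul (hC' t ht))).congr_deriv
      (by simp; ring)
  have hycont : ContinuousOn y (Ici 1) := fun t ht => (hy t ht).continuousWithinAt
  have hy'cont : ContinuousOn y' (Ici 1) := fun t ht => (hy'd t ht).continuousWithinAt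
  have hacont : ContinuousOn a (Ici 1) := fun t ht => (had t ht).continuousWithinAt
  have hBcont : ContinuousOn B (Ici 1) := fun t ht => (hB' t ht).continuousWithinAt
  have hy'1 : y' 1 = 0 := by
    obtain ⟨x, hx, hxe⟩ := hpt 1 le_rfl
    have := (hform.meanCurv_sph_eq_zero_iff (by omega) hB' hpos hxe 1).1
      (hg.boundary_minimal x ⟨hxe, by simp [sph, hx]⟩)
    rw [hx, one_pow] at this
    exact this
  -- A critical radius away from the boundary would be an enclosing minimal sphere.
  have hy'ne : ∀ t, 1 < t → y' t ≠ 0 := by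
    intro t ht h0
    refine hg.outermost (sph (√t)) (isEnclosing_sph (Real.lt_sqrt_of_sq_lt (by simpa using ht)))
      fun x hx => ?_
    have hxt : ‖x‖ ^ 2 = t := by
      rw [sub_eq_zero.1 hx.2, Real.sq_sqrt (zero_le_one.trans ht.le)]
    rw [hform.meanCurv_sph_eq_zero_iff (by omega) hB' hpos hx.1, hxt]
    exact h0
  let R : ℝ → ℝ := fun ρ => √(y (ρ ^ 2))
  have hsq1 : ∀ ρ : ℝ, 1 ≤ ρ → ρ ^ 2 ∈ Ici (1 : ℝ) := fun ρ hρ => one_le_pow₀ hρ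
  have hRarea : ∀ ρ, 1 ≤ ρ → areaRadius g ρ = R ρ := by
    intro ρ hρ
    rw [hform.areaRadius_eq (by omega) hpos hρ]
    simp only [R, y]
    rw [Real.sqrt_mul (sq_nonneg ρ), Real.sqrt_sq (zero_le_one.trans hρ)]
  have hunb : ∀ K, ∃ ρ, 1 ≤ ρ ∧ K < R ρ := by
    intro K
    obtain ⟨ρ, hρ, hK⟩ := hu K
    exact ⟨ρ, hρ, hRarea ρ hρ ▸ hK⟩
  have hyIoi : ∀ t, 1 < t → HasDerivAt y (y' t) t := fun t ht =>
    (hy t ht.le).hasDerivAt (Ici_mem_nhds ht)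
  -- Having no zero, y' has constant sign for t > 1; were it negative, the radii would be bounded by
  -- that of the boundary.
  have hy'pos : ∀ t, 1 < t → 0 < y' t := by
    by_contra! hcon
    obtain ⟨t₀, ht₀, hneg⟩ := hcon
    have hneg' : ∀ t, 1 < t → y' t ≤ 0 := by
      intro t ht
      by_contra! hp
      have hc : IsPreconnected (Ioi (1 : ℝ)) := isPreconnected_Ioi
      obtain ⟨z, hz, hz0⟩ := hc.intermediate_value ht₀ ht (hy'cont.mono Ioi_subset_Ici_self)
        ⟨hneg, hp.le⟩
      exact hy'ne z hz hz0
    have hanti : AntitoneOn y (Ici 1) := by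
      refine antitoneOn_of_deriv_nonpos (convex_Ici 1) hycont ?_ ?_
      · rw [interior_Ici]
        exact fun t ht => (hyIoi t ht).differentiableAt.differentiableWithinAt
      · rw [interior_Ici]
        exact fun t ht => (hyIoi t ht).deriv ▸ hneg' t ht
    obtain ⟨ρ, hρ, hlt⟩ := hunb (R 1)
    have : R ρ ≤ R 1 := by
      refine Real.sqrt_le_sqrt (hanti ?_ (hsq1 ρ hρ) ?_)
      · simp
      · simpa using hsq1 ρ hρ
    exact absurd hlt (not_lt.2 this)
  -- Freezing the speed below ρ = 1 makes it continuous on the whole line, so its primitives are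
  -- differentiable at the boundary too.
  let A : ℝ → ℝ := fun ρ => √(a (max 1 ρ ^ 2))
  let R' : ℝ → ℝ := fun ρ => ρ * y' (ρ ^ 2) / R ρ
  have hmaxA : ∀ ρ, 1 ≤ ρ → A ρ = √(a (ρ ^ 2)) := fun ρ hρ => by simp only [A, max_eq_right hρ]
  have hRpos : ∀ ρ ∈ Ici (1 : ℝ), 0 < R ρ := fun ρ hρ => Real.sqrt_pos.2 (hy0 _ (hsq1 ρ hρ))
  have hsqc : ContinuousOn (fun ρ : ℝ => ρ ^ 2) (Ici 1) := by fun_prop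
  have hRcont : ContinuousOn R (Ici 1) := (hycont.comp hsqc hsq1).sqrt
  refine ⟨A, R, R', ⟨?_, ?_, hRcont, hRpos, ?_, ?_, ?_, ?_, ?_, hunb⟩, hRarea, ?_, ?_, ?_⟩
  · refine Real.continuous_sqrt.comp ?_
    rw [← continuousOn_univ]
    exact hacont.comp (by fun_prop) fun ρ _ => hsq1 _ (le_max_left 1 ρ)
  · exact fun ρ => Real.sqrt_pos.2 (ha0 _ (hsq1 _ (le_max_left 1 ρ)))
  · intro ρ hρ
    have h1 : 1 < ρ ^ 2 := one_lt_pow₀ hρ two_ne_zero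
    have hp : HasDerivAt (fun ρ : ℝ => ρ ^ 2) (2 * ρ) ρ := by simpa using hasDerivAt_pow 2 ρ
    have h2 := (HasDerivAt.comp (h := fun ρ : ℝ => ρ ^ 2) ρ (hyIoi _ h1) hp).sqrt (hy0 _ h1.le).ne'
    refine h2.congr_deriv ?_
    simp only [R', R, Function.comp_apply]
    have := hRpos ρ hρ.le
    simp only [R] at this
    field_simp
  · exact (continuousOn_id.mul (hy'cont.comp hsqc hsq1)).div hRcont fun ρ hρ => (hRpos ρ hρ).ne'
  · intro ρ hρ
    have := hy'pos _ (one_lt_pow₀ hρ two_ne_zero)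
    have := hRpos ρ hρ.le
    simp only [R']
    positivity
  · simp [R', hy'1]
  · have hmono : MonotoneOn (fun t => √(y t) ^ (n - 2) * (1 - t * y' t ^ 2 / (y t * a t)))
        (Ici 1) := by
      have hd := fun t ht => mass_hasDerivWithinAt (m := n - 2) (hy t ht) (hy'd t ht) (had t ht)
        (hy0 t ht) (ha0 t ht)
      refine monotoneOn_of_hasDerivWithinAt_nonneg (convex_Ici 1)
        (fun t ht => (hd t ht).continuousWithinAt) (fun t ht =>
          (hd t (interior_subset ht)).mono interior_subset) fun t ht => ?_
      rw [interior_Ici] at ht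
      have ht' : t ∈ Ici (1 : ℝ) := mem_Ici.2 (mem_Ioi.1 ht).le
      obtain ⟨x, hx, hxe, -⟩ := hpt2 t ht'
      have hscal := hform.scalarCurv_eq hB' hC' hB'' hC'' (fun t ht => (hpos t ht).1.ne')
        (fun t ht => (hpos t ht).2.ne') hxe hx (y := y t) (a := a t) (y' := y' t) rfl rfl rfl rfl rfl
      have h0 := mul_nonneg (hy0 t ht').le (hg.scalar_nonneg x hxe)
      rw [hscal] at h0
      have hn1 : (0 : ℝ) < n - 1 := by
        have : (3 : ℝ) ≤ n := by exact_mod_cast hn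
        linarith
      have h1 := nonneg_of_mul_nonneg_right h0 hn1
      have hcast : ((n - 2 : ℕ) : ℝ) = n - 2 := by rw [Nat.cast_sub (by omega)]; norm_num
      rw [hcast]
      have := hy0 t ht'
      have := hy'pos t ht
      exact mul_nonneg (by positivity) h1
    intro ρ hρ σ hσ hle
    have hρ0 : (0 : ℝ) ≤ ρ := zero_le_one.trans hρ
    have h := hmono (hsq1 ρ hρ) (hsq1 σ hσ) (pow_le_pow_left₀ hρ0 hle 2)
    have heq : ∀ ρ ∈ Ici (1 : ℝ), R ρ ^ (n - 2) * (1 - (R' ρ / A ρ) ^ 2) =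
        √(y (ρ ^ 2)) ^ (n - 2) * (1 - ρ ^ 2 * y' (ρ ^ 2) ^ 2 / (y (ρ ^ 2) * a (ρ ^ 2))) := by
      intro ρ hρ
      have h1 := hRpos ρ hρ
      have h2 := ha0 _ (hsq1 ρ hρ)
      have h3 : R ρ ^ 2 = y (ρ ^ 2) := Real.sq_sqrt (hy0 _ (hsq1 ρ hρ)).le
      rw [hmaxA ρ hρ, div_pow, Real.sq_sqrt h2.le]
      simp only [R']
      rw [div_pow, h3]
      congr 2
      field_simp
    show R ρ ^ (n - 2) * (1 - (R' ρ / A ρ) ^ 2) ≤ R σ ^ (n - 2) * (1 - (R' σ / A σ) ^ 2)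
    rw [heq ρ hρ, heq σ hσ]
    exact h
  · intro ρ hρ
    rw [hform.radialSpeed_eq (by omega) hρ, hmaxA ρ hρ]
  · intro x hx v
    have hx0 : 0 < ‖x‖ := lt_of_lt_of_le one_pos hx
    have hq := one_le_norm_sq hx
    rw [hform.normSq_eq hx, hmaxA _ hx, Real.sq_sqrt (ha0 _ hq).le, div_pow (R ‖x‖),
      Real.sq_sqrt (hy0 _ hq).le]
    simp only [a, y]
    field_simp
    ring
  · rw [boundaryArea, hform.area_sph_div_omega (by omega) hpos le_rfl]
    simp [R, y]

/-! ### The Schwarzschild profile -/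

/-- The slope `√(p / (x^k - p))` with `p = r₀^k` of the Schwarzschild graph. -/
def schwSlope (k : ℕ) (r₀ x : ℝ) : ℝ := √(r₀ ^ k / (x ^ k - r₀ ^ k))

/-- The height of the Schwarzschild graph. -/
def height (k : ℕ) (r₀ r : ℝ) : ℝ := ∫ x in r₀..r, schwSlope k r₀ x

section Height

variable {k : ℕ} {r₀ : ℝ}

theorem measurable_schwSlope : Measurable (schwSlope k r₀) := by
  unfold schwSlope
  fun_prop

theorem pow_lt_pow_of_radius_lt (hk : k ≠ 0) (h0 : 0 < r₀) {x : ℝ} (hx : r₀ < x) :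
    r₀ ^ k < x ^ k := pow_lt_pow_left₀ hx h0.le hk

theorem schwSlope_pos (hk : k ≠ 0) (h0 : 0 < r₀) {x : ℝ} (hx : r₀ < x) : 0 < schwSlope k r₀ x := by
  have := pow_lt_pow_of_radius_lt hk h0 hx
  exact Real.sqrt_pos.2 (div_pos (by positivity) (by linarith))

theorem schwSlope_sq (hk : k ≠ 0) (h0 : 0 < r₀) {x : ℝ} (hx : r₀ < x) :
    schwSlope k r₀ x ^ 2 = r₀ ^ k / (x ^ k - r₀ ^ k) := by
  have := pow_lt_pow_of_radius_lt hk h0 hx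
  exact Real.sq_sqrt (div_nonneg (by positivity) (by linarith))

/-- Since x^k - r₀^k ≥ r₀^(k-1) (x - r₀), the singularity at the horizon is at worst an inverse
square root, hence integrable. -/
theorem schwSlope_le (hk : k ≠ 0) (h0 : 0 < r₀) {x : ℝ} (hx : r₀ < x) :
    schwSlope k r₀ x ≤ √r₀ * (x - r₀) ^ (-(1 / 2) : ℝ) := by
  obtain ⟨m, rfl⟩ := Nat.exists_eq_succ_of_ne_zero hk
  have hx0 : 0 < x - r₀ := by linarith
  have hp := pow_lt_pow_of_radius_lt (k := m + 1) (by omega) h0 hx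
  rw [Real.rpow_neg hx0.le, ← Real.sqrt_eq_rpow, ← div_eq_mul_inv, ← Real.sqrt_div h0.le]
  apply Real.sqrt_le_sqrt
  rw [div_le_div_iff₀ (by simpa using hp) hx0]
  have : r₀ ^ m ≤ x ^ m := pow_le_pow_left₀ h0.le hx.le m
  rw [Nat.succ_eq_add_one, pow_succ, pow_succ]
  nlinarith [mul_le_mul_of_nonneg_right this (h0.trans hx).le]

theorem intervalIntegrable_schwSlope (hk : k ≠ 0) (h0 : 0 < r₀) {r : ℝ} (hr : r₀ ≤ r) :
    IntervalIntegrable (schwSlope k r₀) volume r₀ r := by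
  have h1 : IntervalIntegrable (fun x : ℝ => x ^ (-(1 / 2) : ℝ)) volume 0 (r - r₀) :=
    intervalIntegral.intervalIntegrable_rpow' (by norm_num)
  have h2 := (h1.comp_sub_right r₀).const_mul (√r₀)
  rw [zero_add, sub_add_cancel] at h2
  refine h2.mono_fun' measurable_schwSlope.aestronglyMeasurable ?_
  rw [uIoc_of_le hr]
  refine (ae_restrict_iff' measurableSet_Ioc).2 (Eventually.of_forall fun x hx => ?_)
  show ‖schwSlope k r₀ x‖ ≤ _
  rw [schwSlope, Real.norm_of_nonneg (Real.sqrt_nonneg _)]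
  exact schwSlope_le hk h0 hx.1

@[simp]
theorem height_self : height k r₀ r₀ = 0 := by simp [height]

theorem continuousOn_height (hk : k ≠ 0) (h0 : 0 < r₀) : ContinuousOn (height k r₀) (Ici r₀) := by
  intro r hr
  have hr1 : r₀ ≤ r + 1 := by have : r₀ ≤ r := hr; linarith
  have h := intervalIntegral.continuousOn_primitive_interval'
    (intervalIntegrable_schwSlope hk h0 hr1) left_mem_uIcc
  rw [uIcc_of_le hr1] at h
  have hmem : Icc r₀ (r + 1) ∈ 𝓝[Ici r₀] r := by
    rw [← Ici_inter_Iic]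
    exact inter_mem_nhdsWithin _ (Iic_mem_nhds (by linarith))
  exact (h r ⟨hr, by linarith⟩).mono_of_mem_nhdsWithin hmem

theorem hasDerivAt_height (hk : k ≠ 0) (h0 : 0 < r₀) {r : ℝ} (hr : r₀ < r) :
    HasDerivAt (height k r₀) (schwSlope k r₀ r) r := by
  refine intervalIntegral.integral_hasDerivAt_right (intervalIntegrable_schwSlope hk h0 hr.le)
    (measurable_schwSlope.stronglyMeasurable.stronglyMeasurableAtFilter) ?_
  have := pow_lt_pow_of_radius_lt hk h0 hr
  unfold schwSlope
  refine ContinuousAt.sqrt (continuousAt_const.div ?_ (by linarith))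
  fun_prop

theorem strictMonoOn_height (hk : k ≠ 0) (h0 : 0 < r₀) : StrictMonoOn (height k r₀) (Ici r₀) := by
  refine strictMonoOn_of_deriv_pos (convex_Ici r₀) (continuousOn_height hk h0) fun x hx => ?_
  rw [interior_Ici] at hx
  rw [(hasDerivAt_height hk h0 hx).deriv]
  exact schwSlope_pos hk h0 hx

theorem height_nonneg (hk : k ≠ 0) (h0 : 0 < r₀) {r : ℝ} (hr : r₀ ≤ r) : 0 ≤ height k r₀ r := by
  have := (strictMonoOn_height hk h0).monotoneOn self_mem_Ici hr hr
  rwa [height_self] at this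

end Height

/-! ### Plane curves: chords and arc length -/

/-- A function with nonnegative derivative in the interior is monotone. -/
theorem le_of_hasDerivAt_nonneg {f f' : ℝ → ℝ} {a c : ℝ} (hac : a ≤ c)
    (hf : ContinuousOn f (Icc a c)) (hf' : ∀ x ∈ Ioo a c, HasDerivAt f (f' x) x)
    (h : ∀ x ∈ Ioo a c, 0 ≤ f' x) : f a ≤ f c := by
  refine monotoneOn_of_hasDerivWithinAt_nonneg (convex_Icc a c) hf (f' := f') ?_ ?_
    (left_mem_Icc.2 hac) (right_mem_Icc.2 hac) hac
  · rw [interior_Icc]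
    exact fun x hx => (hf' x hx).hasDerivWithinAt
  · rw [interior_Icc]
    exact h

/-- The chord of a plane curve is not longer than a bound of its arc length. -/
theorem chord_sq_le {f f' g g' s s' : ℝ → ℝ} {a c : ℝ} (hac : a ≤ c)
    (hf : ContinuousOn f (Icc a c)) (hf' : ∀ x ∈ Ioo a c, HasDerivAt f (f' x) x)
    (hg : ContinuousOn g (Icc a c)) (hg' : ∀ x ∈ Ioo a c, HasDerivAt g (g' x) x)
    (hs : ContinuousOn s (Icc a c)) (hs' : ∀ x ∈ Ioo a c, HasDerivAt s (s' x) x)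
    (h0 : ∀ x ∈ Ioo a c, 0 ≤ s' x) (h : ∀ x ∈ Ioo a c, f' x ^ 2 + g' x ^ 2 ≤ s' x ^ 2) :
    (f c - f a) ^ 2 + (g c - g a) ^ 2 ≤ (s c - s a) ^ 2 := by
  set α := f c - f a with hα
  set β := g c - g a with hβ
  set N := √(α ^ 2 + β ^ 2) with hN
  have hN2 : N ^ 2 = α ^ 2 + β ^ 2 := Real.sq_sqrt (by positivity)
  have hN0 : 0 ≤ N := Real.sqrt_nonneg _
  -- The curve is projected to the direction of its chord; Cauchy–Schwarz bounds the speed of the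
  -- projection by N s'.
  have key := le_of_hasDerivAt_nonneg (f := fun x => N * s x - (α * f x + β * g x))
    (f' := fun x => N * s' x - (α * f' x + β * g' x)) hac
    ((hs.const_mul N).sub ((hf.const_mul α).add (hg.const_mul β)))
    (fun x hx => ((hs' x hx).const_mul N).sub
      (((hf' x hx).const_mul α).add ((hg' x hx).const_mul β))) fun x hx => by
        have h1 : (α * f' x + β * g' x) ^ 2 ≤ (N * s' x) ^ 2 := by
          rw [mul_pow, hN2]
          have := mul_le_mul_of_nonneg_left (h x hx) (by positivity : 0 ≤ α ^ 2 + β ^ 2)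
          nlinarith [sq_nonneg (α * g' x - β * f' x)]
        have := abs_le_of_sq_le_sq h1 (mul_nonneg hN0 (h0 x hx))
        show 0 ≤ N * s' x - (α * f' x + β * g' x)
        linarith [le_of_abs_le this]
  have hs0 : 0 ≤ s c - s a := sub_nonneg.2 (le_of_hasDerivAt_nonneg hac hs hs' h0)
  have h2 : N ^ 2 ≤ N * (s c - s a) := by
    rw [hN2]
    have : N * s a - (α * f a + β * g a) ≤ N * s c - (α * f c + β * g c) := key
    have e : α ^ 2 + β ^ 2 = (α * f c + β * g c) - (α * f a + β * g a) := by
      rw [hα, hβ]; ring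
    linarith
  rw [← hN2]
  rcases hN0.eq_or_lt with h3 | h3
  · rw [← h3, zero_pow two_ne_zero]; exact sq_nonneg _
  · have : N ≤ s c - s a := by nlinarith
    exact pow_le_pow_left₀ hN0 this 2

/-- Minkowski's inequality in the plane. -/
theorem sq_add_sq_le_of_split {a b a' b' s s' : ℝ} (hs : 0 ≤ s) (hs' : 0 ≤ s')
    (h : a ^ 2 + b ^ 2 ≤ s ^ 2) (h' : a' ^ 2 + b' ^ 2 ≤ s' ^ 2) :
    (a + a') ^ 2 + (b + b') ^ 2 ≤ (s + s') ^ 2 := by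
  have h1 : (a * a' + b * b') ^ 2 ≤ (s * s') ^ 2 := by
    rw [mul_pow]
    have := mul_le_mul h h' (by positivity) (by positivity)
    nlinarith [sq_nonneg (a * b' - b * a')]
  have := le_of_abs_le (abs_le_of_sq_le_sq h1 (mul_nonneg hs hs'))
  nlinarith

/-! ### Comparison of profiles -/

/-- The generating curve of `M_Sch(m₀, L)`, with `r₀` the radius of the horizon. -/
def IsSchwProfile (k : ℕ) (r₀ L q h : ℝ) : Prop :=
  (r₀ ≤ q ∧ h = height k r₀ q) ∨ (q = r₀ ∧ -L ≤ h ∧ h ≤ 0)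

/-- The arc length `∫_1^ρ A`. -/
def arcLength (A : ℝ → ℝ) (ρ : ℝ) : ℝ := ∫ t in (1 : ℝ)..ρ, A t

theorem hasDerivAt_arcLength {A : ℝ → ℝ} (hA : Continuous A) (ρ : ℝ) :
    HasDerivAt (arcLength A) (A ρ) ρ :=
  intervalIntegral.integral_hasDerivAt_right (hA.intervalIntegrable _ _)
    (hA.stronglyMeasurableAtFilter _ _) hA.continuousAt

/-- A map `ρ ↦ (Q ρ, Z ρ)` onto a generating curve `T` that distorts arc lengths and radii of the
warped product `A² dρ² + R² g` by factors at most `K`. -/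
structure IsComparison (K : ℝ) (A R : ℝ → ℝ) (T : ℝ → ℝ → Prop) (Q Z : ℝ → ℝ) : Prop where
  mem : ∀ ρ, 1 ≤ ρ → T (Q ρ) (Z ρ)
  surj : ∀ q h, T q h → ∃ ρ, 1 ≤ ρ ∧ Q ρ = q ∧ Z ρ = h
  chord_le : ∀ a c, 1 ≤ a → a ≤ c →
    (Q c - Q a) ^ 2 + (Z c - Z a) ^ 2 ≤ (K * (arcLength A c - arcLength A a)) ^ 2
  le_add : ∀ a c, 1 ≤ a → a ≤ c →
    arcLength A c - arcLength A a ≤ K * ((Q c - Q a) + (Z c - Z a))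
  exists_deriv : ∃ b, ∀ ρ, 1 < ρ → ρ ≠ b →
    (∃ z', HasDerivAt Z z' ρ ∧ A ρ ^ 2 ≤ K ^ 2 * z' ^ 2) ∨
    (∃ q' z', HasDerivAt Q q' ρ ∧ HasDerivAt Z z' ρ ∧ A ρ ^ 2 ≤ K ^ 2 * (q' ^ 2 + z' ^ 2))
  radius_le : ∀ ρ, 1 ≤ ρ → 0 < Q ρ ∧ Q ρ ≤ K * R ρ ∧ R ρ ≤ K * Q ρ

section Profile

variable {n : ℕ} {A R R' : ℝ → ℝ}

/-- The slope `dz/dρ` of the graph of a warped product. -/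
def heightSpeed (A R' : ℝ → ℝ) (ρ : ℝ) : ℝ := √(A ρ ^ 2 - R' (max 1 ρ) ^ 2)

/-- The height of the graph of a warped product. -/
def warpHeight (A R' : ℝ → ℝ) (ρ : ℝ) : ℝ := ∫ t in (1 : ℝ)..ρ, heightSpeed A R' t

/-! ### Mass bounds and the matching of profiles -/

namespace WarpData

theorem strictMonoOn_radius (W : WarpData n A R R') : StrictMonoOn R (Ici 1) := by
  refine strictMonoOn_of_deriv_pos (convex_Ici 1) W.continuousOn_radius fun x hx => ?_
  rw [interior_Ici] at hx
  rw [(W.hasDerivAt_radius x hx).deriv]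
  exact W.deriv_pos x hx

theorem continuous_heightSpeed (W : WarpData n A R R') : Continuous (heightSpeed A R') := by
  have : Continuous fun ρ => R' (max 1 ρ) := by
    rw [← continuousOn_univ]
    exact W.continuousOn_deriv.comp (by fun_prop) fun ρ _ => le_max_left 1 ρ
  exact ((W.continuous_speed.pow 2).sub (this.pow 2)).sqrt

theorem hasDerivAt_warpHeight (W : WarpData n A R R') (ρ : ℝ) :
    HasDerivAt (warpHeight A R') (heightSpeed A R' ρ) ρ :=
  hasDerivAt_arcLength W.continuous_heightSpeed ρ

/-- The Hawking mass is at least that of the boundary. -/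
theorem pow_le_mass (W : WarpData n A R R') {ρ : ℝ} (hρ : 1 ≤ ρ) :
    R 1 ^ (n - 2) ≤ R ρ ^ (n - 2) * (1 - (R' ρ / A ρ) ^ 2) := by
  have := W.mass_mono self_mem_Ici hρ hρ
  simpa [W.deriv_one] using this

/-- A positive mass forces |dr/ds| < 1, so the square root defining the graph is not truncated at 0.
-/
theorem heightSpeed_sq (W : WarpData n A R R') {ρ : ℝ} (hρ : 1 ≤ ρ) :
    heightSpeed A R' ρ ^ 2 = A ρ ^ 2 * (1 - (R' ρ / A ρ) ^ 2) ∧ 0 < heightSpeed A R' ρ := by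
  have hA := W.speed_pos ρ
  have h1 : A ρ ^ 2 - R' ρ ^ 2 = A ρ ^ 2 * (1 - (R' ρ / A ρ) ^ 2) := by
    field_simp
  have h2 := (pow_pos (W.radius_pos 1 self_mem_Ici) (n - 2)).trans_le (W.pow_le_mass hρ)
  have h3 : 0 < 1 - (R' ρ / A ρ) ^ 2 :=
    pos_of_mul_pos_right h2 (pow_pos (W.radius_pos ρ hρ) _).le
  have h4 : 0 < A ρ ^ 2 - R' ρ ^ 2 := by rw [h1]; positivity
  rw [heightSpeed, max_eq_right hρ]
  exact ⟨by rw [Real.sq_sqrt h4.le, h1], Real.sqrt_pos.2 h4⟩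

/-- Mass at least m₀ says (dr/ds)² ≤ 1 - p/T, and the right side is the Schwarzschild value at the
same radius. Thus moving to Schwarzschild along equal radii does not increase length. -/
theorem sq_add_schwSlope_sq_le (W : WarpData n A R R') (hn : n - 2 ≠ 0) {ρ : ℝ} (hρ : 1 < ρ) :
    R' ρ ^ 2 + (schwSlope (n - 2) (R 1) (R ρ) * R' ρ) ^ 2 ≤ A ρ ^ 2 := by
  have hA := W.speed_pos ρ
  have h0 := W.radius_pos 1 self_mem_Ici
  have hlt := W.strictMonoOn_radius self_mem_Ici hρ.le hρ
  have hm := W.pow_le_mass hρ.le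
  rw [mul_pow, schwSlope_sq hn h0 hlt]
  have hp := pow_lt_pow_of_radius_lt hn h0 hlt
  generalize R ρ ^ (n - 2) = T at *
  generalize R 1 ^ (n - 2) = p at *
  have hu : R' ρ ^ 2 = A ρ ^ 2 * (R' ρ / A ρ) ^ 2 := by field_simp
  rw [hu]
  generalize (R' ρ / A ρ) ^ 2 = u at *
  have hTp : 0 < T - p := by linarith
  have e : A ρ ^ 2 * u + p / (T - p) * (A ρ ^ 2 * u) = A ρ ^ 2 * (T * u) / (T - p) := by
    field_simp
    ring
  rw [e, div_le_iff₀ hTp]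
  exact mul_le_mul_of_nonneg_left (by linarith) (sq_nonneg _)

theorem schwSlope_mul_le_heightSpeed (W : WarpData n A R R') (hn : n - 2 ≠ 0) {ρ : ℝ} (hρ : 1 < ρ) :
    schwSlope (n - 2) (R 1) (R ρ) * R' ρ ≤ heightSpeed A R' ρ := by
  have := W.sq_add_schwSlope_sq_le hn hρ
  refine Real.le_sqrt_of_sq_le ?_
  rw [max_eq_right hρ.le]
  linarith

/-- From p ≤ T(1 - u) and T ≤ (1 + s)p follows (1 + s)(1 - u) ≥ 1: near the boundary height accounts
for almost all of the length. -/
theorem speed_sq_le_inner (W : WarpData n A R R') {s K ρ : ℝ} (hs : 0 ≤ s) (hK : 1 + s ≤ K)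
    (hρ : 1 ≤ ρ) (hR : R ρ ^ (n - 2) ≤ (1 + s) * R 1 ^ (n - 2)) :
    A ρ ^ 2 ≤ K ^ 2 * heightSpeed A R' ρ ^ 2 := by
  have h0 := pow_pos (W.radius_pos 1 self_mem_Ici) (n - 2)
  have hm := W.pow_le_mass hρ
  rw [(W.heightSpeed_sq hρ).1]
  have hT := pow_pos (W.radius_pos ρ hρ) (n - 2)
  generalize R ρ ^ (n - 2) = T at *
  generalize R 1 ^ (n - 2) = p at *
  generalize (R' ρ / A ρ) ^ 2 = u at *
  have hu : 0 < 1 - u := pos_of_mul_pos_right (h0.trans_le hm) hT.le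
  have h1 : 1 ≤ (1 + s) * (1 - u) := by
    have : p * 1 ≤ p * ((1 + s) * (1 - u)) := by nlinarith
    exact le_of_mul_le_mul_left this h0
  have h2 : 1 ≤ K ^ 2 * (1 - u) := by
    have : 1 + s ≤ K ^ 2 := by nlinarith
    nlinarith
  nlinarith [sq_nonneg (A ρ)]

/-- The mass bound gives T u ≥ (T - p) - s² p, and s p ≤ T - p in this region, so T u ≥ (1 - s)(T -
p). This balance is why the seam is placed at the square root of the mass excess. -/
theorem speed_sq_le_outer (W : WarpData n A R R') (hn : n - 2 ≠ 0) {s K ρ : ℝ} (hs : 0 ≤ s)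
    (hK1 : 1 ≤ K) (hK : 1 ≤ K * (1 - s)) (hρ : 1 < ρ)
    (hmass : R ρ ^ (n - 2) * (1 - (R' ρ / A ρ) ^ 2) ≤ (1 + s ^ 2) * R 1 ^ (n - 2))
    (hR : (1 + s) * R 1 ^ (n - 2) ≤ R ρ ^ (n - 2)) :
    A ρ ^ 2 ≤ K ^ 2 * (R' ρ ^ 2 + (schwSlope (n - 2) (R 1) (R ρ) * R' ρ) ^ 2) := by
  have hA := W.speed_pos ρ
  have h0 := W.radius_pos 1 self_mem_Ici
  have hlt := W.strictMonoOn_radius self_mem_Ici hρ.le hρ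
  rw [mul_pow, schwSlope_sq hn h0 hlt]
  have hp := pow_lt_pow_of_radius_lt hn h0 hlt
  have hp0 := pow_pos h0 (n - 2)
  generalize R ρ ^ (n - 2) = T at *
  generalize R 1 ^ (n - 2) = p at *
  have hu : R' ρ ^ 2 = A ρ ^ 2 * (R' ρ / A ρ) ^ 2 := by field_simp
  rw [hu]
  generalize (R' ρ / A ρ) ^ 2 = u at *
  have hTp : 0 < T - p := by linarith
  have e : K ^ 2 * (A ρ ^ 2 * u + p / (T - p) * (A ρ ^ 2 * u)) =
      A ρ ^ 2 * (K ^ 2 * (T * u)) / (T - p) := by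
    field_simp
    ring
  rw [e, le_div_iff₀ hTp]
  refine mul_le_mul_of_nonneg_left ?_ (sq_nonneg _)
  have h1 : (T - p) * (1 - s) ≤ T * u := by nlinarith
  have h2 : T - p ≤ K * (T * u) := by nlinarith
  have h3 : 0 ≤ K * (T * u) := by linarith
  nlinarith

theorem arcLength_mono (W : WarpData n A R R') {a c : ℝ} (h : a ≤ c) :
    0 ≤ arcLength A c - arcLength A a :=
  sub_nonneg.2 (le_of_hasDerivAt_nonneg h
    (fun x _ => (hasDerivAt_arcLength W.continuous_speed x).continuousAt.continuousWithinAt)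
    (fun x _ => hasDerivAt_arcLength W.continuous_speed x) fun x _ => (W.speed_pos x).le)

/-- In terms of the radius, the comparison with the Schwarzschild graph outside `{ρ < b}`. -/
theorem chord_le_outer (W : WarpData n A R R') (hn : n - 2 ≠ 0) {a c : ℝ} (ha : 1 ≤ a)
    (hac : a ≤ c) : (R c - R a) ^ 2 +
      (height (n - 2) (R 1) (R c) - height (n - 2) (R 1) (R a)) ^ 2 ≤
      (arcLength A c - arcLength A a) ^ 2 := by
  have h0 := W.radius_pos 1 self_mem_Ici
  have hsub : Icc a c ⊆ Ici 1 := fun x hx => ha.trans hx.1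
  refine chord_sq_le (g := fun ρ => height (n - 2) (R 1) (R ρ)) hac
    (W.continuousOn_radius.mono hsub) (f' := R')
    (fun x hx => W.hasDerivAt_radius x (ha.trans_lt hx.1)) ?_
    (g' := fun ρ => schwSlope (n - 2) (R 1) (R ρ) * R' ρ) ?_
    (fun x _ => (hasDerivAt_arcLength W.continuous_speed x).continuousAt.continuousWithinAt)
    (fun x _ => hasDerivAt_arcLength W.continuous_speed x) (fun x _ => (W.speed_pos x).le)
    fun x hx => W.sq_add_schwSlope_sq_le hn (ha.trans_lt hx.1)
  · exact ((continuousOn_height hn h0).comp W.continuousOn_radius fun ρ hρ =>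
      W.strictMonoOn_radius.monotoneOn self_mem_Ici hρ hρ).mono hsub
  · intro x hx
    have hx1 := ha.trans_lt hx.1
    exact (hasDerivAt_height hn h0 (W.strictMonoOn_radius self_mem_Ici hx1.le hx1)).comp x
      (W.hasDerivAt_radius x hx1)

/-- The depth is nonnegative. -/
theorem height_le_warpHeight (W : WarpData n A R R') (hn : n - 2 ≠ 0) {b : ℝ} (hb : 1 ≤ b) :
    height (n - 2) (R 1) (R b) ≤ warpHeight A R' b := by
  have h0 := W.radius_pos 1 self_mem_Ici
  have hsub : Icc 1 b ⊆ Ici 1 := fun x hx => hx.1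
  have := le_of_hasDerivAt_nonneg
    (f := fun ρ => warpHeight A R' ρ - height (n - 2) (R 1) (R ρ))
    (f' := fun ρ => heightSpeed A R' ρ - schwSlope (n - 2) (R 1) (R ρ) * R' ρ) hb
    (ContinuousOn.sub
      (fun x _ => (W.hasDerivAt_warpHeight x).continuousAt.continuousWithinAt)
      (((continuousOn_height hn h0).comp W.continuousOn_radius fun ρ hρ =>
        W.strictMonoOn_radius.monotoneOn self_mem_Ici hρ hρ).mono hsub))
    (fun x hx => (W.hasDerivAt_warpHeight x).sub
      ((hasDerivAt_height hn h0 (W.strictMonoOn_radius self_mem_Ici hx.1.le hx.1)).comp x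
        (W.hasDerivAt_radius x hx.1)))
    fun x hx => sub_nonneg.2 (W.schwSlope_mul_le_heightSpeed hn hx.1)
  simpa [warpHeight] using this

/-- As long as t^k ≤ (1 + s) r₀^k, the Schwarzschild slope is at least 1/√s. -/
theorem sub_le_height_sub {k : ℕ} {r₀ s x y : ℝ} (hk : k ≠ 0) (h0 : 0 < r₀)
    (hx : r₀ ≤ x) (hxy : x ≤ y) (hy : y ^ k ≤ (1 + s) * r₀ ^ k) :
    y - x ≤ √s * (height k r₀ y - height k r₀ x) := by
  have key := le_of_hasDerivAt_nonneg (f := fun t => √s * height k r₀ t - t)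
    (f' := fun t => √s * schwSlope k r₀ t - 1) hxy
    ((((continuousOn_height hk h0).mono fun t ht => hx.trans ht.1).const_mul _).sub
      continuousOn_id)
    (fun t ht => ((hasDerivAt_height hk h0 (hx.trans_lt ht.1)).const_mul _).sub (hasDerivAt_id t))
    fun t ht => by
      have hrt := hx.trans_lt ht.1
      have hp := pow_lt_pow_of_radius_lt hk h0 hrt
      have hty : t ^ k ≤ y ^ k := pow_le_pow_left₀ (h0.trans hrt).le ht.2.le k
      have hp0 := pow_pos h0 k
      have hs : 0 ≤ s := by nlinarith
      rw [sub_nonneg, schwSlope, ← Real.sqrt_mul hs, Real.one_le_sqrt, ← mul_div_assoc,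
        one_le_div (by linarith)]
      linarith
  have : √s * height k r₀ x - x ≤ √s * height k r₀ y - y := key
  linarith

/-- Heights are matched for ρ ≤ b and radii for ρ ≥ b. The cylinder length is exactly the one for
which the two rules agree at b. -/
theorem exists_comparison (W : WarpData n A R R') (hn : n - 2 ≠ 0) {s K b : ℝ} (hs : 0 ≤ s)
    (hK : 1 ≤ K * (1 - s)) (hs1 : s < 1)
    (hmass : ∀ ρ, 1 ≤ ρ →
      R ρ ^ (n - 2) * (1 - (R' ρ / A ρ) ^ 2) ≤ (1 + s ^ 2) * R 1 ^ (n - 2))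
    (hb : 1 ≤ b) (hRb : R b ^ (n - 2) = (1 + s) * R 1 ^ (n - 2)) :
    ∃ Q Z, IsComparison K A R (IsSchwProfile (n - 2) (R 1)
      (warpHeight A R' b - height (n - 2) (R 1) (R b))) Q Z := by
  have hK0 : 0 < K := pos_of_mul_pos_left (one_pos.trans_le hK) (by linarith)
  -- Since (1 + s)(1 - s) ≤ 1, the constant required outside the seam also suffices inside.
  have hKs : 1 + s ≤ K := by nlinarith
  have hK1 : 1 ≤ K := by linarith
  have hKsq : K ≤ K ^ 2 := by nlinarith
  have h0 := W.radius_pos 1 self_mem_Ici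
  have hp0 := pow_pos h0 (n - 2)
  have hRmono := W.strictMonoOn_radius.monotoneOn
  have hR1 : ∀ ρ, 1 ≤ ρ → R 1 ≤ R ρ := fun ρ hρ => hRmono self_mem_Ici hρ hρ
  set k := n - 2 with hk
  set r₀ := R 1 with hr₀
  set ζ := height k r₀ (R b) with hζ
  set L := warpHeight A R' b - ζ with hL
  have hL0 : 0 ≤ L := sub_nonneg.2 (W.height_le_warpHeight hn hb)
  have hζ0 : 0 ≤ ζ := height_nonneg hn h0 (hR1 b hb)
  have hHcont : Continuous (warpHeight A R') :=
    continuous_iff_continuousAt.2 fun x => (W.hasDerivAt_warpHeight x).continuousAt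
  have hH1 : warpHeight A R' 1 = 0 := by simp [warpHeight]
  have hHmono : Monotone (warpHeight A R') := monotone_of_hasDerivAt_nonneg
    W.hasDerivAt_warpHeight fun x => Real.sqrt_nonneg _
  have hZmono := strictMonoOn_height hn h0
  -- the inverse of the height function of the Schwarzschild graph
  have hex : ∀ ρ, 1 ≤ ρ → ρ ≤ b → ∃ q ∈ Icc r₀ (R b),
      height k r₀ q = max (warpHeight A R' ρ - L) 0 := by
    intro ρ h1 h2
    have hc : ContinuousOn (height k r₀) (Icc r₀ (R b)) :=
      (continuousOn_height hn h0).mono fun x hx => hx.1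
    refine intermediate_value_Icc (hR1 b hb) hc ⟨?_, ?_⟩
    · rw [height_self]; exact le_max_right _ _
    · refine max_le ?_ hζ0
      have := hHmono h2
      simp only [hL]
      linarith
  choose! q hq hqZ using hex
  have hqmono : ∀ a c, 1 ≤ a → a ≤ c → c ≤ b → q a ≤ q c := by
    intro a c h1 h2 h3
    rw [← hZmono.le_iff_le (hq a h1 (h2.trans h3)).1 (hq c (h1.trans h2) h3).1,
      hqZ a h1 (h2.trans h3), hqZ c (h1.trans h2) h3]
    exact max_le_max_right _ (by linarith [hHmono h2])
  have hqb : q b = R b := hZmono.injOn (hq b hb le_rfl).1 (hR1 b hb) (by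
    rw [hqZ b hb le_rfl, max_eq_left (by simp only [hL]; linarith)]
    simp only [hL]
    ring)
  -- Through the truncation at 0 in `hqZ`, negative heights receive the horizon radius, that is,
  -- they land on the cylinder.
  let Q : ℝ → ℝ := fun ρ => if ρ ≤ b then q ρ else R ρ
  let Z : ℝ → ℝ := fun ρ => if ρ ≤ b then warpHeight A R' ρ - L else height k r₀ (R ρ)
  have hQi : ∀ ρ, ρ ≤ b → Q ρ = q ρ := fun ρ h => if_pos h
  have hZi : ∀ ρ, ρ ≤ b → Z ρ = warpHeight A R' ρ - L := fun ρ h => if_pos h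
  have hQo : ∀ ρ, b ≤ ρ → Q ρ = R ρ := by
    intro ρ h
    rcases h.eq_or_lt with rfl | h
    · rw [hQi _ le_rfl, hqb]
    · exact if_neg (not_le.2 h)
  have hZo : ∀ ρ, b ≤ ρ → Z ρ = height k r₀ (R ρ) := by
    intro ρ h
    rcases h.eq_or_lt with rfl | h
    · rw [hZi _ le_rfl]; simp only [hL]; ring
    · exact if_neg (not_le.2 h)
  have hRpow : ∀ ρ, 1 ≤ ρ → ρ ≤ b → R ρ ^ k ≤ (1 + s) * r₀ ^ k := fun ρ h1 h2 => by
    rw [← hRb]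
    exact pow_le_pow_left₀ (W.radius_pos ρ h1).le (hRmono h1 hb h2) k
  have hRpow' : ∀ ρ, b ≤ ρ → (1 + s) * r₀ ^ k ≤ R ρ ^ k := fun ρ h => by
    rw [← hRb]
    exact pow_le_pow_left₀ (W.radius_pos b hb).le (hRmono hb (hb.trans h) h) k
  have hSd := hasDerivAt_arcLength W.continuous_speed
  have hScont : ∀ s, ContinuousOn (arcLength A) s := fun s x _ =>
    (hSd x).continuousAt.continuousWithinAt
  have hSmono : ∀ a c, a ≤ c → 0 ≤ arcLength A c - arcLength A a := fun a c h =>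
    W.arcLength_mono h
  have hspeed : ∀ ρ, 1 ≤ ρ → ρ ≤ b → A ρ ≤ K * heightSpeed A R' ρ := by
    intro ρ h1 h2
    have h3 := W.speed_sq_le_inner hs hKs h1 (hRpow ρ h1 h2)
    rw [← mul_pow] at h3
    exact le_of_abs_le (abs_le_of_sq_le_sq h3 (mul_nonneg hK0.le (Real.sqrt_nonneg _)))
  have hspeed' : ∀ ρ, heightSpeed A R' ρ ≤ A ρ := fun ρ =>
    Real.sqrt_le_iff.2 ⟨(W.speed_pos ρ).le, by linarith [sq_nonneg (R' (max 1 ρ))]⟩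
  -- The radial increment is at most √s times the height increment, so the squared chord is at most
  -- (1 + s) times the squared height increment, which K² absorbs.
  have chord_in : ∀ a c, 1 ≤ a → a ≤ c → c ≤ b → (Q c - Q a) ^ 2 + (Z c - Z a) ^ 2 ≤
      (K * (arcLength A c - arcLength A a)) ^ 2 := by
    intro a c h1 h2 h3
    rw [hQi c h3, hQi a (h2.trans h3), hZi c h3, hZi a (h2.trans h3)]
    have hc1 := h1.trans h2
    have e1 := sub_le_height_sub (s := s) hn h0 (hq a h1 (h2.trans h3)).1 (hqmono a c h1 h2 h3) (by
      rw [← hRb]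
      exact pow_le_pow_left₀ (h0.le.trans (hq c hc1 h3).1) (hq c hc1 h3).2 k)
    rw [hqZ c hc1 h3, hqZ a h1 (h2.trans h3)] at e1
    -- Truncation at 0 does not expand increments.
    have e2 : max (warpHeight A R' c - L) 0 - max (warpHeight A R' a - L) 0 ≤
        warpHeight A R' c - warpHeight A R' a := by
      have := hHmono h2
      rcases le_total (warpHeight A R' a - L) 0 with h | h
      · rw [max_eq_right h]
        rcases le_total (warpHeight A R' c - L) 0 with h' | h'
        · rw [max_eq_right h']; linarith
        · rw [max_eq_left h']; linarith
      · rw [max_eq_left h, max_eq_left (by linarith)]; linarith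
    have e3 : warpHeight A R' c - warpHeight A R' a ≤ arcLength A c - arcLength A a := by
      have := le_of_hasDerivAt_nonneg (f := fun x => arcLength A x - warpHeight A R' x) h2
        ((hScont _).sub hHcont.continuousOn)
        (fun x _ => (hSd x).sub (W.hasDerivAt_warpHeight x)) fun x _ => sub_nonneg.2 (hspeed' x)
      have : arcLength A a - warpHeight A R' a ≤ arcLength A c - warpHeight A R' c := this
      linarith
    have e4 : q c - q a ≤ √s * (warpHeight A R' c - warpHeight A R' a) :=
      e1.trans (mul_le_mul_of_nonneg_left e2 (Real.sqrt_nonneg s))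
    have e5 := pow_le_pow_left₀ (sub_nonneg.2 (hqmono a c h1 h2 h3)) e4 2
    rw [mul_pow, Real.sq_sqrt hs] at e5
    have e6 := pow_le_pow_left₀ (sub_nonneg.2 (hHmono h2)) e3 2
    rw [mul_pow]
    have e7 : 1 + s ≤ K ^ 2 := by linarith
    have e8 := mul_le_mul e7 e6 (sq_nonneg _) (sq_nonneg K)
    rw [sub_sub_sub_cancel_right]
    nlinarith
  have chord_out : ∀ a c, b ≤ a → a ≤ c → (Q c - Q a) ^ 2 + (Z c - Z a) ^ 2 ≤
      (K * (arcLength A c - arcLength A a)) ^ 2 := by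
    intro a c h1 h2
    rw [hQo c (h1.trans h2), hQo a h1, hZo c (h1.trans h2), hZo a h1]
    refine (W.chord_le_outer hn (hb.trans h1) h2).trans ?_
    refine pow_le_pow_left₀ (hSmono a c h2) ?_ 2
    nlinarith [hSmono a c h2]
  -- The height alone suffices; the increment of Q only helps because Q is nondecreasing. The sum of
  -- increments, unlike their Euclidean norm, simply adds across the seam.
  have add_in : ∀ a c, 1 ≤ a → a ≤ c → c ≤ b → arcLength A c - arcLength A a ≤
      K * ((Q c - Q a) + (Z c - Z a)) := by
    intro a c h1 h2 h3
    rw [hQi c h3, hQi a (h2.trans h3), hZi c h3, hZi a (h2.trans h3)]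
    have := le_of_hasDerivAt_nonneg (f := fun x => K * warpHeight A R' x - arcLength A x)
      (f' := fun x => K * heightSpeed A R' x - A x) h2
      ((hHcont.continuousOn.const_mul K).sub (hScont _))
      (fun x _ => ((W.hasDerivAt_warpHeight x).const_mul K).sub (hSd x))
      fun x hx => sub_nonneg.2 (hspeed x (h1.trans hx.1.le) (hx.2.le.trans h3))
    have h4 : K * warpHeight A R' a - arcLength A a ≤ K * warpHeight A R' c - arcLength A c := this
    nlinarith [hqmono a c h1 h2 h3]
  have add_out : ∀ a c, b ≤ a → a ≤ c → arcLength A c - arcLength A a ≤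
      K * ((Q c - Q a) + (Z c - Z a)) := by
    intro a c h1 h2
    rw [hQo c (h1.trans h2), hQo a h1, hZo c (h1.trans h2), hZo a h1]
    have hsub : Icc a c ⊆ Ici 1 := fun x hx => (hb.trans h1).trans hx.1
    have := le_of_hasDerivAt_nonneg
      (f := fun x => K * (R x + height k r₀ (R x)) - arcLength A x)
      (f' := fun x => K * (R' x + schwSlope k r₀ (R x) * R' x) - A x) h2
      ((((W.continuousOn_radius.mono hsub).add
        (((continuousOn_height hn h0).comp W.continuousOn_radius fun ρ hρ =>
          hR1 ρ hρ).mono hsub)).const_mul K).sub (hScont _))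
      (fun x hx => by
        have hx1 : 1 < x := (hb.trans h1).trans_lt hx.1
        exact (((W.hasDerivAt_radius x hx1).add
          ((hasDerivAt_height hn h0 (W.strictMonoOn_radius self_mem_Ici hx1.le hx1)).comp x
            (W.hasDerivAt_radius x hx1))).const_mul K).sub (hSd x))
      fun x hx => by
        have hx1 : 1 < x := (hb.trans h1).trans_lt hx.1
        have h3 := W.speed_sq_le_outer hn hs hK1 hK hx1 (hmass x hx1.le)
          (hRpow' x (h1.trans hx.1.le))
        have h4 := (W.deriv_pos x hx1).le
        have h5 : 0 ≤ schwSlope k r₀ (R x) * R' x := mul_nonneg (Real.sqrt_nonneg _) h4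
        rw [sub_nonneg]
        refine le_of_abs_le (abs_le_of_sq_le_sq (h3.trans ?_)
          (mul_nonneg hK0.le (add_nonneg h4 h5)))
        rw [mul_pow K]
        -- For nonnegative terms the sum of squares is at most the square of the sum.
        exact mul_le_mul_of_nonneg_left (by nlinarith) (sq_nonneg K)
    have h4 : K * (R a + height k r₀ (R a)) - arcLength A a ≤
      K * (R c + height k r₀ (R c)) - arcLength A c := this
    linarith
  refine ⟨Q, Z, ⟨fun ρ hρ => ?_, fun x h hT => ?_, fun a c h1 h2 => ?_, fun a c h1 h2 => ?_,
    ⟨b, fun ρ h1 hne => ?_⟩, fun ρ hρ => ?_⟩⟩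
  · rcases le_total ρ b with h | h
    · rw [hQi ρ h, hZi ρ h]
      rcases le_total (warpHeight A R' ρ - L) 0 with h' | h'
      · refine Or.inr ⟨?_, ?_, h'⟩
        · refine hZmono.injOn (hq ρ hρ h).1 self_mem_Ici ?_
          rw [hqZ ρ hρ h, max_eq_right h', height_self]
        · have := hHmono hρ
          linarith
      · refine Or.inl ⟨(hq ρ hρ h).1, ?_⟩
        rw [hqZ ρ hρ h, max_eq_left h']
    · rw [hQo ρ h, hZo ρ h]
      exact Or.inl ⟨hR1 ρ hρ, rfl⟩
  -- One argument reaches the cylinder and the Schwarzschild part below the seam, since the height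
  -- runs continuously from -L to ζ.
  · have inner : ∀ h, -L ≤ h → h ≤ ζ → r₀ ≤ x → height k r₀ x = max h 0 →
        ∃ ρ, 1 ≤ ρ ∧ Q ρ = x ∧ Z ρ = h := by
      intro h hh1 hh2 hx hxh
      obtain ⟨ρ, hρ, hρh⟩ := intermediate_value_Icc hb (f := fun ρ => warpHeight A R' ρ - L)
        (by fun_prop) (show h ∈ Icc (warpHeight A R' 1 - L) (warpHeight A R' b - L) from
          ⟨by rw [hH1]; linarith, by simp only [hL]; linarith⟩)
      refine ⟨ρ, hρ.1, ?_, by rw [hZi ρ hρ.2]; exact hρh⟩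
      rw [hQi ρ hρ.2]
      refine hZmono.injOn (hq ρ hρ.1 hρ.2).1 hx ?_
      rw [hqZ ρ hρ.1 hρ.2, hxh]
      exact congrArg (max · 0) hρh
    rcases hT with ⟨hx, hh⟩ | ⟨hx, hh1, hh2⟩
    · have hh0 : 0 ≤ h := hh ▸ height_nonneg hn h0 hx
      rcases le_total x (R b) with hxb | hxb
      · refine inner h (by linarith) ?_ hx ?_
        · rw [hh]
          exact hZmono.monotoneOn hx (hR1 b hb) hxb
        · rw [max_eq_left hh0, hh]
      · obtain ⟨ρ₁, hρ₁, hlt⟩ := W.unbounded x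
        have hbρ : b ≤ ρ₁ := by
          by_contra! hcon
          have := hRmono hρ₁ hb hcon.le
          linarith
        obtain ⟨ρ, hρ, hρx⟩ := intermediate_value_Icc hbρ
          (W.continuousOn_radius.mono fun y hy => hb.trans hy.1) ⟨hxb, hlt.le⟩
        refine ⟨ρ, hb.trans hρ.1, ?_, ?_⟩
        · rw [hQo ρ hρ.1, hρx]
        · rw [hZo ρ hρ.1, hρx, hh]
    · refine inner h hh1 (by linarith) hx.ge ?_
      rw [hx, height_self, max_eq_right hh2]
  · rcases le_total c b with h3 | h3
    · exact chord_in a c h1 h2 h3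
    · rcases le_total b a with h4 | h4
      · exact chord_out a c h4 h2
      -- An interval containing the seam is cut there, and the two chord bounds combine by
      -- Minkowski.
      · have := sq_add_sq_le_of_split (mul_nonneg hK0.le (hSmono a b h4))
          (mul_nonneg hK0.le (hSmono b c h3)) (chord_in a b h1 h4 le_rfl)
          (chord_out b c le_rfl h3)
        convert this using 2 <;> ring
  · rcases le_total c b with h3 | h3
    · exact add_in a c h1 h2 h3
    · rcases le_total b a with h4 | h4
      · exact add_out a c h4 h2
      · have e1 := add_in a b h1 h4 le_rfl
        have e2 := add_out b c le_rfl h3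
        linarith
  · rcases lt_or_gt_of_ne hne with h | h
    · refine Or.inl ⟨heightSpeed A R' ρ, ?_, W.speed_sq_le_inner hs hKs h1.le (hRpow ρ h1.le h.le)⟩
      refine ((W.hasDerivAt_warpHeight ρ).sub_const L).congr_of_eventuallyEq ?_
      filter_upwards [Iio_mem_nhds h] with y hy using hZi y (le_of_lt hy)
    · refine Or.inr ⟨R' ρ, schwSlope k r₀ (R ρ) * R' ρ, ?_, ?_,
        W.speed_sq_le_outer hn hs hK1 hK h1 (hmass ρ h1.le) (hRpow' ρ h.le)⟩
      · refine (W.hasDerivAt_radius ρ h1).congr_of_eventuallyEq ?_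
        filter_upwards [Ioi_mem_nhds h] with y hy using hQo y (le_of_lt hy)
      · refine ((hasDerivAt_height hn h0 (W.strictMonoOn_radius self_mem_Ici h1.le h1)).comp ρ
          (W.hasDerivAt_radius ρ h1)).congr_of_eventuallyEq ?_
        filter_upwards [Ioi_mem_nhds h] with y hy using hZo y (le_of_lt hy)
  -- Below the seam both radii lie in [r₀, R b], and (R b)^k = (1 + s) r₀^k ≤ K^k r₀^k bounds the
  -- ratio of any two of them.
  · have hRb' : R b ≤ K * r₀ := by
      refine le_of_pow_le_pow_left₀ hn (by positivity) ?_
      rw [hRb, mul_pow]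
      refine mul_le_mul_of_nonneg_right ?_ hp0.le
      exact hKs.trans (le_self_pow₀ hK1 hn)
    rcases le_total ρ b with h | h
    · have hqρ := hq ρ hρ h
      have h1 := hR1 ρ hρ
      have h2 := hRmono hρ hb h
      rw [hQi ρ h]
      refine ⟨h0.trans_le hqρ.1, ?_, ?_⟩
      · exact hqρ.2.trans (hRb'.trans (mul_le_mul_of_nonneg_left h1 hK0.le))
      · exact h2.trans (hRb'.trans (mul_le_mul_of_nonneg_left hqρ.1 hK0.le))
    · have := W.radius_pos ρ hρ
      rw [hQo ρ h]
      exact ⟨this, by nlinarith, by nlinarith⟩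

end WarpData

end Profile

/-! ### Lipschitz curves -/

section Curves

variable {E F : Type*} [NormedAddCommGroup E] [NormedAddCommGroup F]

/-- `f` is Lipschitz on `[0,1]`. -/
def IsLip (f : ℝ → E) : Prop := ∃ K, LipschitzOnWith K f (Icc 0 1)

theorem IsLip.of_le {f : ℝ → E} {C : ℝ}
    (h : ∀ s ∈ Icc (0 : ℝ) 1, ∀ t ∈ Icc (0 : ℝ) 1, ‖f s - f t‖ ≤ C * |s - t|) : IsLip f :=
  ⟨C.toNNReal, LipschitzOnWith.of_dist_le' fun s hs t ht => by
    rw [dist_eq_norm, Real.dist_eq]; exact h s hs t ht⟩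

theorem IsLip.exists_le {f : ℝ → E} (h : IsLip f) :
    ∃ C : ℝ, 0 ≤ C ∧ ∀ s ∈ Icc (0 : ℝ) 1, ∀ t ∈ Icc (0 : ℝ) 1, ‖f s - f t‖ ≤ C * |s - t| := by
  obtain ⟨K, hK⟩ := h
  refine ⟨K, K.2, fun s hs t ht => ?_⟩
  rw [← dist_eq_norm, ← Real.dist_eq]
  exact hK.dist_le_mul s hs t ht

theorem IsLip.continuousOn {f : ℝ → E} (h : IsLip f) : ContinuousOn f (Icc 0 1) :=
  h.choose_spec.continuousOn

theorem IsLip.norm {f : ℝ → E} (h : IsLip f) : IsLip fun t => ‖f t‖ := by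
  obtain ⟨C, -, hC⟩ := h.exists_le
  exact IsLip.of_le fun s hs t ht => (abs_norm_sub_norm_le _ _).trans (hC s hs t ht)

theorem IsLip.fst {f : ℝ → E × F} (h : IsLip f) : IsLip fun t => (f t).1 := by
  obtain ⟨C, -, hC⟩ := h.exists_le
  exact IsLip.of_le fun s hs t ht => (norm_fst_le (f s - f t)).trans (hC s hs t ht)

theorem IsLip.snd {f : ℝ → E × F} (h : IsLip f) : IsLip fun t => (f t).2 := by
  obtain ⟨C, -, hC⟩ := h.exists_le
  exact IsLip.of_le fun s hs t ht => (norm_snd_le (f s - f t)).trans (hC s hs t ht)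

theorem IsLip.prodMk {f : ℝ → E} {g : ℝ → F} (hf : IsLip f) (hg : IsLip g) :
    IsLip fun t => (f t, g t) := by
  obtain ⟨C, -, hC⟩ := hf.exists_le
  obtain ⟨D, -, hD⟩ := hg.exists_le
  refine IsLip.of_le (C := max C D) fun s hs t ht => ?_
  rw [Prod.mk_sub_mk, Prod.norm_mk]
  exact max_le ((hC s hs t ht).trans (mul_le_mul_of_nonneg_right (le_max_left _ _) (abs_nonneg _)))
    ((hD s hs t ht).trans (mul_le_mul_of_nonneg_right (le_max_right _ _) (abs_nonneg _)))

variable [NormedSpace ℝ E] [NormedSpace ℝ F]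

/-- Compactness of [0, 1] keeps the norm away from 0, where radial projection is Lipschitz. -/
theorem IsLip.normalize {f : ℝ → E} (h : IsLip f) (h0 : ∀ t ∈ Icc (0 : ℝ) 1, f t ≠ 0) :
    IsLip fun t => ‖f t‖⁻¹ • f t := by
  obtain ⟨C, -, hC⟩ := h.exists_le
  obtain ⟨t₀, ht₀, hmin⟩ := isCompact_Icc.exists_isMinOn
    (nonempty_Icc.2 (zero_le_one' ℝ)) h.norm.continuousOn
  have hm : 0 < ‖f t₀‖ := norm_pos_iff.2 (h0 t₀ ht₀)
  refine IsLip.of_le (C := 2 / ‖f t₀‖ * C) fun s hs t ht => ?_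
  have h1 := norm_mul_norm_normalize_sub_le (h0 s hs) (h0 t ht)
  have h2 : ‖f t₀‖ * ‖‖f s‖⁻¹ • f s - ‖f t‖⁻¹ • f t‖ ≤ 2 * (C * |s - t|) :=
    (mul_le_mul_of_nonneg_right (hmin hs) (norm_nonneg _)).trans
      (h1.trans (mul_le_mul_of_nonneg_left (hC s hs t ht) zero_le_two))
  rw [← le_div_iff₀' hm] at h2
  refine h2.trans (le_of_eq ?_)
  ring

theorem IsLip.smul_unit {r : ℝ → ℝ} {f : ℝ → E} (hr : IsLip r) (hf : IsLip f)
    (h1 : ∀ t ∈ Icc (0 : ℝ) 1, ‖f t‖ = 1) : IsLip fun t => r t • f t := by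
  obtain ⟨C, -, hC⟩ := hr.exists_le
  obtain ⟨D, hD0, hD⟩ := hf.exists_le
  obtain ⟨M, hM⟩ := isCompact_Icc.exists_bound_of_continuousOn hr.continuousOn
  refine IsLip.of_le (C := C + M * D) fun s hs t ht => ?_
  have e : r s • f s - r t • f t = (r s - r t) • f s + r t • (f s - f t) := by
    rw [sub_smul, smul_sub]; abel
  rw [e]
  refine (norm_add_le _ _).trans ?_
  rw [norm_smul, norm_smul, h1 s hs, mul_one, add_mul, mul_assoc]
  exact add_le_add (hC s hs t ht) (mul_le_mul (hM t ht) (hD s hs t ht) (norm_nonneg _)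
    ((norm_nonneg _).trans (hM t ht)))

theorem IsLip.ae_differentiableAt [FiniteDimensional ℝ E] {f : ℝ → E} (h : IsLip f) :
    ∀ᵐ t ∂volume.restrict (Ioo (0 : ℝ) 1), DifferentiableAt ℝ f t := by
  obtain ⟨K, hK⟩ := h
  have h1 := (hK.mono Ioo_subset_Icc_self).ae_differentiableWithinAt_real measurableSet_Ioo
  filter_upwards [h1, ae_restrict_mem measurableSet_Ioo] with t ht htm
  exact ht.differentiableAt (Ioo_mem_nhds htm.1 htm.2)

/-- Almost everywhere on a level set, the derivative vanishes. -/
theorem ae_deriv_eq_zero_of_eq (f : ℝ → ℝ) (c : ℝ) :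
    ∀ᵐ t ∂(volume : Measure ℝ), f t = c → ∀ f', HasDerivAt f f' t → f' = 0 := by
  -- A nonzero derivative isolates t in the level set from the right, and such points are countable,
  -- hence null.
  have hc := countable_setOfPred_isolated_right_within (s := {t | f t = c})
  filter_upwards [compl_mem_ae_iff.2 (hc.measure_zero volume)] with t ht htc f' hf'
  by_contra hne
  refine ht ⟨htc, ?_⟩
  have h1 : ∀ᶠ z in 𝓝[>] t, f z ≠ c := (hf'.eventually_ne hne).filter_mono
    (nhdsWithin_mono t fun z hz => ne_of_gt hz)
  rw [inter_comm, nhdsWithin_inter', ← Filter.empty_mem_iff_bot, mem_inf_principal]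
  filter_upwards [h1] with z hz hzc using hz hzc

theorem curveLength_le_mul {G : E → E → ℝ} {G' : F → F → ℝ} {γ : ℝ → E} {η : ℝ → F} {K : ℝ}
    (hK : 0 ≤ K) (h : ∀ᵐ t ∂volume.restrict (Ioo (0 : ℝ) 1),
      √(G' (η t) (deriv η t)) ≤ K * √(G (γ t) (deriv γ t))) :
    curveLength G' η ≤ ENNReal.ofReal K * curveLength G γ := by
  unfold curveLength
  rw [setLIntegral_congr Ioo_ae_eq_Icc.symm, setLIntegral_congr Ioo_ae_eq_Icc.symm,
    ← lintegral_const_mul' _ _ ENNReal.ofReal_ne_top]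
  refine lintegral_mono_ae ?_
  filter_upwards [h] with t ht
  rw [← ENNReal.ofReal_mul hK]
  exact ENNReal.ofReal_le_ofReal ht

/-- If near `t` the increments of `(f, g)` are bounded by those of `s`, so are the derivatives. -/
theorem sq_add_sq_le_of_increments {f g s : ℝ → ℝ} {f' g' s' t : ℝ} (hf : HasDerivAt f f' t)
    (hg : HasDerivAt g g' t) (hs : HasDerivAt s s' t)
    (h : ∀ᶠ u in 𝓝 t, (f u - f t) ^ 2 + (g u - g t) ^ 2 ≤ (s u - s t) ^ 2) :
    f' ^ 2 + g' ^ 2 ≤ s' ^ 2 := by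
  rw [hasDerivAt_iff_tendsto_slope] at hf hg hs
  refine le_of_tendsto_of_tendsto ((hf.pow 2).add (hg.pow 2)) (hs.pow 2) ?_
  filter_upwards [h.filter_mono nhdsWithin_le_nhds] with u hu
  simp only [slope_def_field, div_pow]
  rw [← add_div]
  exact div_le_div_of_nonneg_right hu (sq_nonneg _)

end Curves

/-- Derivatives in polar coordinates. -/
theorem polar_hasDerivAt {E : Type*} [NormedAddCommGroup E] [InnerProductSpace ℝ E] {γ : ℝ → E}
    {v : E} {t : ℝ} (h : HasDerivAt γ v t) (h0 : γ t ≠ 0) :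
    HasDerivAt (fun s => ‖γ s‖) (inner ℝ (γ t) v / ‖γ t‖) t ∧
    ∃ θ' : E, HasDerivAt (fun s => ‖γ s‖⁻¹ • γ s) θ' t ∧
      ‖v‖ ^ 2 = (inner ℝ (γ t) v / ‖γ t‖) ^ 2 + ‖γ t‖ ^ 2 * ‖θ'‖ ^ 2 := by
  have hn : 0 < ‖γ t‖ := norm_pos_iff.2 h0
  have h1 : HasDerivAt (fun s => ‖γ s‖) (inner ℝ (γ t) v / ‖γ t‖) t := by
    have h2 := (h.norm_sq).sqrt (by positivity)
    simp only [Real.sqrt_sq (norm_nonneg _)] at h2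
    refine h2.congr_deriv ?_
    field_simp
  refine ⟨h1, _, (h1.inv hn.ne').smul h, ?_⟩
  have e : ‖γ t‖⁻¹ • v + (-(inner ℝ (γ t) v / ‖γ t‖) / ‖γ t‖ ^ 2) • γ t =
      ‖γ t‖⁻¹ • (v - (inner ℝ (γ t) v / ‖γ t‖ ^ 2) • γ t) := by
    rw [smul_sub, smul_smul, sub_eq_add_neg, ← neg_smul]
    congr 2
    field_simp
  simp only [Pi.inv_apply]
  rw [e, norm_smul, mul_pow, norm_inv, norm_norm, norm_sub_sq_real, norm_smul,
    real_inner_smul_right, real_inner_comm, Real.norm_eq_abs, mul_pow, sq_abs]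
  field_simp
  ring

/-! ### Comparison of length distances -/

theorem sqrt_le_mul_sqrt {x y K : ℝ} (hK : 0 ≤ K) (h : x ≤ K ^ 2 * y) : √x ≤ K * √y := by
  refine (Real.sqrt_le_sqrt h).trans (le_of_eq ?_)
  rw [Real.sqrt_mul (sq_nonneg K), Real.sqrt_sq hK]

theorem IsLip.congr {E : Type*} [NormedAddCommGroup E] {f g : ℝ → E} (h : IsLip f)
    (hfg : ∀ t ∈ Icc (0 : ℝ) 1, g t = f t) : IsLip g := by
  obtain ⟨C, -, hC⟩ := h.exists_le
  exact IsLip.of_le fun s hs t ht => by rw [hfg s hs, hfg t ht]; exact hC s hs t ht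

/-- On bounded intervals, arc length is comparable with the parameter. -/
theorem arcLength_comparable {A : ℝ → ℝ} (hA : Continuous A) (hA0 : ∀ ρ, 0 < A ρ) {M : ℝ}
    (hM : 1 ≤ M) : ∃ m N : ℝ, 0 < m ∧ 0 ≤ N ∧ ∀ a ∈ Icc 1 M, ∀ c ∈ Icc 1 M,
      m * |a - c| ≤ |arcLength A a - arcLength A c| ∧
      |arcLength A a - arcLength A c| ≤ N * |a - c| := by
  obtain ⟨x, -, hx⟩ := isCompact_Icc.exists_isMinOn (nonempty_Icc.2 hM) hA.continuousOn
  obtain ⟨y, -, hy⟩ := isCompact_Icc.exists_isMaxOn (nonempty_Icc.2 hM) hA.continuousOn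
  have hS := hasDerivAt_arcLength hA
  have hSc : ∀ s, ContinuousOn (arcLength A) s := fun s z _ =>
    (hS z).continuousAt.continuousWithinAt
  have key : ∀ a c, 1 ≤ a → a ≤ c → c ≤ M → A x * (c - a) ≤ arcLength A c - arcLength A a ∧
      arcLength A c - arcLength A a ≤ A y * (c - a) := by
    intro a c ha hac hc
    have h1 := le_of_hasDerivAt_nonneg (f := fun z => arcLength A z - A x * z)
      (f' := fun z => A z - A x * 1) hac
      ((hSc _).sub (continuousOn_id.const_mul _))
      (fun z _ => (hS z).sub ((hasDerivAt_id z).const_mul _))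
      fun z hz => by
        have : A x ≤ A z := hx ⟨ha.trans hz.1.le, hz.2.le.trans hc⟩
        linarith
    have h2 := le_of_hasDerivAt_nonneg (f := fun z => A y * z - arcLength A z)
      (f' := fun z => A y * 1 - A z) hac
      ((continuousOn_id.const_mul _).sub (hSc _))
      (fun z _ => ((hasDerivAt_id z).const_mul _).sub (hS z))
      fun z hz => by
        have : A z ≤ A y := hy ⟨ha.trans hz.1.le, hz.2.le.trans hc⟩
        linarith
    constructor <;> linarith
  refine ⟨A x, A y, hA0 x, (hA0 y).le, fun a ha c hc => ?_⟩
  rcases le_total a c with h | h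
  · obtain ⟨h1, h2⟩ := key a c ha.1 h hc.2
    have h0 : 0 ≤ arcLength A c - arcLength A a :=
      (mul_nonneg (hA0 x).le (sub_nonneg.2 h)).trans h1
    rw [abs_sub_comm, abs_sub_comm (arcLength A a), abs_of_nonneg h0,
      abs_of_nonneg (sub_nonneg.2 h)]
    exact ⟨h1, h2⟩
  · obtain ⟨h1, h2⟩ := key c a hc.1 h ha.2
    have h0 : 0 ≤ arcLength A a - arcLength A c :=
      (mul_nonneg (hA0 x).le (sub_nonneg.2 h)).trans h1
    rw [abs_of_nonneg h0, abs_of_nonneg (sub_nonneg.2 h)]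
    exact ⟨h1, h2⟩

theorem strictMono_arcLength {A : ℝ → ℝ} (hA : Continuous A) (hA0 : ∀ ρ, 0 < A ρ) :
    StrictMono (arcLength A) :=
  strictMono_of_hasDerivAt_pos (hasDerivAt_arcLength hA) hA0

/-! ### From a matching of profiles to a bi-Lipschitz bijection -/

namespace IsComparison

variable {n : ℕ} {K : ℝ} {A R Q Z : ℝ → ℝ} {T : ℝ → ℝ → Prop}

theorem chord_le' (h : IsComparison K A R T Q Z) {a c : ℝ} (ha : 1 ≤ a) (hc : 1 ≤ c) :
    (Q c - Q a) ^ 2 + (Z c - Z a) ^ 2 ≤ (K * (arcLength A c - arcLength A a)) ^ 2 := by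
  rcases le_total a c with hac | hac
  · exact h.chord_le a c ha hac
  · have := h.chord_le c a hc hac
    convert this using 1 <;> ring

theorem abs_sub_le (h : IsComparison K A R T Q Z) (hK : 0 ≤ K) {a c : ℝ} (ha : 1 ≤ a)
    (hc : 1 ≤ c) : |Q c - Q a| ≤ K * |arcLength A c - arcLength A a| ∧
      |Z c - Z a| ≤ K * |arcLength A c - arcLength A a| := by
  have h1 := h.chord_le' ha hc
  have e : K * |arcLength A c - arcLength A a| = |K * (arcLength A c - arcLength A a)| := by
    rw [abs_mul, abs_of_nonneg hK]
  rw [e]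
  exact ⟨sq_le_sq.1 (by nlinarith [sq_nonneg (Z c - Z a)]),
    sq_le_sq.1 (by nlinarith [sq_nonneg (Q c - Q a)])⟩

/-- A coarse reverse estimate, used for injectivity and for the regularity of pulled-back curves.
The loss from the sum of absolute values is harmless: the sharp constant comes from `ae_speed_le`.
-/
theorem abs_arcLength_sub_le (h : IsComparison K A R T Q Z) (hK : 0 ≤ K)
    (hA : Continuous A) (hA0 : ∀ ρ, 0 < A ρ) {a c : ℝ} (ha : 1 ≤ a) (hc : 1 ≤ c) :
    |arcLength A c - arcLength A a| ≤ K * (|Q c - Q a| + |Z c - Z a|) := by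
  have key : ∀ a c, 1 ≤ a → a ≤ c →
      |arcLength A c - arcLength A a| ≤ K * (|Q c - Q a| + |Z c - Z a|) := by
    intro a c ha hac
    rw [abs_of_nonneg (sub_nonneg.2 ((strictMono_arcLength hA hA0).monotone hac))]
    exact (h.le_add a c ha hac).trans (mul_le_mul_of_nonneg_left
      (add_le_add (le_abs_self _) (le_abs_self _)) hK)
  rcases le_total a c with hac | hac
  · exact key a c ha hac
  · have := key c a hc hac
    rwa [abs_sub_comm, abs_sub_comm (Q a), abs_sub_comm (Z a)] at this

/-- The map between the two spaces. -/
def toFun (n : ℕ) (Q Z : ℝ → ℝ) (x : V n) : V n × ℝ := (Q ‖x‖ • (‖x‖⁻¹ • x), Z ‖x‖)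

theorem norm_toFun (h : IsComparison K A R T Q Z) {x : V n} (hx : x ∈ ext n) :
    ‖(toFun n Q Z x).1‖ = Q ‖x‖ ∧
      ‖(toFun n Q Z x).1‖⁻¹ • (toFun n Q Z x).1 = ‖x‖⁻¹ • x := by
  have hx0 : 0 < ‖x‖ := one_pos.trans_le hx
  have hQ := (h.radius_le ‖x‖ hx).1
  have h1 : ‖(toFun n Q Z x).1‖ = Q ‖x‖ := by
    rw [toFun, norm_smul, norm_smul, norm_inv, norm_norm, inv_mul_cancel₀ hx0.ne', mul_one,
      Real.norm_of_nonneg hQ.le]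
  refine ⟨h1, ?_⟩
  rw [h1, toFun, smul_smul, inv_mul_cancel₀ hQ.ne', one_smul]

theorem isLip_toFun (h : IsComparison K A R T Q Z) (hK : 0 ≤ K) (hA : Continuous A)
    (hA0 : ∀ ρ, 0 < A ρ) {γ : ℝ → V n} (hγ : IsLip γ) (hmem : ∀ t ∈ Icc (0 : ℝ) 1, γ t ∈ ext n) :
    IsLip fun t => toFun n Q Z (γ t) := by
  obtain ⟨M, hM⟩ := isCompact_Icc.exists_bound_of_continuousOn hγ.continuousOn
  have h01 : (0 : ℝ) ∈ Icc (0 : ℝ) 1 := ⟨le_rfl, zero_le_one⟩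
  have hM1 : 1 ≤ M := (show 1 ≤ ‖γ 0‖ from hmem 0 h01).trans (hM 0 h01)
  obtain ⟨m, N, -, hN, hmN⟩ := arcLength_comparable hA hA0 hM1
  obtain ⟨C, -, hC⟩ := hγ.norm.exists_le
  have hI : ∀ t ∈ Icc (0 : ℝ) 1, ‖γ t‖ ∈ Icc 1 M := fun t ht => ⟨hmem t ht, hM t ht⟩
  have hS : ∀ s ∈ Icc (0 : ℝ) 1, ∀ t ∈ Icc (0 : ℝ) 1,
      K * |arcLength A ‖γ s‖ - arcLength A ‖γ t‖| ≤ K * (N * C) * |s - t| := by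
    intro s hs t ht
    rw [mul_assoc, mul_assoc]
    exact mul_le_mul_of_nonneg_left ((hmN _ (hI s hs) _ (hI t ht)).2.trans
      (mul_le_mul_of_nonneg_left (hC s hs t ht) hN)) hK
  have hQ : IsLip fun t => Q ‖γ t‖ := IsLip.of_le fun s hs t ht =>
    (h.abs_sub_le hK (hmem t ht) (hmem s hs)).1.trans (hS s hs t ht)
  have hZ : IsLip fun t => Z ‖γ t‖ := IsLip.of_le fun s hs t ht =>
    (h.abs_sub_le hK (hmem t ht) (hmem s hs)).2.trans (hS s hs t ht)
  have hne : ∀ t ∈ Icc (0 : ℝ) 1, γ t ≠ 0 := fun t ht =>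
    norm_pos_iff.1 (one_pos.trans_le (hmem t ht))
  refine (hQ.smul_unit (hγ.normalize hne) fun t ht => ?_).prodMk hZ
  rw [norm_smul, norm_inv, norm_norm, inv_mul_cancel₀ (norm_ne_zero_iff.2 (hne t ht))]

/-- Arc length along the curve is Lipschitz, hence bounded; as arc length is unbounded in ρ, the
curve stays in a compact annulus, where arc length and ρ are comparable. -/
theorem isLip_of_toFun (h : IsComparison K A R T Q Z) (hK : 0 ≤ K) (hA : Continuous A)
    (hA0 : ∀ ρ, 0 < A ρ) (hS : ∀ c, ∃ ρ, 1 ≤ ρ ∧ c < arcLength A ρ) {γ : ℝ → V n}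
    (hη : IsLip fun t => toFun n Q Z (γ t)) (hmem : ∀ t ∈ Icc (0 : ℝ) 1, γ t ∈ ext n) :
    IsLip γ := by
  obtain ⟨C, -, hC⟩ := hη.fst.norm.exists_le
  obtain ⟨D, -, hD⟩ := hη.snd.exists_le
  have hSl : IsLip fun t => arcLength A ‖γ t‖ := by
    refine IsLip.of_le (C := K * (C + D)) fun s hs t ht => ?_
    refine (h.abs_arcLength_sub_le hK hA hA0 (hmem t ht) (hmem s hs)).trans ?_
    rw [mul_assoc, add_mul]
    refine mul_le_mul_of_nonneg_left (add_le_add ?_ (hD s hs t ht)) hK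
    have := hC s hs t ht
    rwa [(h.norm_toFun (hmem s hs)).1, (h.norm_toFun (hmem t ht)).1] at this
  obtain ⟨c, hc⟩ := isCompact_Icc.exists_bound_of_continuousOn hSl.continuousOn
  obtain ⟨M, hM1, hM⟩ := hS c
  have hI : ∀ t ∈ Icc (0 : ℝ) 1, ‖γ t‖ ∈ Icc 1 M := fun t ht => ⟨hmem t ht, by
    rw [← (strictMono_arcLength hA hA0).le_iff_le]
    exact (le_abs_self _).trans ((hc t ht).trans hM.le)⟩
  obtain ⟨m, N, hm, -, hmN⟩ := arcLength_comparable hA hA0 hM1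
  obtain ⟨B, -, hB⟩ := hSl.exists_le
  have hρ : IsLip fun t => ‖γ t‖ := by
    refine IsLip.of_le (C := B / m) fun s hs t ht => ?_
    have h1 := (hmN _ (hI s hs) _ (hI t ht)).1.trans (hB s hs t ht)
    rw [← le_div_iff₀' hm] at h1
    rw [div_mul_eq_mul_div]
    exact h1
  have hne : ∀ t ∈ Icc (0 : ℝ) 1, (toFun n Q Z (γ t)).1 ≠ 0 := fun t ht =>
    norm_pos_iff.1 (by
      rw [(h.norm_toFun (hmem t ht)).1]
      exact (h.radius_le _ (hmem t ht)).1)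
  have hγ0 : ∀ t ∈ Icc (0 : ℝ) 1, ‖γ t‖ ≠ 0 := fun t ht => (one_pos.trans_le (hmem t ht)).ne'
  have hθ : IsLip fun t => ‖γ t‖⁻¹ • γ t := (hη.fst.normalize hne).congr fun t ht =>
    (h.norm_toFun (hmem t ht)).2.symm
  refine (hρ.smul_unit hθ fun t ht => ?_).congr fun t ht => ?_
  · rw [norm_smul, norm_inv, norm_norm, inv_mul_cancel₀ (hγ0 t ht)]
  · rw [smul_smul, mul_inv_cancel₀ (hγ0 t ht), one_smul]

/-- The infinitesimal comparison of the two metrics along a curve. -/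
theorem ae_speed_le (h : IsComparison K A R T Q Z) (hK : 0 ≤ K) (hA : Continuous A)
    (hR : ∀ ρ, 1 ≤ ρ → 0 < R ρ) {G : V n → V n → ℝ}
    (hG : ∀ x ∈ ext n, ∀ v, G x v = A ‖x‖ ^ 2 * (inner ℝ x v / ‖x‖) ^ 2 +
        (R ‖x‖ / ‖x‖) ^ 2 * (‖v‖ ^ 2 - (inner ℝ x v / ‖x‖) ^ 2)) {γ : ℝ → V n} (hγ : IsLip γ)
    {η : ℝ → V n × ℝ} (hη : IsLip η) (hmem : ∀ t ∈ Icc (0 : ℝ) 1, γ t ∈ ext n)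
    (hγη : ∀ t ∈ Icc (0 : ℝ) 1, η t = toFun n Q Z (γ t)) :
    ∀ᵐ t ∂volume.restrict (Ioo (0 : ℝ) 1),
      √(‖(deriv η t).1‖ ^ 2 + (deriv η t).2 ^ 2) ≤ K * √(G (γ t) (deriv γ t)) ∧
      √(G (γ t) (deriv γ t)) ≤ K * √(‖(deriv η t).1‖ ^ 2 + (deriv η t).2 ^ 2) := by
  obtain ⟨b, hb⟩ := h.exists_deriv
  -- Nothing is known of the derivatives of Q and Z at the seam b, but at almost every time spent on
  -- that sphere ‖γ‖ has zero derivative.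
  filter_upwards [hγ.ae_differentiableAt, hη.ae_differentiableAt, ae_restrict_mem measurableSet_Ioo,
    ae_restrict_of_ae (ae_deriv_eq_zero_of_eq (fun t => ‖γ t‖) b)] with t htγ htη ht htb
  have hnhds : ∀ᶠ u in 𝓝 t, u ∈ Icc (0 : ℝ) 1 := Icc_mem_nhds ht.1 ht.2
  have htI : t ∈ Icc (0 : ℝ) 1 := Ioo_subset_Icc_self ht
  have hx := hmem t htI
  have hx0 : 0 < ‖γ t‖ := one_pos.trans_le hx
  have hγd := htγ.hasDerivAt
  have hηd := htη.hasDerivAt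
  generalize deriv γ t = v at *
  generalize deriv η t = w at *
  have hη1 : HasDerivAt (fun u => (η u).1) w.1 t :=
    (hasFDerivAt_fst (𝕜 := ℝ) (p := η t)).comp_hasDerivAt t hηd
  have hη2 : HasDerivAt (fun u => (η u).2) w.2 t :=
    (hasFDerivAt_snd (𝕜 := ℝ) (p := η t)).comp_hasDerivAt t hηd
  obtain ⟨hQ0, hQR, hRQ⟩ := h.radius_le _ hx
  have hnorm : ∀ u ∈ Icc (0 : ℝ) 1, ‖(η u).1‖ = Q ‖γ u‖ := fun u hu => by
    rw [hγη u hu, (h.norm_toFun (hmem u hu)).1]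
  have hη0 : (η t).1 ≠ 0 := norm_pos_iff.1 (by rw [hnorm t htI]; exact hQ0)
  obtain ⟨hρ', θ', hθ', hv⟩ := polar_hasDerivAt hγd (norm_pos_iff.1 hx0)
  obtain ⟨hq', θ₂, hθ₂, hw⟩ := polar_hasDerivAt hη1 hη0
  -- The map preserves directions, so both curves have the same angular velocity, and only the radii
  -- weight it differently.
  have hθeq : θ₂ = θ' := by
    refine hθ₂.unique (hθ'.congr_of_eventuallyEq ?_)
    filter_upwards [hnhds] with u hu
    rw [hγη u hu, (h.norm_toFun (hmem u hu)).2]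
  subst hθeq
  rw [hG _ hx, hv]
  generalize inner ℝ (γ t) v / ‖γ t‖ = ρ' at *
  generalize inner ℝ (η t).1 w.1 / ‖(η t).1‖ = q' at *
  rw [hw, hnorm t htI]
  have hSd : HasDerivAt (fun u => arcLength A ‖γ u‖) (A ‖γ t‖ * ρ') t :=
    (hasDerivAt_arcLength hA _).comp t hρ'
  -- The chord estimate passes to the limit of difference quotients, without differentiating Q or Z.
  have hfwd : q' ^ 2 + w.2 ^ 2 ≤ (K * (A ‖γ t‖ * ρ')) ^ 2 := by
    refine sq_add_sq_le_of_increments hq' hη2 (hSd.const_mul K) ?_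
    filter_upwards [hnhds] with u hu
    rw [hnorm u hu, hnorm t htI, hγη u hu, hγη t htI, ← mul_sub]
    exact h.chord_le' hx (hmem u hu)
  have hbwd : (A ‖γ t‖ * ρ') ^ 2 ≤ K ^ 2 * (q' ^ 2 + w.2 ^ 2) := by
    by_cases h0 : ρ' = 0
    · rw [h0]
      have : 0 ≤ K ^ 2 * (q' ^ 2 + w.2 ^ 2) := by positivity
      simpa using this
    -- A time on the boundary sphere is a local minimum of ‖γ‖, where the radial velocity would
    -- vanish.
    · have h1 : 1 < ‖γ t‖ := by
        refine lt_of_le_of_ne hx fun heq => h0 ?_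
        refine IsLocalMin.hasDerivAt_eq_zero (f := fun u => ‖γ u‖) ?_ hρ'
        filter_upwards [hnhds] with u hu
        rw [← heq]
        exact hmem u hu
      have hZη : ∀ z', HasDerivAt Z z' ‖γ t‖ → w.2 = z' * ρ' := by
        intro z' hz'
        refine hη2.unique ((HasDerivAt.comp (h := fun u => ‖γ u‖) t hz' hρ').congr_of_eventuallyEq ?_)
        filter_upwards [hnhds] with u hu
        rw [hγη u hu]
        rfl
      have hQη : ∀ z', HasDerivAt Q z' ‖γ t‖ → q' = z' * ρ' := by
        intro z' hz'
        refine hq'.unique ((HasDerivAt.comp (h := fun u => ‖γ u‖) t hz' hρ').congr_of_eventuallyEq ?_)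
        filter_upwards [hnhds] with u hu
        rw [hnorm u hu]
        rfl
      rcases hb _ h1 (fun hne => h0 (htb hne _ hρ')) with ⟨z', hz', hle⟩ | ⟨p', z', hp', hz', hle⟩
      · rw [hZη z' hz', mul_pow, mul_pow z']
        have := mul_le_mul_of_nonneg_right hle (sq_nonneg ρ')
        nlinarith [mul_nonneg (sq_nonneg K) (sq_nonneg q')]
      · rw [hZη z' hz', hQη p' hp', mul_pow, mul_pow z', mul_pow p']
        have := mul_le_mul_of_nonneg_right hle (sq_nonneg ρ')
        linarith
  have hRt := hR _ hx
  have e : (R ‖γ t‖ / ‖γ t‖) ^ 2 * (ρ' ^ 2 + ‖γ t‖ ^ 2 * ‖θ₂‖ ^ 2 - ρ' ^ 2) =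
      R ‖γ t‖ ^ 2 * ‖θ₂‖ ^ 2 := by
    field_simp
    ring
  rw [e]
  constructor
  · refine sqrt_le_mul_sqrt hK ?_
    have h1 := mul_le_mul_of_nonneg_right (pow_le_pow_left₀ hQ0.le hQR 2) (sq_nonneg ‖θ₂‖)
    nlinarith
  · refine sqrt_le_mul_sqrt hK ?_
    have h1 := mul_le_mul_of_nonneg_right (pow_le_pow_left₀ hRt.le hRQ 2) (sq_nonneg ‖θ₂‖)
    nlinarith

/-- Admissible curves correspond under the map and its inverse, and each length is at most K times
the other; the infima inherit both bounds. -/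
theorem exists_equiv (h : IsComparison K A R T Q Z) (hK : 0 < K) (hA : Continuous A)
    (hA0 : ∀ ρ, 0 < A ρ) (hS : ∀ c, ∃ ρ, 1 ≤ ρ ∧ c < arcLength A ρ)
    (hR : ∀ ρ, 1 ≤ ρ → 0 < R ρ) {G : V n → V n → ℝ}
    (hG : ∀ x ∈ ext n, ∀ v, G x v = A ‖x‖ ^ 2 * (inner ℝ x v / ‖x‖) ^ 2 +
        (R ‖x‖ / ‖x‖) ^ 2 * (‖v‖ ^ 2 - (inner ℝ x v / ‖x‖) ^ 2)) {Y : Set (V n × ℝ)}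
    (hY : ∀ p, p ∈ Y ↔ T ‖p.1‖ p.2) :
    ∃ φ : ext n ≃ Y, ∀ x y,
      lengthDist (fun _ v => ‖v.1‖ ^ 2 + v.2 ^ 2) Y (φ x) (φ y) ≤
        ENNReal.ofReal K * lengthDist G (ext n) x y ∧
      lengthDist G (ext n) x y ≤
        ENNReal.ofReal K * lengthDist (fun _ v => ‖v.1‖ ^ 2 + v.2 ^ 2) Y (φ x) (φ y) := by
  have hmemY : ∀ x ∈ ext n, toFun n Q Z x ∈ Y := fun x hx => by
    rw [hY, (h.norm_toFun hx).1]
    exact h.mem _ hx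
  have hinj : Function.Injective fun x : ext n => (⟨toFun n Q Z x, hmemY x x.2⟩ : Y) := by
    rintro ⟨x, hx⟩ ⟨y, hy⟩ hxy
    have hxy' : toFun n Q Z x = toFun n Q Z y := congrArg Subtype.val hxy
    have hQ : Q ‖x‖ = Q ‖y‖ := by rw [← (h.norm_toFun hx).1, ← (h.norm_toFun hy).1, hxy']
    have hZ : Z ‖x‖ = Z ‖y‖ := congrArg Prod.snd hxy'
    have h1 := h.abs_arcLength_sub_le hK.le hA hA0 (a := ‖x‖) (c := ‖y‖) hx hy
    rw [hQ, hZ, sub_self, sub_self, abs_zero, add_zero, mul_zero] at h1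
    have hn : ‖x‖ = ‖y‖ := ((strictMono_arcLength hA hA0).injective
      (sub_eq_zero.1 (abs_nonpos_iff.1 h1))).symm
    have h2 : ‖x‖⁻¹ • x = ‖y‖⁻¹ • y := by
      rw [← (h.norm_toFun hx).2, ← (h.norm_toFun hy).2, hxy']
    have hx0 : ‖x‖ ≠ 0 := (one_pos.trans_le hx).ne'
    rw [← hn] at h2
    exact Subtype.ext (smul_right_injective _ (inv_ne_zero hx0) h2)
  have hsurj : Function.Surjective fun x : ext n => (⟨toFun n Q Z x, hmemY x x.2⟩ : Y) := by
    rintro ⟨⟨x, z⟩, hxz⟩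
    obtain ⟨ρ, hρ, hQ, hZ⟩ := h.surj _ _ ((hY _).1 hxz)
    have hx0 : 0 < ‖x‖ := hQ ▸ (h.radius_le ρ hρ).1
    have hρ0 : 0 < ρ := one_pos.trans_le hρ
    have hn : ‖ρ • (‖x‖⁻¹ • x)‖ = ρ := by
      rw [norm_smul, norm_smul, norm_inv, norm_norm, inv_mul_cancel₀ hx0.ne', mul_one,
        Real.norm_of_nonneg hρ0.le]
    have key : toFun n Q Z (ρ • (‖x‖⁻¹ • x)) = (x, z) := by
      rw [toFun, hn, show Q ρ = ‖x‖ from hQ, show Z ρ = z from hZ, inv_smul_smul₀ hρ0.ne',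
        smul_inv_smul₀ hx0.ne']
    exact ⟨⟨ρ • (‖x‖⁻¹ • x), show 1 ≤ ‖ρ • (‖x‖⁻¹ • x)‖ from hn.symm ▸ hρ⟩, Subtype.ext key⟩
  let φ := Equiv.ofBijective _ ⟨hinj, hsurj⟩
  have hφ : ∀ x : ext n, (φ x : V n × ℝ) = toFun n Q Z x := fun x => rfl
  refine ⟨φ, fun x y => ⟨?_, ?_⟩⟩
  · unfold lengthDist
    rw [ENNReal.mul_iInf_of_ne (by simpa using hK) ENNReal.ofReal_ne_top]
    refine le_iInf fun γ => ?_
    rw [ENNReal.mul_iInf_of_ne (by simpa using hK) ENNReal.ofReal_ne_top]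
    refine le_iInf fun hγ => ?_
    obtain ⟨hlip, hmem, h0, h1⟩ := hγ
    have hη := h.isLip_toFun hK.le hA hA0 hlip hmem
    refine (iInf₂_le (fun t => toFun n Q Z (γ t)) ⟨hη, fun t ht => hmemY _ (hmem t ht), ?_, ?_⟩).trans
      (curveLength_le_mul hK.le ?_)
    · filter_upwards [h.ae_speed_le hK.le hA hR hG hlip hη hmem fun t _ => rfl] with t ht using ht.1
    · exact congrArg (toFun n Q Z) h0
    · exact congrArg (toFun n Q Z) h1
  · unfold lengthDist
    rw [ENNReal.mul_iInf_of_ne (by simpa using hK) ENNReal.ofReal_ne_top]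
    refine le_iInf fun η => ?_
    rw [ENNReal.mul_iInf_of_ne (by simpa using hK) ENNReal.ofReal_ne_top]
    refine le_iInf fun hη => ?_
    obtain ⟨hlip, hmem, h0, h1⟩ := hη
    -- The value 0 outside [0, 1] is arbitrary; lengths and Lipschitz bounds are taken within [0,
    -- 1].
    let γ : ℝ → V n := fun t => if ht : t ∈ Icc (0 : ℝ) 1 then φ.symm ⟨η t, hmem t ht⟩ else 0
    have hγt : ∀ t (ht : t ∈ Icc (0 : ℝ) 1), γ t = φ.symm ⟨η t, hmem t ht⟩ := fun t ht =>
      dif_pos ht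
    have hγmem : ∀ t ∈ Icc (0 : ℝ) 1, γ t ∈ ext n := fun t ht => by
      rw [hγt t ht]
      exact (φ.symm ⟨η t, hmem t ht⟩).2
    have hγη : ∀ t ∈ Icc (0 : ℝ) 1, η t = toFun n Q Z (γ t) := fun t ht => by
      rw [hγt t ht, ← hφ, Equiv.apply_symm_apply]
    have hγlip : IsLip γ := h.isLip_of_toFun hK.le hA hA0 hS
      (IsLip.congr hlip fun t ht => (hγη t ht).symm) hγmem
    have hends : ∀ t (ht : t ∈ Icc (0 : ℝ) 1) (z : ext n), η t = φ z → γ t = z := by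
      intro t ht z hz
      rw [hγt t ht]
      have : (⟨η t, hmem t ht⟩ : Y) = φ z := Subtype.ext hz
      rw [this, Equiv.symm_apply_apply]
    refine (iInf₂_le γ ⟨hγlip, hγmem, hends 0 ⟨le_rfl, zero_le_one⟩ x h0,
      hends 1 ⟨zero_le_one, le_rfl⟩ y h1⟩).trans (curveLength_le_mul hK.le ?_)
    filter_upwards [h.ae_speed_le hK.le hA hR hG hγlip hlip hγmem hγη] with t ht using ht.2

end IsComparison

/-! ### Bounding the Lipschitz distance -/

/-- The reverse inequality, tested on one pair of points with positive quotient, gives dilation at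
least 1/K; this controls the logarithm from below. -/
theorem dil_le_and_abs_log_le {X Y : Type*} {dX : X → X → ℝ≥0∞} {dY : Y → Y → ℝ≥0∞} {K : ℝ}
    (hK : 1 ≤ K) (φ : X → Y) (h₁ : ∀ x y, dY (φ x) (φ y) ≤ ENNReal.ofReal K * dX x y)
    (h₂ : ∀ x y, dX x y ≤ ENNReal.ofReal K * dY (φ x) (φ y)) :
    dil dX dY φ ≤ ENNReal.ofReal K ∧ |Real.log (dil dX dY φ).toReal| ≤ Real.log K := by
  have hK0 : 0 < K := one_pos.trans_le hK
  have hlog : 0 ≤ Real.log K := Real.log_nonneg hK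
  have hle : dil dX dY φ ≤ ENNReal.ofReal K :=
    iSup_le fun x => iSup_le fun y => iSup_le fun _ => ENNReal.div_le_of_le_mul (h₁ x y)
  refine ⟨hle, ?_⟩
  have htop : dil dX dY φ ≠ ⊤ := (hle.trans_lt ENNReal.ofReal_lt_top).ne
  have hle' : (dil dX dY φ).toReal ≤ K := ENNReal.toReal_le_of_le_ofReal hK0.le hle
  -- A vanishing dilation is harmless by the convention log 0 = 0.
  by_cases h0 : dil dX dY φ = 0
  · simpa [h0] using hlog
  obtain ⟨x, y, hxy, hpos⟩ : ∃ x y, x ≠ y ∧ 0 < dY (φ x) (φ y) / dX x y := by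
    by_contra! hcon
    exact h0 (le_antisymm (iSup_le fun x => iSup_le fun y => iSup_le fun hxy => hcon x y hxy)
      bot_le)
  have hdil : dY (φ x) (φ y) / dX x y ≤ dil dX dY φ :=
    le_iSup_of_le x (le_iSup_of_le y (le_iSup_of_le hxy le_rfl))
  obtain ⟨hY0, hXtop⟩ := ENNReal.div_pos_iff.1 hpos
  have hX0 : dX x y ≠ 0 := fun hX => by
    rw [hX, ENNReal.div_zero hY0] at hdil
    exact htop (top_le_iff.1 hdil)
  have hge : ENNReal.ofReal K⁻¹ ≤ dil dX dY φ := by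
    refine le_trans ?_ hdil
    rw [ENNReal.le_div_iff_mul_le (Or.inl hX0) (Or.inl hXtop), ENNReal.ofReal_inv_of_pos hK0]
    calc (ENNReal.ofReal K)⁻¹ * dX x y
        ≤ (ENNReal.ofReal K)⁻¹ * (ENNReal.ofReal K * dY (φ x) (φ y)) := by gcongr; exact h₂ x y
      _ = dY (φ x) (φ y) := by
        rw [← mul_assoc, ENNReal.inv_mul_cancel (by simpa using hK0) ENNReal.ofReal_ne_top, one_mul]
  have hge' : K⁻¹ ≤ (dil dX dY φ).toReal := (ENNReal.ofReal_le_iff_le_toReal htop).1 hge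
  have hpos' : 0 < (dil dX dY φ).toReal := (inv_pos.2 hK0).trans_le hge'
  rw [abs_le, ← Real.log_inv]
  exact ⟨Real.log_le_log (inv_pos.2 hK0) hge', Real.log_le_log hpos' hle'⟩

theorem lipschitzDist_le {X Y : Type*} {dX : X → X → ℝ≥0∞} {dY : Y → Y → ℝ≥0∞} {K : ℝ}
    (hK : 1 ≤ K) (φ : X ≃ Y) (h₁ : ∀ x y, dY (φ x) (φ y) ≤ ENNReal.ofReal K * dX x y)
    (h₂ : ∀ x y, dX x y ≤ ENNReal.ofReal K * dY (φ x) (φ y)) :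
    lipschitzDist dX dY ≤ ENNReal.ofReal (2 * Real.log K) := by
  obtain ⟨ha, hb⟩ := dil_le_and_abs_log_le hK φ h₁ h₂
  obtain ⟨hc, hd⟩ := dil_le_and_abs_log_le (dX := dY) (dY := dX) hK φ.symm
    (fun x y => by simpa using h₂ (φ.symm x) (φ.symm y))
    fun x y => by simpa using h₁ (φ.symm x) (φ.symm y)
  refine (iInf₂_le φ ⟨ha.trans_lt ENNReal.ofReal_lt_top, hc.trans_lt ENNReal.ofReal_lt_top⟩).trans
    (ENNReal.ofReal_le_ofReal ?_)
  linarith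

/-! ### Masses and depth in terms of the warping functions -/

section Warp

variable {n : ℕ} {g : MetricTensor n} {A R R' : ℝ → ℝ}

theorem WarpData.exists_arcLength_gt (W : WarpData n A R R') (hn : n - 2 ≠ 0) (c : ℝ) :
    ∃ ρ, 1 ≤ ρ ∧ c < arcLength A ρ := by
  obtain ⟨ρ, hρ, h⟩ := W.unbounded (c + R 1 - arcLength A 1)
  refine ⟨ρ, hρ, ?_⟩
  have h1 := W.chord_le_outer hn le_rfl hρ
  have h2 : 0 ≤ arcLength A ρ - arcLength A 1 :=
    sub_nonneg.2 ((strictMono_arcLength W.continuous_speed W.speed_pos).monotone hρ)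
  have h3 : R ρ - R 1 ≤ arcLength A ρ - arcLength A 1 :=
    le_of_sq_le_sq (by
      linarith [sq_nonneg (height (n - 2) (R 1) (R ρ) - height (n - 2) (R 1) (R 1))]) h2
  linarith

theorem WarpData.exists_radius_eq (W : WarpData n A R R') {r : ℝ} (hr : R 1 ≤ r) :
    ∃ b, 1 ≤ b ∧ R b = r := by
  obtain ⟨M, hM, h⟩ := W.unbounded r
  obtain ⟨b, hb, hbr⟩ := intermediate_value_Icc hM
    (W.continuousOn_radius.mono fun x hx => hx.1) ⟨hr, h.le⟩
  exact ⟨b, hb.1, hbr⟩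

theorem deriv_areaRadius (W : WarpData n A R R') (hR : ∀ ρ, 1 ≤ ρ → areaRadius g ρ = R ρ) {ρ : ℝ}
    (hρ : 1 < ρ) : deriv (areaRadius g) ρ = R' ρ := by
  refine ((W.hasDerivAt_radius ρ hρ).congr_of_eventuallyEq ?_).deriv
  filter_upwards [Ioi_mem_nhds hρ] with u hu using hR u (le_of_lt hu)

theorem hawkingMass_eq (W : WarpData n A R R') (hR : ∀ ρ, 1 ≤ ρ → areaRadius g ρ = R ρ)
    (hA : ∀ ρ, 1 ≤ ρ → radialSpeed g ρ = A ρ) {ρ : ℝ} (hρ : 1 < ρ) :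
    hawkingMass g ρ = 1 / 2 * (R ρ ^ (n - 2) * (1 - (R' ρ / A ρ) ^ 2)) := by
  rw [hawkingMass, hR ρ hρ.le, hA ρ hρ.le, deriv_areaRadius W hR hρ]
  ring

/-- Monotonicity makes the limit exist in the extended reals, as a supremum, so `limUnder` is a
genuine limit. -/
theorem hawkingMass_le_admMass (W : WarpData n A R R')
    (hR : ∀ ρ, 1 ≤ ρ → areaRadius g ρ = R ρ) (hA : ∀ ρ, 1 ≤ ρ → radialSpeed g ρ = A ρ) {ρ : ℝ}
    (hρ : 1 < ρ) : (hawkingMass g ρ : EReal) ≤ admMass g := by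
  have hmono : ∀ a c, 1 < a → a ≤ c → hawkingMass g a ≤ hawkingMass g c := by
    intro a c ha hac
    have hc := ha.trans_le hac
    rw [hawkingMass_eq W hR hA ha, hawkingMass_eq W hR hA hc]
    have := W.mass_mono ha.le hc.le hac
    dsimp only at this
    linarith
  -- The cut-off at 2 stays off the boundary, where the two-sided derivative of `areaRadius` is not
  -- controlled.
  have hm : Monotone fun ρ => (hawkingMass g (max 2 ρ) : EReal) := fun a c hac =>
    EReal.coe_le_coe_iff.2 (hmono _ _ (lt_max_of_lt_left one_lt_two) (max_le_max_left 2 hac))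
  have ht : Tendsto (fun ρ => (hawkingMass g ρ : EReal)) atTop
      (𝓝 (⨆ ρ, (hawkingMass g (max 2 ρ) : EReal))) := by
    refine (tendsto_atTop_iSup hm).congr' ?_
    filter_upwards [Ici_mem_atTop (2 : ℝ)] with ρ hρ
    rw [max_eq_right hρ]
  rw [admMass, ht.limUnder_eq]
  refine le_trans ?_ (le_iSup (fun ρ => (hawkingMass g (max 2 ρ) : EReal)) ρ)
  exact EReal.coe_le_coe_iff.2 (hmono _ _ hρ (le_max_right _ _))

theorem mZero_eq (hn : 3 ≤ n) (h0 : 0 < R 1) (h : boundaryArea g / omega n = R 1 ^ (n - 1)) :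
    (boundaryArea g / omega n) ^ (((n : ℝ) - 2) / ((n : ℝ) - 1)) = R 1 ^ (n - 2) := by
  obtain ⟨k, rfl⟩ : ∃ k, n = k + 2 := ⟨n - 2, by omega⟩
  have hk : ((k + 2 : ℕ) : ℝ) - 1 ≠ 0 := by
    rw [show ((k + 2 : ℕ) : ℝ) - 1 = k + 1 by push_cast; ring]
    positivity
  rw [h, ← Real.rpow_natCast, ← Real.rpow_mul h0.le, ← Real.rpow_natCast]
  congr 1
  have e1 : ((k + 2 - 1 : ℕ) : ℝ) = ((k + 2 : ℕ) : ℝ) - 1 := by push_cast; ring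
  have e2 : ((k + 2 - 2 : ℕ) : ℝ) = ((k + 2 : ℕ) : ℝ) - 2 := by push_cast; ring
  rw [e1, e2, mul_div_cancel₀ _ hk]

theorem pow_rpow_one_div {r : ℝ} (hn : 3 ≤ n) (hr : 0 ≤ r) :
    (r ^ (n - 2)) ^ (1 / ((n : ℝ) - 2)) = r := by
  have e : ((n : ℝ) - 2) = ((n - 2 : ℕ) : ℝ) := by
    rw [Nat.cast_sub (by omega)]
    norm_num
  rw [e, one_div, Real.pow_rpow_inv_natCast hr (by omega)]

theorem rpow_one_div_pow {r : ℝ} (hn : 3 ≤ n) (hr : 0 ≤ r) :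
    (r ^ (1 / ((n : ℝ) - 2))) ^ (n - 2) = r := by
  have e : ((n : ℝ) - 2) = ((n - 2 : ℕ) : ℝ) := by
    rw [Nat.cast_sub (by omega)]
    norm_num
  rw [e, one_div, Real.rpow_inv_natCast_pow hr (by omega)]

theorem horizonRadius_eq (hn : 3 ≤ n) {r₀ : ℝ} (h0 : 0 ≤ r₀) :
    horizonRadius n (1 / 2 * r₀ ^ (n - 2)) = r₀ := by
  rw [horizonRadius, ← mul_assoc, mul_one_div_cancel two_ne_zero, one_mul, pow_rpow_one_div hn h0]

theorem schwHeight_eq (hn : 3 ≤ n) {r₀ : ℝ} (h0 : 0 ≤ r₀) (r : ℝ) :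
    schwHeight n (1 / 2 * r₀ ^ (n - 2)) r = height (n - 2) r₀ r := by
  rw [schwHeight, horizonRadius_eq hn h0, ← mul_assoc, mul_one_div_cancel two_ne_zero, one_mul]
  rfl

theorem mem_schwSpace_iff (hn : 3 ≤ n) {r₀ : ℝ} (h0 : 0 ≤ r₀) (L : ℝ) (p : V n × ℝ) :
    p ∈ schwSpace n (1 / 2 * r₀ ^ (n - 2)) L ↔ IsSchwProfile (n - 2) r₀ L ‖p.1‖ p.2 := by
  simp only [schwSpace, mem_ofPred_eq, horizonRadius_eq hn h0, schwHeight_eq hn h0, IsSchwProfile]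

theorem graphHeight_eq (W : WarpData n A R R') (hR : ∀ ρ, 1 ≤ ρ → areaRadius g ρ = R ρ)
    (hA : ∀ ρ, 1 ≤ ρ → radialSpeed g ρ = A ρ) {b : ℝ} (hb : 1 ≤ b) :
    graphHeight g b = warpHeight A R' b := by
  refine intervalIntegral.integral_congr_ae (Eventually.of_forall fun t ht => ?_)
  -- The half-open interval omits t = 1, the one point where that derivative is unknown.
  rw [uIoc_of_le hb] at ht
  rw [hA t ht.1.le, deriv_areaRadius W hR ht.1, heightSpeed, max_eq_right ht.1.le]

theorem rhoDelta_eq (W : WarpData n A R R') (hR : ∀ ρ, 1 ≤ ρ → areaRadius g ρ = R ρ) {b : ℝ}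
    (hb : 1 ≤ b) (h : R b = rDelta g) : rhoDelta g = b := by
  have : {ρ | 1 ≤ ρ ∧ areaRadius g ρ = rDelta g} = {b} := by
    ext ρ
    constructor
    · rintro ⟨h1, h2⟩
      rw [hR ρ h1, ← h] at h2
      exact W.strictMonoOn_radius.injOn h1 hb h2
    · rintro rfl
      exact ⟨hb, (hR ρ hb).trans h⟩
  rw [rhoDelta, this, csInf_singleton]

/-- The seam is placed by the actual excess s = √`massExcess`, while K comes from the uniform bound
s₀ ≥ s. -/
theorem WarpData.depth_nonneg_and_lipschitzDist_le (W : WarpData n A R R') (hn : 3 ≤ n)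
    (hR : ∀ ρ, 1 ≤ ρ → areaRadius g ρ = R ρ) (hA : ∀ ρ, 1 ≤ ρ → radialSpeed g ρ = A ρ)
    (hG : ∀ x ∈ ext n, ∀ v, normSq g x v = A ‖x‖ ^ 2 * (inner ℝ x v / ‖x‖) ^ 2 +
        (R ‖x‖ / ‖x‖) ^ 2 * (‖v‖ ^ 2 - (inner ℝ x v / ‖x‖) ^ 2))
    (hbd : boundaryArea g / omega n = R 1 ^ (n - 1)) {s₀ : ℝ} (hs₀ : 0 ≤ s₀) (hs₁ : s₀ < 1)
    (hm : admMass g ≤ (((1 + s₀ ^ 2) / 2 * R 1 ^ (n - 2) : ℝ) : EReal)) :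
    0 ≤ depth g ∧ lipschitzDist (gDist g) (schwDist n (mZero g) (depth g)) ≤
      ENNReal.ofReal (2 * Real.log (1 - s₀)⁻¹) := by
  have h0 : 0 < R 1 := W.radius_pos 1 self_mem_Ici
  have hp : 0 < R 1 ^ (n - 2) := pow_pos h0 _
  have hn2 : n - 2 ≠ 0 := by omega
  have hm0 : mZero g = 1 / 2 * R 1 ^ (n - 2) := by rw [mZero, mZero_eq hn h0 hbd]
  have hge : ∀ ρ, 1 < ρ → ((1 / 2 * (R ρ ^ (n - 2) * (1 - (R' ρ / A ρ) ^ 2)) : ℝ) : EReal) ≤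
      admMass g := fun ρ hρ => hawkingMass_eq W hR hA hρ ▸ hawkingMass_le_admMass W hR hA hρ
  have htop : admMass g ≠ ⊤ := (hm.trans_lt (EReal.coe_lt_top _)).ne
  have hbot : admMass g ≠ ⊥ := ((EReal.bot_lt_coe _).trans_le (hge 2 one_lt_two)).ne'
  set μ := (admMass g).toReal with hμ
  have hμe : admMass g = (μ : EReal) := (EReal.coe_toReal htop hbot).symm
  rw [hμe] at hge hm
  have hge' : ∀ ρ, 1 < ρ → R ρ ^ (n - 2) * (1 - (R' ρ / A ρ) ^ 2) ≤ 2 * μ := fun ρ hρ => by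
    have := EReal.coe_le_coe_iff.1 (hge ρ hρ)
    linarith
  have hm' : μ ≤ (1 + s₀ ^ 2) / 2 * R 1 ^ (n - 2) := EReal.coe_le_coe_iff.1 hm
  -- The bound is carried to ρ = 1 by comparison with the mass at ρ + 1.
  have hge₁ : ∀ ρ, 1 ≤ ρ → R ρ ^ (n - 2) * (1 - (R' ρ / A ρ) ^ 2) ≤ 2 * μ := fun ρ hρ =>
    (W.mass_mono hρ (show (1 : ℝ) ≤ ρ + 1 by linarith) (by linarith)).trans
      (hge' (ρ + 1) (by linarith))
  have hμ1 : R 1 ^ (n - 2) ≤ 2 * μ := (W.pow_le_mass le_rfl).trans (hge₁ 1 le_rfl)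
  have hex : (1 + massExcess g) * R 1 ^ (n - 2) = 2 * μ := by
    rw [massExcess, ← hμ, hm0]
    field_simp
    ring
  have hex0 : 0 ≤ massExcess g := by
    by_contra! hcon
    nlinarith
  have hex1 : massExcess g ≤ s₀ ^ 2 := by
    by_contra! hcon
    nlinarith
  set s := √(massExcess g) with hs
  have hs0 : 0 ≤ s := Real.sqrt_nonneg _
  have hss : s ^ 2 = massExcess g := Real.sq_sqrt hex0
  have hsle : s ≤ s₀ := Real.sqrt_le_iff.2 ⟨hs₀, hex1⟩
  have hrD : rDelta g = (1 + s) ^ (1 / ((n : ℝ) - 2)) * R 1 := by rw [rDelta, hR 1 le_rfl]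
  have hrDp : rDelta g ^ (n - 2) = (1 + s) * R 1 ^ (n - 2) := by
    rw [hrD, mul_pow, rpow_one_div_pow hn (by linarith)]
  have hrD1 : R 1 ≤ rDelta g := by
    rw [hrD]
    have : (3 : ℝ) ≤ n := by exact_mod_cast hn
    exact le_mul_of_one_le_left h0.le
      (Real.one_le_rpow (by linarith) (one_div_nonneg.2 (by linarith)))
  obtain ⟨b, hb, hRb⟩ := W.exists_radius_eq hrD1
  have hdepth : depth g = warpHeight A R' b - height (n - 2) (R 1) (R b) := by
    rw [depth, rhoDelta_eq W hR hb hRb, graphHeight_eq W hR hA hb, hm0, schwHeight_eq hn h0.le, hRb]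
  refine ⟨hdepth ▸ sub_nonneg.2 (W.height_le_warpHeight hn2 hb), ?_⟩
  have hK0 : 0 < (1 - s₀)⁻¹ := inv_pos.2 (by linarith)
  have hK1 : 1 ≤ (1 - s₀)⁻¹ := one_le_inv_iff₀.2 ⟨by linarith, by linarith⟩
  have hK : 1 ≤ (1 - s₀)⁻¹ * (1 - s) := by
    rw [← div_eq_inv_mul, one_le_div (by linarith)]
    linarith
  obtain ⟨Q, Z, hQZ⟩ := W.exists_comparison hn2 hs0 hK (hsle.trans_lt hs₁)
    (fun ρ hρ => by rw [hss, hex]; exact hge₁ ρ hρ) hb (by rw [hRb, hrDp])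
  rw [← hdepth] at hQZ
  obtain ⟨φ, hφ⟩ := hQZ.exists_equiv hK0 W.continuous_speed W.speed_pos
    (W.exists_arcLength_gt hn2) W.radius_pos hG
    (Y := schwSpace n (mZero g) (depth g)) (by rw [hm0]; exact mem_schwSpace_iff hn h0.le _)
  exact lipschitzDist_le hK1 φ (fun x y => (hφ x y).1) fun x y => (hφ x y).2

end Warp

end

end Penrose

/-! ### The stability theorem -/

theorem mainTheorem2 (n : ℕ) (hn : 3 ≤ n) (ε : ℝ) (hε : 0 < ε) :
    ∃ δ : ℝ, 0 < δ ∧ ∀ g : Penrose.MetricTensor n, Penrose.IsRotSym g → Penrose.UnboundedRadii g →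
      Penrose.admMass g ≤ (((1 + δ) / 2 * (Penrose.boundaryArea g / Penrose.omega n) ^
          (((n : ℝ) - 2) / ((n : ℝ) - 1)) : ℝ) : EReal) →
      0 ≤ Penrose.depth g ∧
      Penrose.lipschitzDist (Penrose.gDist g)
        (Penrose.schwDist n (Penrose.mZero g) (Penrose.depth g)) < ENNReal.ofReal ε := by
  have he : Real.exp (-(ε / 3)) < 1 := Real.exp_lt_one_iff.2 (by linarith)
  have hs0 : 0 < 1 - Real.exp (-(ε / 3)) := by linarith
  have hs1 : 1 - Real.exp (-(ε / 3)) < 1 := by linarith [Real.exp_pos (-(ε / 3))]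
  -- Here δ = s₀² with s₀ = 1 - exp(-ε/3), so K = exp(ε/3) and 2 log K = 2ε/3 < ε.
  refine ⟨(1 - Real.exp (-(ε / 3))) ^ 2, by positivity, fun g hg hu hm => ?_⟩
  obtain ⟨A, R, R', W, hR, hA, hG, hbd⟩ := hg.exists_warpData hn hu
  rw [Penrose.mZero_eq hn (W.radius_pos 1 Set.self_mem_Ici) hbd] at hm
  obtain ⟨h1, h2⟩ := W.depth_nonneg_and_lipschitzDist_le hn hR hA hG hbd hs0.le hs1 hm
  refine ⟨h1, h2.trans_lt ((ENNReal.ofReal_lt_ofReal_iff hε).2 ?_)⟩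
  rw [sub_sub_cancel, Real.log_inv, Real.log_exp]
  linarith
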